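/- Setting. Let $\mathcal X\subset\mathbb R^d$, let $f\sim\mathcal{GP}(0,k)$ be a centred Gaussian process on $\mathcal X$ with stationary kernel $k$ satisfying $k(\mathbf x,\mathbf x)=1$, and let $\epsilon_1,\epsilon_2,\dots$ be i.i.d. $\mathcal N(0,\sigma^2)$, $\sigma>0$, independent of $f$. Let $\mathbf x^*\in\arg\max_{\mathbf x\in\mathcal X}f(\mathbf x)$. At step $t\ge 1$ an algorithm queries $\mathbf x_t\in\mathcal X$ and observes $y_t=f(\mathbf x_t)+\epsilon_t$. Given $\mathcal D_{t-1}=\{(\mathbf x_i,y_i)\}_{i<t}$, let $\mathbf k_{t-1}(\mathbf x)=(k(\mathbf x,\mathbf x_i))_{i<t}$, $\mathbf K=(k(\mathbf x_i,\mathbf x_j))_{i,j<t}$, $\mathbf y_{t-1}=(y_i)_{i<t}$, and $$\mu_{t-1}(\mathbf x)=\mathbf k_{t-1}(\mathbf x)^\top(\mathbf K+\sigma^2\mathbf I)^{-1}\mathbf y_{t-1},\qquad \sigma_{t-1}^2(\mathbf x)=k(\mathbf x,\mathbf x)-\mathbf k_{t-1}(\mathbf x)^\top(\mathbf K+\sigma^2\mathbf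 I)^{-1}\mathbf k_{t-1}(\mathbf x).$$ GP-UCB with parameters $(\beta_t)_{t\ge1}$ chooses $\mathbf x_t\in\arg\max_{\mathbf x\in\mathcal X}\mu_{t-1}(\mathbf x)+\beta_t^{1/2}\sigma_{t-1}(\mathbf x)$, ties being broken by a measurable function of $\mathcal D_{t-1}$. Let $\mathrm{BCR}_T=\mathbb E\bigl[\sum_{t=1}^T(f(\mathbf x^*)-f(\mathbf x_t))\bigr]$, $C_1=2/\log(1+\sigma^{-2})$, and let $\gamma_T=\sup I(\mathbf y_A;\mathbf f_A)$, the supremum over all $A=(\mathbf a_1,\dots,\mathbf a_T)\in\mathcal X^T$ (repetitions allowed), where $\mathbf f_A=(f(\mathbf a_i))_{i\le T}$, $\mathbf y_A=(f(\mathbf a_i)+\epsilon_i)_{i\le T}$ and $I$ is Shannon mutual information. Square roots of negative numbers are read as $0$ (this concerns only degenerate parameter values where $\beta_t<0$ or $\log(ad)<0$). Theorem. In both cases below, for every $T$, $\gamma_T<\infty$ and the cumulative regret is integrable. (i) If $\mathcal X$ is finite, GP-UCB with $\beta_t=2\log\bigl(|\mathcal X|t^2/\sqrt{2\pi}\bigr)$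 satisfies $$\mathrm{BCR}_T\le\frac{\pi^2}{6}+\sqrt{C_1T\beta_T\gamma_T}.$$ (ii) Let $\mathcal X$ be infinite, compact and convex with $\mathcal X\subset[0,r]^d$, $r>0$. Suppose that almost every sample path of $f$ is differentiable on $\mathcal X$ and that there are $a,b>0$ such that $\Pr\bigl(\sup_{\mathbf x\in\mathcal X}|\partial f/\partial x_j|>L\bigr)\le a\exp(-(L/b)^2)$ for all $L>0$ and $j=1,\dots,d$. Then GP-UCB with $$\beta_t=2d\log\Bigl(bdrt^2\bigl(\sqrt{\log(ad)}+\sqrt\pi/2\bigr)\Bigr)+2\log\bigl(t^2/\sqrt{2\pi}\bigr)$$ satisfies $$\mathrm{BCR}_T\le\frac{\pi^2}{3}+\sqrt{C_1T\beta_T\gamma_T}.$$ Moreover, for fixed $d,r,b,t$, this $\beta_t$ is $O(\log\log a)$ as $a\to\infty$. -/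

import Mathlib

open MeasureTheory ProbabilityTheory InformationTheory
open scoped NNReal ENNReal

noncomputable section

namespace GPUCB

/-- Points of `ℝ^d`. -/
abbrev Pt (d : ℕ) : Type := EuclideanSpace ℝ (Fin d)

/-- A data set `{(x_i, y_i)}` of `n` query/observation pairs. -/
abbrev Data (d n : ℕ) : Type := Fin n → Pt d × ℝ

/-! ### The GP posterior and the upper confidence bound -/

/-- The vector `(k(x, x_1), …, k(x, x_n))`. -/
def kernelVec {d n : ℕ} (k : Pt d → Pt d → ℝ) (D : Data d n) (x : Pt d) : Fin n → ℝ :=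
  fun i => k x (D i).1

/-- The matrix `K + s² I` with `K_{ij} = k(x_i, x_j)`. -/
def regKernelMatrix {d n : ℕ} (k : Pt d → Pt d → ℝ) (s : ℝ≥0) (D : Data d n) :
    Matrix (Fin n) (Fin n) ℝ :=
  Matrix.of (fun i j => k (D i).1 (D j).1) + ((s : ℝ) ^ 2) • (1 : Matrix (Fin n) (Fin n) ℝ)

/-- Posterior mean of `f(x)` given the data `D`, for the noise variance `s²`. -/
def postMean {d n : ℕ} (k : Pt d → Pt d → ℝ) (s : ℝ≥0) (D : Data d n) (x : Pt d) : ℝ :=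
  kernelVec k D x ⬝ᵥ ((regKernelMatrix k s D)⁻¹).mulVec (fun i => (D i).2)

/-- Posterior variance of `f(x)` given the data `D`, for the noise variance `s²`. -/
def postVar {d n : ℕ} (k : Pt d → Pt d → ℝ) (s : ℝ≥0) (D : Data d n) (x : Pt d) : ℝ :=
  k x x - kernelVec k D x ⬝ᵥ ((regKernelMatrix k s D)⁻¹).mulVec (kernelVec k D x)

/-- The upper confidence bound `μ(x) + β^{1/2} σ(x)` computed from the data `D`. -/
def ucb {d n : ℕ} (k : Pt d → Pt d → ℝ) (s : ℝ≥0) (β : ℝ) (D : Data d n) (x : Pt d) : ℝ :=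
  postMean k s D x + Real.sqrt β * Real.sqrt (postVar k s D x)

/-! ### The algorithm and its run -/

/-- A decision rule: the next query point as a function of the data collected so far. -/
abbrev Rule (d : ℕ) : Type := (n : ℕ) → Data d n → Pt d

/-- `π` is a GP-UCB rule with confidence parameters `β_1, β_2, …`: after `n` observations the query
`x_{n+1}` maximizes over `X` the upper confidence bound with parameter `β_{n+1}`. Ties may be broken
by an arbitrary measurable function of the data. -/
structure IsGPUCB {d : ℕ} (X : Set (Pt d)) (k : Pt d → Pt d → ℝ) (s : ℝ≥0) (β : ℕ → ℝ)
    (π : Rule d) : Prop where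
  measurable : ∀ n, Measurable (π n)
  mem : ∀ (n : ℕ) (D : Data d n), (∀ i, (D i).1 ∈ X) → π n D ∈ X
  isMaxOn : ∀ (n : ℕ) (D : Data d n), (∀ i, (D i).1 ∈ X) →
    IsMaxOn (ucb k s (β (n + 1)) D) X (π n D)

/-- The data set after `n` steps of running `π` on the objective `f` with noise `ε`;
step `n + 1` queries `π n` of the current data and observes `f` there with the noise `ε n`. -/
def history {d : ℕ} {Ω : Type*} (π : Rule d) (f : Pt d → Ω → ℝ) (ε : ℕ → Ω → ℝ) (ω : Ω) :
    (n : ℕ) → Data d n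
  | 0 => Fin.elim0
  | n + 1 =>
    Fin.snoc (α := fun _ => Pt d × ℝ) (history π f ε ω n)
      (π n (history π f ε ω n), f (π n (history π f ε ω n)) ω + ε n ω)

/-- The query point `x_{n+1}`. -/
def query {d : ℕ} {Ω : Type*} (π : Rule d) (f : Pt d → Ω → ℝ) (ε : ℕ → Ω → ℝ) (n : ℕ) (ω : Ω) :
    Pt d :=
  π n (history π f ε ω n)

/-- The cumulative regret `∑_{t=1}^T (f(x^*) - f(x_t))` as a random variable. -/
def cumRegret {d : ℕ} {Ω : Type*} (π : Rule d) (f : Pt d → Ω → ℝ) (ε : ℕ → Ω → ℝ)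
    (xstar : Ω → Pt d) (T : ℕ) (ω : Ω) : ℝ :=
  ∑ n ∈ Finset.range T, (f (xstar ω) ω - f (query π f ε n ω) ω)

/-- The Bayesian cumulative regret: the expectation of the cumulative regret. -/
def bcr {d : ℕ} {Ω : Type*} [MeasurableSpace Ω] (P : Measure Ω) (π : Rule d) (f : Pt d → Ω → ℝ)
    (ε : ℕ → Ω → ℝ) (xstar : Ω → Pt d) (T : ℕ) : ℝ :=
  ∫ ω, cumRegret π f ε xstar T ω ∂P

/-! ### The probabilistic model -/

/-- `f ∼ GP(0, k)` on `X`, and `ε` is i.i.d. `N(0, s²)` noise, independent of `f`.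
Only the values of `f` and `k` on `X` matter. -/
structure IsGPModel {d : ℕ} {Ω : Type*} [MeasurableSpace Ω] (P : Measure Ω) (X : Set (Pt d))
    (k : Pt d → Pt d → ℝ) (s : ℝ≥0) (f : Pt d → Ω → ℝ) (ε : ℕ → Ω → ℝ) : Prop where
  measurable_f : ∀ x ∈ X, Measurable (f x)
  measurable_noise : ∀ n, Measurable (ε n)
  gaussian : IsGaussianProcess (fun x : X => f x) P
  mean : ∀ x ∈ X, ∫ ω, f x ω ∂P = 0
  cov : ∀ x ∈ X, ∀ y ∈ X, cov[f x, f y; P] = k x y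
  noise_law : ∀ n, P.map (ε n) = gaussianReal 0 (s ^ 2)
  noise_indep : iIndepFun ε P
  indep : IndepFun (fun ω (x : X) => f x ω) (fun ω (n : ℕ) => ε n ω) P

/-- `k` is stationary on `X`: `k(x, y)` depends only on `x - y`. -/
def IsStationaryOn {d : ℕ} (X : Set (Pt d)) (k : Pt d → Pt d → ℝ) : Prop :=
  ∃ φ : Pt d → ℝ, ∀ x ∈ X, ∀ y ∈ X, k x y = φ (x - y)

/-- The regularity assumption for continuous domains: `X ⊆ [0, r]^d` is compact and convex, almost
every sample path of `f` is differentiable on `X` (with derivative `G ω x` at `x`, which is unique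
when `X` has non-empty interior), and the suprema of its partial derivatives satisfy
`Pr(sup_{x ∈ X} |∂f/∂x_j| > L) ≤ a exp(-(L/b)²)`. -/
structure DerivTail {d : ℕ} {Ω : Type*} [MeasurableSpace Ω] (P : Measure Ω) (X : Set (Pt d))
    (f : Pt d → Ω → ℝ) (r a b : ℝ) : Prop where
  r_pos : 0 < r
  a_pos : 0 < a
  b_pos : 0 < b
  compact : IsCompact X
  convex : Convex ℝ X
  subset_box : ∀ x ∈ X, ∀ j, x j ∈ Set.Icc 0 r
  tail : ∃ G : Ω → Pt d → (Pt d →L[ℝ] ℝ),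
    (∀ᵐ ω ∂P, ∀ x ∈ X, HasFDerivWithinAt (fun z => f z ω) (G ω x) X x) ∧
    ∀ (j : Fin d) (L : ℝ), 0 < L →
      P {ω | ENNReal.ofReal L < ⨆ x ∈ X, ‖G ω x (EuclideanSpace.single j 1)‖ₑ} ≤
        ENNReal.ofReal (a * Real.exp (-(L / b) ^ 2))

/-! ### Information gain -/

/-- Shannon mutual information `I(U; V)`: the Kullback–Leibler divergence of the joint law from the
product of the marginal laws. -/
def mutualInfo {Ω α β : Type*} [MeasurableSpace Ω] [MeasurableSpace α] [MeasurableSpace β]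
    (P : Measure Ω) (U : Ω → α) (V : Ω → β) : ℝ≥0∞ :=
  klDiv (P.map (fun ω => (U ω, V ω))) ((P.map U).prod (P.map V))

/-- The maximum information gain `γ_T = sup I(y_A; f_A)` over `A = (a_1, …, a_T)` in `X`,
where `f_A = (f(a_i))_i` and `y_A = (f(a_i) + ε_i)_i`. Points may be repeated. -/
def maxInfoGain {d : ℕ} {Ω : Type*} [MeasurableSpace Ω] (P : Measure Ω) (X : Set (Pt d))
    (f : Pt d → Ω → ℝ) (ε : ℕ → Ω → ℝ) (T : ℕ) : ℝ≥0∞ :=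
  ⨆ A : Fin T → X,
    mutualInfo P (fun ω (i : Fin T) => f (A i) ω + ε i ω) (fun ω (i : Fin T) => f (A i) ω)

/-! ### Constants -/

/-- `C₁ = 2 / log(1 + s⁻²)`. -/
def constC1 (s : ℝ≥0) : ℝ := 2 / Real.log (1 + ((s : ℝ) ^ 2)⁻¹)

/-- `β_t = 2 log(|X| t² / √(2π))` for a domain with `N = |X|` points. -/
def betaFinite (N : ℕ) (t : ℕ) : ℝ :=
  2 * Real.log ((N : ℝ) * (t : ℝ) ^ 2 / Real.sqrt (2 * Real.pi))

/-- `β_t = 2 d log(b d r t² (√(log(a d)) + √π / 2)) + 2 log(t² / √(2π))`. -/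
def betaContinuous (d : ℕ) (r a b : ℝ) (t : ℕ) : ℝ :=
  2 * (d : ℝ) * Real.log (b * d * r * (t : ℝ) ^ 2 *
      (Real.sqrt (Real.log (a * d)) + Real.sqrt Real.pi / 2)) +
    2 * Real.log ((t : ℝ) ^ 2 / Real.sqrt (2 * Real.pi))

end GPUCB

end

/-! Write `U` for the upper confidence bound at a given step. Since the query maximizes `U`, its
regret is at most `(f(x*) - U(x*)) + (U(x_t) - f(x_t))`. The second bracket has mean `√β_t · E
σ(x_t)`, because the posterior mean is unbiased at a query chosen from the data. The first bracket
is at most the sum over `x ∈ X` of the positive parts of `f(x) - U(x)`. Given the data each `f(x)`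
is Gaussian with variance at most one, so each positive part has mean at most `exp(-β_t/2)/√(2π)`.
The choice of `β_t` makes the sum at most `1/t²`, and `∑ 1/t² = π²/6`.

The widths are summed by Cauchy–Schwarz. Along every realized run, `σ² ≤ C₁ · log(1 + σ²/s²)/2`, and
the sum of these logarithms is the mutual information for the realized query points, hence at most
`γ_T` (`mutualInfo_eq`, `sum_postVar_le`).

On a continuous domain, `X` is replaced by a finite net that depends on `t`. The tail assumption
gives a random `ℓ¹`-Lipschitz constant whose mean is at most `b(√log(ad) + √π/2)`
(`exists_lipschitz`). The mesh is chosen so that the mean discretization error is at most another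
`1/t²`, and `β_t` carries the logarithm of a bound for the number of net points. This doubles the
constant.

The delicate point is the posterior under adaptive sampling. No conditional distributions are used:
the data have the Gaussian likelihood as density with respect to a reference measure that does not
involve `f` (`lintegral_history`). Adaptivity therefore does not change the posterior, and it
suffices to know it for each fixed data set (`lintegral_mul_lik`). There it follows from the fact
that the prediction residual is independent of the observations. Joint measurability, which the
model does not provide, is obtained by passing to a version of `f` that is a function of countably
many values (`exists_isMeasurableGPModel`). -/

set_option linter.unusedSectionVars false

namespace GPUCB

/-! ### Runs of a decision rule -/

section History

variable {d : ℕ} {Ω Ω' : Type*} {π : Rule d}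

/-- The observation `y_{n+1}`. -/
noncomputable def observation (π : Rule d) (f : Pt d → Ω → ℝ) (ε : ℕ → Ω → ℝ) (n : ℕ) (ω : Ω) : ℝ :=
  f (query π f ε n ω) ω + ε n ω

lemma history_succ (f : Pt d → Ω → ℝ) (ε : ℕ → Ω → ℝ) (ω : Ω) (n : ℕ) :
    history π f ε ω (n + 1) = Fin.snoc (α := fun _ => Pt d × ℝ) (history π f ε ω n)
      (query π f ε n ω, observation π f ε n ω) := rfl

/-- All histories of one run are initial segments of a single stream, so bounds proved for arbitrary
data streams apply pathwise. -/
lemma history_eq_prefix (f : Pt d → Ω → ℝ) (ε : ℕ → Ω → ℝ) (ω : Ω) (n : ℕ) :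
    history π f ε ω n = fun i : Fin n => (query π f ε i ω, observation π f ε i ω) := by
  induction n with
  | zero => ext i <;> exact i.elim0
  | succ n ih =>
    rw [history_succ, ih]
    funext i
    refine Fin.lastCases ?_ (fun j => ?_) i
    · simp
    · simp

lemma history_mem {X : Set (Pt d)}
    (hπ : ∀ (n : ℕ) (D : Data d n), (∀ i, (D i).1 ∈ X) → π n D ∈ X)
    (f : Pt d → Ω → ℝ) (ε : ℕ → Ω → ℝ) (ω : Ω) (n : ℕ) :
    ∀ i, (history π f ε ω n i).1 ∈ X := by
  induction n with
  | zero => exact fun i => i.elim0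
  | succ n ih =>
    intro i
    rw [history_succ]
    refine Fin.lastCases ?_ (fun j => ?_) i
    · rw [Fin.snoc_last]
      exact hπ n _ ih
    · simpa using ih j

lemma query_mem {X : Set (Pt d)}
    (hπ : ∀ (n : ℕ) (D : Data d n), (∀ i, (D i).1 ∈ X) → π n D ∈ X)
    (f : Pt d → Ω → ℝ) (ε : ℕ → Ω → ℝ) (n : ℕ) (ω : Ω) : query π f ε n ω ∈ X :=
  hπ n _ (history_mem hπ f ε ω n)

/-- A run sees the objective only on `X` and only the first `n` noise values. This allows `f` to be
replaced by another version, and exhibits the history as a function of past noise. -/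
lemma history_congr {X : Set (Pt d)}
    (hπ : ∀ (n : ℕ) (D : Data d n), (∀ i, (D i).1 ∈ X) → π n D ∈ X)
    {f : Pt d → Ω → ℝ} {f' : Pt d → Ω' → ℝ} {ε : ℕ → Ω → ℝ} {ε' : ℕ → Ω' → ℝ} {ω : Ω} {ω' : Ω'}
    (hf : ∀ x ∈ X, f x ω = f' x ω') {n : ℕ} (hε : ∀ i < n, ε i ω = ε' i ω') :
    history π f ε ω n = history π f' ε' ω' n := by
  induction n with
  | zero => rfl
  | succ n ih =>
    have h := ih fun i hi => hε i (hi.trans n.lt_succ_self)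
    have hq : query π f ε n ω = query π f' ε' n ω' := by simp only [query, h]
    rw [history_succ, history_succ, h]
    simp only [observation]
    rw [hq, hf _ (query_mem hπ f' ε' n ω'), hε n n.lt_succ_self]

lemma measurable_snoc {n : ℕ} :
    Measurable fun q : Data d n × (Pt d × ℝ) =>
      (Fin.snoc (α := fun _ => Pt d × ℝ) q.1 q.2 : Data d (n + 1)) := by
  rw [measurable_pi_iff]
  intro i
  refine Fin.lastCases ?_ (fun j => ?_) i
  · simpa using measurable_snd
  · simp only [Fin.snoc_castSucc]
    exact (measurable_pi_apply j).comp measurable_fst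

lemma measurable_history [MeasurableSpace Ω] (hπ : ∀ n, Measurable (π n)) {f : Pt d → Ω → ℝ}
    (hf : Measurable fun q : Pt d × Ω => f q.1 q.2) {ε : ℕ → Ω → ℝ} (hε : ∀ n, Measurable (ε n))
    (n : ℕ) : Measurable fun ω => history π f ε ω n := by
  induction n with
  | zero => exact measurable_const
  | succ n ih =>
    simp only [history_succ]
    have hq : Measurable (query π f ε n) := (hπ n).comp ih
    exact measurable_snoc.comp (ih.prodMk (hq.prodMk
      ((hf.comp (hq.prodMk measurable_id)).add (hε n))))

/-- The measure on data sets under which the queries follow the rule `π` and the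
observations are distributed according to Lebesgue measure. -/
noncomputable def refMeasure (π : Rule d) : (n : ℕ) → Measure (Data d n)
  | 0 => Measure.dirac Fin.elim0
  | n + 1 => ((refMeasure π n).prod volume).map fun q : Data d n × ℝ =>
      Fin.snoc (α := fun _ => Pt d × ℝ) q.1 (π n q.1, q.2)

lemma measurable_snoc_rule (hπ : ∀ n, Measurable (π n)) (n : ℕ) :
    Measurable fun q : Data d n × ℝ =>
      (Fin.snoc (α := fun _ => Pt d × ℝ) q.1 (π n q.1, q.2) : Data d (n + 1)) :=
  measurable_snoc.comp (measurable_fst.prodMk (((hπ n).comp measurable_fst).prodMk measurable_snd))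

lemma lintegral_refMeasure_succ (hπ : ∀ n, Measurable (π n)) {n : ℕ}
    {g : Data d (n + 1) → ℝ≥0∞} (hg : Measurable g) :
    ∫⁻ D, g D ∂refMeasure π (n + 1) =
      ∫⁻ D, ∫⁻ y, g (Fin.snoc (α := fun _ => Pt d × ℝ) D (π n D, y)) ∂volume ∂refMeasure π n := by
  rw [refMeasure, lintegral_map hg (measurable_snoc_rule hπ n),
    lintegral_prod]
  exact (hg.comp (measurable_snoc_rule hπ n)).aemeasurable

lemma ae_refMeasure_mem {X : Set (Pt d)} (hX : MeasurableSet X) (hπm : ∀ n, Measurable (π n))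
    (hπ : ∀ (n : ℕ) (D : Data d n), (∀ i, (D i).1 ∈ X) → π n D ∈ X) (n : ℕ) :
    ∀ᵐ D ∂refMeasure π n, ∀ i, (D i).1 ∈ X := by
  induction n with
  | zero => exact .of_forall fun D i => i.elim0
  | succ n ih =>
    have hm : MeasurableSet {D : Data d (n + 1) | ∀ i, (D i).1 ∈ X} := by
      simp only [Set.ofPred_forall]
      exact MeasurableSet.iInter fun i => hX.preimage ((measurable_pi_apply i).fst)
    rw [refMeasure, ae_map_iff (measurable_snoc_rule hπm n).aemeasurable hm]
    have : ∀ᵐ q ∂(refMeasure π n).prod (volume : Measure ℝ), ∀ i, (q.1 i).1 ∈ X :=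
      Measure.quasiMeasurePreserving_fst.ae ih
    filter_upwards [this] with q hq i
    refine Fin.lastCases ?_ (fun j => ?_) i
    · simpa using hπ n _ hq
    · simpa using hq j

end History

/-! ### The Gaussian likelihood -/

section Likelihood

variable {d : ℕ}

/-- The density of the observations in `D` for the objective `h` and noise variance `s²`. -/
noncomputable def lik {n : ℕ} (s : ℝ≥0) (h : Pt d → ℝ) (D : Data d n) : ℝ≥0∞ :=
  ∏ i, gaussianPDF (h (D i).1) (s ^ 2) (D i).2

lemma lik_snoc {n : ℕ} (s : ℝ≥0) (h : Pt d → ℝ) (D : Data d n) (q : Pt d × ℝ) :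
    lik s h (Fin.snoc (α := fun _ => Pt d × ℝ) D q : Data d (n + 1)) =
      lik s h D * gaussianPDF (h q.1) (s ^ 2) q.2 := by
  simp [lik, Fin.prod_univ_castSucc]

lemma measurable_lik {Ω : Type*} [MeasurableSpace Ω] {f : Pt d → Ω → ℝ}
    (hf : Measurable fun q : Pt d × Ω => f q.1 q.2) (s : ℝ≥0) (n : ℕ) :
    Measurable fun q : Ω × Data d n => lik s (f · q.1) q.2 := by
  unfold lik
  refine Finset.measurable_prod _ fun i _ => ?_
  have h1 : Measurable fun q : Ω × Data d n => f (q.2 i).1 q.1 :=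
    hf.comp (((measurable_pi_apply i).comp measurable_snd).fst.prodMk measurable_fst)
  have h2 : Measurable fun q : Ω × Data d n => (q.2 i).2 :=
    ((measurable_pi_apply i).comp measurable_snd).snd
  exact measurable_uncurry_gaussianPDF.comp (h1.prodMk (measurable_const.prodMk h2))

/-- The change of variables from noise to observation: for a fixed signal `m`, the observation has a
density with respect to a measure free of `m`. -/
lemma lintegral_gaussianReal_shift {v : ℝ≥0} (hv : v ≠ 0) (m : ℝ) {g : ℝ → ℝ≥0∞}
    (hg : Measurable g) :
    ∫⁻ e, g (m + e) ∂gaussianReal 0 v = ∫⁻ y, gaussianPDF m v y * g y := by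
  have : (gaussianReal 0 v).map (m + ·) = gaussianReal m v := by
    rw [gaussianReal_map_const_add, zero_add]
  rw [← lintegral_map (g := (m + ·)) hg (by fun_prop), this, gaussianReal_of_var_ne_zero _ hv,
    lintegral_withDensity_eq_lintegral_mul _ (measurable_gaussianPDF _ _) hg]
  rfl

end Likelihood

/-! ### Independence of the noise and the joint law of adaptively collected data. -/

lemma indepFun_prodMk_of_indepFun {Ω α β γ : Type*} [MeasurableSpace Ω] [MeasurableSpace α]
    [MeasurableSpace β] [MeasurableSpace γ] {P : Measure Ω} [IsProbabilityMeasure P]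
    {U : Ω → α} {V : Ω → β} {W : Ω → γ} (hU : Measurable U) (hV : Measurable V)
    (hW : Measurable W) (h : IndepFun U (fun ω => (V ω, W ω)) P) (hVW : IndepFun V W P) :
    IndepFun (fun ω => (U ω, V ω)) W P := by
  have : IsProbabilityMeasure (P.map U) := Measure.isProbabilityMeasure_map hU.aemeasurable
  have : IsProbabilityMeasure (P.map V) := Measure.isProbabilityMeasure_map hV.aemeasurable
  have : IsProbabilityMeasure (P.map W) := Measure.isProbabilityMeasure_map hW.aemeasurable
  have hUV : IndepFun U V P := h.comp measurable_id measurable_fst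
  rw [indepFun_iff_map_prod_eq_prod_map_map (hU.prodMk hV).aemeasurable hW.aemeasurable,
    (indepFun_iff_map_prod_eq_prod_map_map hU.aemeasurable hV.aemeasurable).1 hUV]
  -- After reassociation both sides are the joint law of `(U, (V, W))`, which splits into the three
  -- marginals.
  apply MeasurableEquiv.prodAssoc.map_measurableEquiv_injective
  rw [Measure.prodAssoc_prod,
    ← (indepFun_iff_map_prod_eq_prod_map_map hV.aemeasurable hW.aemeasurable).1 hVW,
    ← (indepFun_iff_map_prod_eq_prod_map_map hU.aemeasurable (hV.prodMk hW).aemeasurable).1 h,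
    Measure.map_map MeasurableEquiv.prodAssoc.measurable ((hU.prodMk hV).prodMk hW)]
  rfl

/-- Noise `ε n` is independent of the objective and the earlier noise. -/
lemma indepFun_past_noise {Ω E : Type*} [MeasurableSpace Ω] [MeasurableSpace E]
    {P : Measure Ω} [IsProbabilityMeasure P] {p : Ω → E} (hp : Measurable p) {ε : ℕ → Ω → ℝ}
    (hε : ∀ n, Measurable (ε n)) (hiid : iIndepFun ε P)
    (hind : IndepFun p (fun ω n => ε n ω) P) (n : ℕ) :
    IndepFun (fun ω => (p ω, fun i : Fin n => ε i ω)) (ε n) P := by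
  have hεn : Measurable fun ω (i : Fin n) => ε i ω := measurable_pi_lambda _ fun i => hε i
  have h1 : IndepFun (fun ω (i : Fin n) => ε i ω) (ε n) P :=
    (hiid.indepFun_finset (Finset.range n) {n} (by simp) hε).comp
      (φ := fun (u : Finset.range n → ℝ) (i : Fin n) => u ⟨i, by simp⟩)
      (ψ := fun u : ({n} : Finset ℕ) → ℝ => u ⟨n, by simp⟩) (by fun_prop) (by fun_prop)
  have h2 : IndepFun p (fun ω => ((fun i : Fin n => ε i ω), ε n ω)) P :=
    hind.comp (φ := id) (ψ := fun u : ℕ → ℝ => ((fun i : Fin n => u i), u n))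
      measurable_id (by fun_prop)
  exact indepFun_prodMk_of_indepFun hp hεn (hε n) h2 h1

/-- Noise `ε n` is independent of the objective and the data collected before. -/
lemma indepFun_history_noise {d : ℕ} {Ω E : Type*} [MeasurableSpace Ω] [MeasurableSpace E]
    {P : Measure Ω} [IsProbabilityMeasure P] {π : Rule d} (hπ : ∀ n, Measurable (π n))
    {Φ : Pt d → E → ℝ} (hΦ : Measurable fun q : Pt d × E => Φ q.1 q.2)
    {p : Ω → E} (hp : Measurable p) {ε : ℕ → Ω → ℝ} (hε : ∀ n, Measurable (ε n))
    (hiid : iIndepFun ε P) (hind : IndepFun p (fun ω n => ε n ω) P) (n : ℕ) :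
    IndepFun (fun ω => (p ω, history π (fun x ω => Φ x (p ω)) ε ω n)) (ε n) P := by
  -- The history is written as a measurable function of the objective and a finite block of noise;
  -- noise with index at least `n` is set to `0` and never read.
  have hG : Measurable fun q : E × (Fin n → ℝ) =>
      history π (fun x q => Φ x q.1)
        (fun i (q : E × (Fin n → ℝ)) => if h : i < n then q.2 ⟨i, h⟩ else 0) q n := by
    refine measurable_history hπ (f := fun x (q : E × (Fin n → ℝ)) => Φ x q.1)
      (hΦ.comp (measurable_fst.prodMk measurable_snd.fst))
      (fun i => ?_) n
    by_cases h : i < n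
    · simp only [h, dite_true]; fun_prop
    · simp only [h, dite_false]; fun_prop
  have := (indepFun_past_noise hp hε hiid hind n).comp (measurable_fst.prodMk hG) measurable_id
  refine this.congr (.of_forall fun ω => ?_) (.of_forall fun ω => rfl)
  symm
  refine Prod.ext rfl ?_
  change history π _ ε ω n = history π _ _ (p ω, fun i : Fin n => ε i ω) n
  refine history_congr (X := Set.univ) (f := fun x ω => Φ x (p ω)) (ω := ω)
    (f' := fun x (q : E × (Fin n → ℝ)) => Φ x q.1)
    (ε' := fun i (q : E × (Fin n → ℝ)) => if h : i < n then q.2 ⟨i, h⟩ else 0)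
    (fun _ _ _ => trivial) (fun _ _ => rfl) fun i hi => ?_
  simp [hi]

/-- Joint law of an objective and the data collected by an adaptive rule: the data have the Gaussian
likelihood as their density with respect to `refMeasure`. -/
theorem lintegral_history {d : ℕ} {Ω E : Type*} [MeasurableSpace Ω] [MeasurableSpace E]
    {P : Measure Ω} [IsProbabilityMeasure P] {π : Rule d} (hπ : ∀ n, Measurable (π n))
    {s : ℝ≥0} (hs : 0 < s) {Φ : Pt d → E → ℝ} (hΦ : Measurable fun q : Pt d × E => Φ q.1 q.2)
    {p : Ω → E} (hp : Measurable p) {ε : ℕ → Ω → ℝ} (hε : ∀ n, Measurable (ε n))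
    (hlaw : ∀ n, P.map (ε n) = gaussianReal 0 (s ^ 2)) (hiid : iIndepFun ε P)
    (hind : IndepFun p (fun ω n => ε n ω) P) (n : ℕ) {g : E × Data d n → ℝ≥0∞}
    (hg : Measurable g) :
    ∫⁻ ω, g (p ω, history π (fun x ω => Φ x (p ω)) ε ω n) ∂P =
      ∫⁻ D, ∫⁻ ω, g (p ω, D) * lik s (Φ · (p ω)) D ∂P ∂refMeasure π n := by
  have hF : Measurable fun q : Pt d × Ω => Φ q.1 (p q.2) :=
    hΦ.comp (measurable_fst.prodMk (hp.comp measurable_snd))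
  have hv : s ^ 2 ≠ 0 := pow_ne_zero _ hs.ne'
  have hmeas : ∀ (m : ℕ) (g : E × Data d m → ℝ≥0∞), Measurable g →
      Measurable fun q : Ω × Data d m => g (p q.1, q.2) * lik s (Φ · (p q.1)) q.2 := fun m g hg =>
    (hg.comp ((hp.comp measurable_fst).prodMk measurable_snd)).mul (measurable_lik (f := fun x ω => Φ x (p ω)) hF s m)
  induction n with
  | zero =>
    have h0 : ∀ D : Data d 0, D = Fin.elim0 := fun D => funext fun i => i.elim0
    rw [refMeasure, lintegral_dirac']
    · refine lintegral_congr fun ω => ?_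
      rw [h0 (history _ _ _ _ _)]
      simp [lik]
    · exact Measurable.lintegral_prod_left (hmeas 0 g hg)
  | succ n ih =>
    have hH := measurable_history (f := fun x ω => Φ x (p ω)) hπ hF hε n
    have hprod := (indepFun_iff_map_prod_eq_prod_map_map (hp.prodMk hH).aemeasurable
      (hε n).aemeasurable).1 (indepFun_history_noise hπ hΦ hp hε hiid hind n)
    have hπ' : Measurable fun q : (E × Data d n) × ℝ => Φ (π n q.1.2) q.1.1 :=
      hΦ.comp (((hπ n).comp measurable_fst.snd).prodMk measurable_fst.fst)
    have hsn : Measurable fun q : (E × Data d n) × ℝ =>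
        (q.1.1, (Fin.snoc (α := fun _ => Pt d × ℝ) q.1.2 (π n q.1.2, q.2) : Data d (n + 1))) :=
      measurable_fst.fst.prodMk
        ((measurable_snoc_rule hπ n).comp (measurable_fst.snd.prodMk measurable_snd))
    have hk : Measurable fun q : (E × Data d n) × ℝ => g (q.1.1,
        (Fin.snoc (α := fun _ => Pt d × ℝ) q.1.2
          (π n q.1.2, Φ (π n q.1.2) q.1.1 + q.2) : Data d (n + 1))) :=
      hg.comp (hsn.comp (measurable_fst.prodMk (hπ'.add measurable_snd)))
    -- `g'` is `g` with the last observation integrated out. The query is determined by the earlier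
    -- data, so the induction hypothesis applies to `g'`, and Tonelli then restores the last factor
    -- of the likelihood.
    set g' : E × Data d n → ℝ≥0∞ := fun q => ∫⁻ y, gaussianPDF (Φ (π n q.2) q.1) (s ^ 2) y *
      g (q.1, (Fin.snoc (α := fun _ => Pt d × ℝ) q.2 (π n q.2, y) : Data d (n + 1))) with hg'
    have hpdf : Measurable fun q : (E × Data d n) × ℝ =>
        gaussianPDF (Φ (π n q.1.2) q.1.1) (s ^ 2) q.2 :=
      measurable_uncurry_gaussianPDF.comp (hπ'.prodMk (measurable_const.prodMk measurable_snd))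
    have hg'm : Measurable g' := Measurable.lintegral_prod_right (hpdf.mul (hg.comp hsn))
    calc ∫⁻ ω, g (p ω, history π (fun x ω => Φ x (p ω)) ε ω (n + 1)) ∂P
        = ∫⁻ q, g (q.1.1, (Fin.snoc (α := fun _ => Pt d × ℝ) q.1.2
            (π n q.1.2, Φ (π n q.1.2) q.1.1 + q.2) : Data d (n + 1)))
            ∂(P.map fun ω => ((p ω, history π (fun x ω => Φ x (p ω)) ε ω n), ε n ω)) := by
          rw [lintegral_map hk ((hp.prodMk hH).prodMk (hε n))]
          rfl
      _ = ∫⁻ ω, g' (p ω, history π (fun x ω => Φ x (p ω)) ε ω n) ∂P := by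
          rw [hprod, hlaw, lintegral_prod _ hk.aemeasurable, lintegral_map _ (hp.prodMk hH)]
          · refine lintegral_congr fun ω => ?_
            simp only [hg']
            have hsec : Measurable fun y : ℝ =>
                ((p ω, history π (fun x ω => Φ x (p ω)) ε ω n), y) :=
              measurable_const.prodMk measurable_id
            exact lintegral_gaussianReal_shift hv _ ((hg.comp hsn).comp hsec)
          · exact Measurable.lintegral_prod_right hk
      _ = ∫⁻ D, ∫⁻ ω, g' (p ω, D) * lik s (Φ · (p ω)) D ∂P ∂refMeasure π n := ih hg'm
      _ = _ := by
          rw [lintegral_refMeasure_succ hπ (Measurable.lintegral_prod_left (hmeas _ g hg))]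
          refine lintegral_congr fun D => ?_
          have hj : Measurable fun q : Ω × ℝ =>
              g (p q.1, (Fin.snoc (α := fun _ => Pt d × ℝ) D (π n D, q.2) : Data d (n + 1))) *
              lik s (Φ · (p q.1))
                (Fin.snoc (α := fun _ => Pt d × ℝ) D (π n D, q.2) : Data d (n + 1)) :=
            (hmeas _ g hg).comp (measurable_fst.prodMk
              ((measurable_snoc_rule hπ n).comp (measurable_const.prodMk measurable_snd)))
          have hj' : AEMeasurable (Function.uncurry fun (y : ℝ) (ω : Ω) =>
              g (p ω, (Fin.snoc (α := fun _ => Pt d × ℝ) D (π n D, y) : Data d (n + 1))) *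
              lik s (Φ · (p ω)) (Fin.snoc (α := fun _ => Pt d × ℝ) D (π n D, y) : Data d (n + 1)))
              ((volume : Measure ℝ).prod P) := (hj.comp measurable_swap).aemeasurable
          rw [lintegral_lintegral_swap hj']
          refine lintegral_congr fun ω => ?_
          simp only [hg', lik_snoc]
          rw [← lintegral_mul_const]
          · refine lintegral_congr fun y => ?_
            ring
          · have hsec : Measurable fun y : ℝ => ((p ω, D), y) :=
              measurable_const.prodMk measurable_id
            exact (hpdf.comp hsec).mul ((hg.comp hsn).comp hsec)

/-! ### Gaussian regression with a fixed design -/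

/-- The coefficients of the posterior mean at `x` as a linear function of the observations. -/
noncomputable def weights {d n : ℕ} (k : Pt d → Pt d → ℝ) (s : ℝ≥0) (D : Data d n) (x : Pt d) :
    Fin n → ℝ :=
  ((regKernelMatrix k s D)⁻¹).mulVec (kernelVec k D x)

/-- The error of the posterior mean when predicting `f x` from noisy observations at the query
points of `D`. -/
noncomputable def residual {d n : ℕ} {Ω : Type*} (k : Pt d → Pt d → ℝ) (s : ℝ≥0)
    (f : Pt d → Ω → ℝ) (ε : ℕ → Ω → ℝ) (D : Data d n) (x : Pt d) (ω : Ω) : ℝ :=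
  f x ω - ∑ i, weights k s D x i * (f (D i).1 ω + ε i ω)

namespace IsGPModel

variable {d n : ℕ} {Ω : Type*} [MeasurableSpace Ω] {P : Measure Ω} [IsProbabilityMeasure P]
  {X : Set (Pt d)} {k : Pt d → Pt d → ℝ} {s : ℝ≥0} {f : Pt d → Ω → ℝ} {ε : ℕ → Ω → ℝ}

lemma noise_hasGaussianLaw (hm : IsGPModel P X k s f ε) (n : ℕ) : HasGaussianLaw (ε n) P where
  isGaussian_map := by rw [hm.noise_law n]; infer_instance

lemma memLp_noise (hm : IsGPModel P X k s f ε) (n : ℕ) : MemLp (ε n) 2 P :=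
  (hm.noise_hasGaussianLaw n).memLp_two

lemma memLp_f (hm : IsGPModel P X k s f ε) {x : Pt d} (hx : x ∈ X) : MemLp (f x) 2 P :=
  (hm.gaussian.hasGaussianLaw_eval ⟨x, hx⟩).memLp_two

lemma integral_noise (hm : IsGPModel P X k s f ε) (n : ℕ) : ∫ ω, ε n ω ∂P = 0 := by
  have := integral_map (μ := P) (hm.measurable_noise n).aemeasurable
    (f := fun x : ℝ => x) measurable_id.aestronglyMeasurable
  rw [hm.noise_law n, integral_id_gaussianReal] at this
  exact this.symm

lemma variance_noise (hm : IsGPModel P X k s f ε) (n : ℕ) : Var[ε n; P] = (s : ℝ) ^ 2 := by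
  have := variance_map (μ := P) (X := fun x : ℝ => x) (Y := ε n) (by fun_prop)
    (hm.measurable_noise n).aemeasurable
  rw [hm.noise_law n, variance_fun_id_gaussianReal] at this
  simpa [Function.comp_def] using this.symm

lemma cov_noise (hm : IsGPModel P X k s f ε) (i j : ℕ) :
    cov[ε i, ε j; P] = if i = j then (s : ℝ) ^ 2 else 0 := by
  split_ifs with h
  · subst h
    rw [covariance_self (hm.measurable_noise i).aemeasurable, hm.variance_noise]
  · exact (hm.noise_indep.indepFun h).covariance_eq_zero (hm.memLp_noise i) (hm.memLp_noise j)

lemma cov_f_noise (hm : IsGPModel P X k s f ε) {x : Pt d} (hx : x ∈ X) (i : ℕ) :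
    cov[f x, ε i; P] = 0 := by
  have : IndepFun (f x) (ε i) P :=
    hm.indep.comp (φ := fun u : X → ℝ => u ⟨x, hx⟩) (ψ := fun u : ℕ → ℝ => u i)
      (by fun_prop) (by fun_prop)
  exact this.covariance_eq_zero (hm.memLp_f hx) (hm.memLp_noise i)

lemma memLp_obs (hm : IsGPModel P X k s f ε) {x : Pt d} (hx : x ∈ X) (i : ℕ) :
    MemLp (fun ω => f x ω + ε i ω) 2 P := (hm.memLp_f hx).add (hm.memLp_noise i)

lemma cov_f_obs (hm : IsGPModel P X k s f ε) {x y : Pt d} (hx : x ∈ X) (hy : y ∈ X) (i : ℕ) :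
    cov[f x, fun ω => f y ω + ε i ω; P] = k x y := by
  have := covariance_add_right (hm.memLp_f hx) (hm.memLp_f hy) (hm.memLp_noise i)
  rw [hm.cov x hx y hy, hm.cov_f_noise hx, add_zero] at this
  exact this

lemma cov_obs (hm : IsGPModel P X k s f ε) {x y : Pt d} (hx : x ∈ X) (hy : y ∈ X) (i j : ℕ) :
    cov[fun ω => f x ω + ε i ω, fun ω => f y ω + ε j ω; P] =
      k x y + if i = j then (s : ℝ) ^ 2 else 0 := by
  have h1 := covariance_add_left (hm.memLp_f hx) (hm.memLp_noise i) (hm.memLp_obs hy j)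
  have h2 := covariance_add_right (hm.memLp_noise i) (hm.memLp_f hy) (hm.memLp_noise j)
  rw [covariance_comm (ε i) (f y), hm.cov_f_noise hy, zero_add, hm.cov_noise] at h2
  have h3 : cov[ε i, fun ω => f y ω + ε j ω; P] = if i = j then (s : ℝ) ^ 2 else 0 := h2
  rw [h3, hm.cov_f_obs hx hy] at h1
  exact h1

lemma kernel_comm (hm : IsGPModel P X k s f ε) {x y : Pt d} (hx : x ∈ X) (hy : y ∈ X) :
    k x y = k y x := by
  rw [← hm.cov x hx y hy, covariance_comm, hm.cov y hy x hx]

lemma regKernelMatrix_apply (D : Data d n) (i j : Fin n) :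
    regKernelMatrix k s D i j = k (D i).1 (D j).1 + if i = j then (s : ℝ) ^ 2 else 0 := by
  simp [regKernelMatrix, Matrix.one_apply]

/-- The quadratic form of `K` at `v` is the variance of `∑ v_i f(x_i)`, hence nonnegative even with
repeated points; the noise term makes the sum definite. -/
lemma regKernelMatrix_posDef (hm : IsGPModel P X k s f ε) (hs : 0 < s) {D : Data d n}
    (hD : ∀ i, (D i).1 ∈ X) : (regKernelMatrix k s D).PosDef := by
  have h1 : (Matrix.of fun i j => k (D i).1 (D j).1).PosSemidef := by
    refine Matrix.PosSemidef.of_dotProduct_mulVec_nonneg ?_ fun v => ?_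
    · ext i j
      simpa using hm.kernel_comm (hD j) (hD i)
    · have : Var[fun ω => ∑ i, v i * f (D i).1 ω; P] =
          star v ⬝ᵥ (Matrix.of fun i j => k (D i).1 (D j).1).mulVec v := by
        have hL : ∀ i, MemLp (fun ω => v i * f (D i).1 ω) 2 P := fun i =>
          (hm.memLp_f (hD i)).const_mul _
        rw [← covariance_self (Finset.aemeasurable_fun_sum _ fun i _ =>
          (hL i).aestronglyMeasurable.aemeasurable), covariance_fun_sum_fun_sum hL hL]
        simp only [dotProduct, Matrix.mulVec, Matrix.of_apply, Finset.mul_sum, Pi.star_apply,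
          star_trivial]
        refine Finset.sum_congr rfl fun i _ => Finset.sum_congr rfl fun j _ => ?_
        rw [covariance_const_mul_left, covariance_const_mul_right, hm.cov _ (hD i) _ (hD j)]
        ring
      rw [← this]
      exact variance_nonneg _ _
  exact Matrix.PosDef.posSemidef_add h1 (Matrix.PosDef.one.smul (by positivity))

lemma mulVec_weights (hm : IsGPModel P X k s f ε) (hs : 0 < s) {D : Data d n}
    (hD : ∀ i, (D i).1 ∈ X) (x : Pt d) :
    (regKernelMatrix k s D).mulVec (weights k s D x) = kernelVec k D x := by
  rw [weights, Matrix.mulVec_mulVec, Matrix.mul_nonsing_inv _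
    ((Matrix.isUnit_iff_isUnit_det _).1 (hm.regKernelMatrix_posDef hs hD).isUnit),
    Matrix.one_mulVec]

lemma postMean_eq (hm : IsGPModel P X k s f ε) (hs : 0 < s) {D : Data d n}
    (hD : ∀ i, (D i).1 ∈ X) (x : Pt d) :
    postMean k s D x = ∑ i, weights k s D x i * (D i).2 := by
  have hsymm : ((regKernelMatrix k s D)⁻¹).transpose = (regKernelMatrix k s D)⁻¹ := by
    have := (hm.regKernelMatrix_posDef hs hD).isHermitian.inv
    rwa [Matrix.IsHermitian, Matrix.conjTranspose_eq_transpose_of_trivial] at this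
  rw [postMean, Matrix.dotProduct_mulVec, ← Matrix.mulVec_transpose, hsymm]
  rfl

lemma postVar_eq (D : Data d n) (x : Pt d) :
    postVar k s D x = k x x - ∑ i, weights k s D x i * k x (D i).1 := by
  rw [postVar, dotProduct_comm]
  rfl

lemma memLp_residual_aux (hm : IsGPModel P X k s f ε) {D : Data d n}
    (hD : ∀ i, (D i).1 ∈ X) (x : Pt d) (i : Fin n) :
    MemLp (fun ω => weights k s D x i * (f (D i).1 ω + ε i ω)) 2 P :=
  (hm.memLp_obs (hD i) i).const_mul _

/-- These are the normal equations: `(K + s²I) w` is the kernel vector, so the posterior mean is the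
orthogonal projection of `f x` onto the span of the observations. -/
lemma cov_residual_obs (hm : IsGPModel P X k s f ε) (hs : 0 < s) {D : Data d n}
    (hD : ∀ i, (D i).1 ∈ X) {x : Pt d} (hx : x ∈ X) (j : Fin n) :
    cov[residual k s f ε D x, fun ω => f (D j).1 ω + ε j ω; P] = 0 := by
  have hL := hm.memLp_residual_aux (s := s) hD x
  have h := covariance_fun_sub_left (hm.memLp_f hx) (memLp_finsetSum Finset.univ fun i _ => hL i)
    (hm.memLp_obs (hD j) j)
  rw [covariance_fun_sum_left hL (hm.memLp_obs (hD j) j), hm.cov_f_obs hx (hD j)] at h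
  unfold residual
  rw [h]
  have hw := congrFun (hm.mulVec_weights hs hD x) j
  simp only [Matrix.mulVec, dotProduct, regKernelMatrix_apply, kernelVec] at hw
  rw [← hw, sub_eq_zero]
  refine Finset.sum_congr rfl fun i _ => ?_
  rw [covariance_const_mul_left, hm.cov_obs (hD i) (hD j), hm.kernel_comm (hD i) (hD j),
    mul_comm]
  simp only [Fin.ext_iff, eq_comm]

lemma memLp_residual (hm : IsGPModel P X k s f ε) {D : Data d n}
    (hD : ∀ i, (D i).1 ∈ X) {x : Pt d} (hx : x ∈ X) : MemLp (residual k s f ε D x) 2 P :=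
  (hm.memLp_f hx).sub (memLp_finsetSum Finset.univ fun i _ => hm.memLp_residual_aux hD x i)

lemma variance_residual (hm : IsGPModel P X k s f ε) (hs : 0 < s) {D : Data d n}
    (hD : ∀ i, (D i).1 ∈ X) {x : Pt d} (hx : x ∈ X) :
    Var[residual k s f ε D x; P] = postVar k s D x := by
  have hL := hm.memLp_residual_aux (s := s) hD x
  have hR := hm.memLp_residual (s := s) hD hx
  have hS := memLp_finsetSum Finset.univ fun i _ => hL i
  rw [← covariance_self hR.aestronglyMeasurable.aemeasurable]
  have h := covariance_fun_sub_right hR (hm.memLp_f hx) hS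
  rw [covariance_fun_sum_right hL hR] at h
  -- The residual is orthogonal to its own correction term, so its variance equals its covariance
  -- with `f x`.
  have h0 : ∀ i : Fin n, cov[residual k s f ε D x,
      fun ω => weights k s D x i * (f (D i).1 ω + ε i ω); P] = 0 := fun i => by
    rw [covariance_const_mul_right, hm.cov_residual_obs hs hD hx, mul_zero]
  simp only [h0, Finset.sum_const_zero, sub_zero] at h
  change cov[residual k s f ε D x, fun ω => f x ω - _; P] = _
  rw [h, postVar_eq]
  have h2 := covariance_fun_sub_left (hm.memLp_f hx) hS (hm.memLp_f hx)
  rw [covariance_fun_sum_left hL (hm.memLp_f hx), hm.cov x hx x hx] at h2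
  change cov[fun ω => f x ω - _, f x; P] = _
  rw [h2]
  congr 1
  refine Finset.sum_congr rfl fun i _ => ?_
  rw [covariance_const_mul_left, covariance_comm, hm.cov_f_obs hx (hD i)]

lemma integral_residual (hm : IsGPModel P X k s f ε) {D : Data d n}
    (hD : ∀ i, (D i).1 ∈ X) {x : Pt d} (hx : x ∈ X) :
    ∫ ω, residual k s f ε D x ω ∂P = 0 := by
  have hint : ∀ i : Fin n, Integrable (fun ω => weights k s D x i * (f (D i).1 ω + ε i ω)) P :=
    fun i => (hm.memLp_residual_aux hD x i).integrable (by norm_num)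
  unfold residual
  rw [integral_sub ((hm.memLp_f hx).integrable (by norm_num)) (integrable_finsetSum _ fun i _ => hint i),
    integral_finsetSum _ fun i _ => hint i, hm.mean x hx]
  simp only [integral_const_mul]
  rw [zero_sub, neg_eq_zero]
  refine Finset.sum_eq_zero fun i _ => ?_
  rw [integral_add ((hm.memLp_f (hD i)).integrable (by norm_num))
    ((hm.memLp_noise i).integrable (by norm_num)), hm.mean _ (hD i), hm.integral_noise]
  simp

lemma postVar_nonneg (hm : IsGPModel P X k s f ε) (hs : 0 < s) {D : Data d n}
    (hD : ∀ i, (D i).1 ∈ X) {x : Pt d} (hx : x ∈ X) : 0 ≤ postVar k s D x := by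
  rw [← hm.variance_residual hs hD hx]
  exact variance_nonneg _ _

lemma postVar_le (hm : IsGPModel P X k s f ε) (hs : 0 < s) {D : Data d n}
    (hD : ∀ i, (D i).1 ∈ X) (x : Pt d) : postVar k s D x ≤ k x x := by
  have := (hm.regKernelMatrix_posDef hs hD).inv.posSemidef.dotProduct_mulVec_nonneg
    (kernelVec k D x)
  rw [postVar]
  simp only [star_trivial] at this
  linarith

/-- The objective at `x`, its values at the query points and the noise are jointly Gaussian. -/
lemma hasGaussianLaw_joint (hm : IsGPModel P X k s f ε) {D : Data d n}
    (hD : ∀ i, (D i).1 ∈ X) {x : Pt d} (hx : x ∈ X) :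
    HasGaussianLaw (fun ω => ((f x ω, fun i : Fin n => f (D i).1 ω), fun i : Fin n => ε i ω)) P := by
  have hnoise : HasGaussianLaw (fun ω (i : Fin n) => ε i ω) P :=
    (hm.noise_indep.precomp Fin.val_injective).hasGaussianLaw fun i => hm.noise_hasGaussianLaw i
  have hf : HasGaussianLaw (fun ω => (f x ω, fun i : Fin n => f (D i).1 ω)) P := by
    -- `none` stands for the new point `x`. The map need not be injective, so query points may
    -- repeat or coincide with `x`.
    let u : Option (Fin n) → X := fun o => o.elim ⟨x, hx⟩ fun i => ⟨(D i).1, hD i⟩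
    have h := (hm.gaussian.comp_right u).hasGaussianLaw Finset.univ
    let L : (↥(Finset.univ : Finset (Option (Fin n))) → ℝ) →L[ℝ] ℝ × (Fin n → ℝ) :=
      (ContinuousLinearMap.proj ⟨none, Finset.mem_univ _⟩).prod
        (ContinuousLinearMap.pi fun i => ContinuousLinearMap.proj ⟨some i, Finset.mem_univ _⟩)
    exact h.map_fun L
  refine IndepFun.hasGaussianLaw hf hnoise ?_
  exact hm.indep.comp (φ := fun v : X → ℝ => (v ⟨x, hx⟩, fun i : Fin n => v ⟨(D i).1, hD i⟩))
    (ψ := fun v : ℕ → ℝ => fun i : Fin n => v i) (by fun_prop) (by fun_prop)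

lemma hasGaussianLaw_residual_obs (hm : IsGPModel P X k s f ε) {D : Data d n}
    (hD : ∀ i, (D i).1 ∈ X) {x : Pt d} (hx : x ∈ X) :
    HasGaussianLaw (fun ω => ((fun _ : Unit => residual k s f ε D x ω),
      fun i : Fin n => f (D i).1 ω + ε i ω)) P := by
  let L : ((ℝ × (Fin n → ℝ)) × (Fin n → ℝ)) →ₗ[ℝ] ((Unit → ℝ) × (Fin n → ℝ)) :=
    { toFun := fun q => ((fun _ => q.1.1 - ∑ i, weights k s D x i * (q.1.2 i + q.2 i)),
        fun i => q.1.2 i + q.2 i)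
      map_add' := fun p q => by
        ext i
        · simp only [Prod.fst_add, Prod.snd_add, Pi.add_apply, mul_add, Finset.sum_add_distrib]
          ring
        · simp only [Prod.fst_add, Prod.snd_add, Pi.add_apply]
          ring
      map_smul' := fun c q => by
        ext i
        · simp only [Prod.smul_fst, Prod.smul_snd, Pi.smul_apply, smul_eq_mul, RingHom.id_apply,
            mul_sub, Finset.mul_sum]
          congr 1
          exact Finset.sum_congr rfl fun i _ => by ring
        · simp only [Prod.smul_fst, Prod.smul_snd, Pi.smul_apply, smul_eq_mul, RingHom.id_apply]
          ring }
  exact (hm.hasGaussianLaw_joint hD hx).map_fun (LinearMap.toContinuousLinearMap L)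

/-- Uncorrelated and jointly Gaussian, hence independent. The `Unit` index only puts the residual in
the form of a family. -/
lemma indepFun_residual_obs (hm : IsGPModel P X k s f ε) (hs : 0 < s) {D : Data d n}
    (hD : ∀ i, (D i).1 ∈ X) {x : Pt d} (hx : x ∈ X) :
    IndepFun (residual k s f ε D x) (fun ω (i : Fin n) => f (D i).1 ω + ε i ω) P := by
  have h := HasGaussianLaw.indepFun_of_covariance_eval
    (X := fun (_ : Unit) => residual k s f ε D x)
    (Y := fun (i : Fin n) ω => f (D i).1 ω + ε i ω)
    (hm.hasGaussianLaw_residual_obs hD hx) fun _ j => hm.cov_residual_obs hs hD hx j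
  exact h.comp (φ := fun u : Unit → ℝ => u ()) (ψ := id) (by fun_prop) measurable_id

lemma map_residual (hm : IsGPModel P X k s f ε) (hs : 0 < s) {D : Data d n}
    (hD : ∀ i, (D i).1 ∈ X) {x : Pt d} (hx : x ∈ X) :
    P.map (residual k s f ε D x) = gaussianReal 0 (postVar k s D x).toNNReal := by
  have h : HasGaussianLaw (residual k s f ε D x) P :=
    (hm.hasGaussianLaw_residual_obs hD hx).fst.eval ()
  rw [h.map_eq_gaussianReal, hm.variance_residual hs hD hx, hm.integral_residual hD hx]

lemma measurable_residual (hm : IsGPModel P X k s f ε) {D : Data d n}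
    (hD : ∀ i, (D i).1 ∈ X) {x : Pt d} (hx : x ∈ X) : Measurable (residual k s f ε D x) :=
  (hm.measurable_f x hx).sub (Finset.measurable_fun_sum _ fun i _ =>
    ((hm.measurable_f _ (hD i)).add (hm.measurable_noise i)).const_mul _)

/-- The second moment of the innovation of a new observation. -/
lemma integral_innovation_sq (hm : IsGPModel P X k s f ε) (hs : 0 < s) {D : Data d n}
    (hD : ∀ i, (D i).1 ∈ X) {x : Pt d} (hx : x ∈ X) :
    Integrable (fun ω => (residual k s f ε D x ω + ε n ω) ^ 2) P ∧
    ∫ ω, (residual k s f ε D x ω + ε n ω) ^ 2 ∂P = postVar k s D x + (s : ℝ) ^ 2 := by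
  have hR := hm.memLp_residual (s := s) hD hx
  have hN := hm.memLp_noise n
  refine ⟨(hR.add hN).integrable_sq, ?_⟩
  have hp : Measurable fun ω (x : X) => f x ω :=
    measurable_pi_lambda _ fun x => hm.measurable_f x x.2
  -- The residual involves only noise with index below `n`.
  have hind : IndepFun (residual k s f ε D x) (ε n) P :=
    (indepFun_past_noise hp hm.measurable_noise hm.noise_indep hm.indep n).comp
      (φ := fun q : (X → ℝ) × (Fin n → ℝ) =>
        q.1 ⟨x, hx⟩ - ∑ i, weights k s D x i * (q.1 ⟨(D i).1, hD i⟩ + q.2 i))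
      (ψ := id) (by fun_prop) measurable_id
  have hv := hind.variance_add hR hN
  rw [hm.variance_residual hs hD hx, hm.variance_noise] at hv
  rw [← hv, variance_of_integral_eq_zero]
  · rfl
  · exact (hR.add hN).aestronglyMeasurable.aemeasurable
  · have := integral_add (hR.integrable (by norm_num)) (hN.integrable (by norm_num))
    rw [hm.integral_residual hD hx, hm.integral_noise, add_zero] at this
    exact this

end IsGPModel

/-! ### Conjugacy: the posterior for a fixed data set. -/

lemma pi_gaussianReal_eq_withDensity {n : ℕ} (m : Fin n → ℝ) {v : ℝ≥0} (hv : v ≠ 0) :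
    Measure.pi (fun i => gaussianReal (m i) v) =
      volume.withDensity fun y : Fin n → ℝ => ∏ i, gaussianPDF (m i) v (y i) := by
  refine Measure.pi_eq fun t ht => ?_
  have hint : ∀ i, Integrable (gaussianPDFReal (m i) v) (volume.restrict (t i)) := fun i =>
    (integrable_gaussianPDFReal _ _).restrict
  have hvol : (volume : Measure (Fin n → ℝ)).restrict (Set.univ.pi t) =
      Measure.pi fun i => volume.restrict (t i) := by
    rw [volume_pi, Measure.restrict_pi_pi]
  rw [withDensity_apply _ (MeasurableSet.univ_pi ht), hvol]
  have h1 : ∀ y : Fin n → ℝ, ∏ i, gaussianPDF (m i) v (y i) =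
      ENNReal.ofReal (∏ i, gaussianPDFReal (m i) v (y i)) := fun y => by
    rw [ENNReal.ofReal_prod_of_nonneg fun i _ => gaussianPDFReal_nonneg _ _ _]
    rfl
  simp only [h1]
  rw [← ofReal_integral_eq_lintegral_ofReal (Integrable.fintype_prod hint)
    (.of_forall fun y => Finset.prod_nonneg fun i _ => gaussianPDFReal_nonneg _ _ _),
    integral_fintype_prod_eq_prod, ENNReal.ofReal_prod_of_nonneg fun i _ =>
      integral_nonneg fun z => gaussianPDFReal_nonneg _ _ _]
  refine Finset.prod_congr rfl fun i _ => ?_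
  rw [gaussianReal_apply_eq_integral _ hv]

lemma lintegral_pi_gaussianReal_shift {n : ℕ} (m : Fin n → ℝ) {v : ℝ≥0} (hv : v ≠ 0)
    {g : (Fin n → ℝ) → ℝ≥0∞} (hg : Measurable g) :
    ∫⁻ e, g (fun i => m i + e i) ∂Measure.pi (fun _ : Fin n => gaussianReal 0 v) =
      ∫⁻ y, g y * ∏ i, gaussianPDF (m i) v (y i) := by
  have hmp : MeasurePreserving (fun (e : Fin n → ℝ) i => m i + e i)
      (Measure.pi fun _ : Fin n => gaussianReal 0 v)
      (Measure.pi fun i => gaussianReal (m i) v) := by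
    refine measurePreserving_pi _ _ fun i => ⟨by fun_prop, ?_⟩
    rw [gaussianReal_map_const_add, zero_add]
  rw [hmp.lintegral_comp hg, pi_gaussianReal_eq_withDensity m hv,
    lintegral_withDensity_eq_lintegral_mul _ _ hg]
  · simp [mul_comm]
  · exact Finset.measurable_fun_prod _ fun i _ =>
      (measurable_gaussianPDF _ _).comp (measurable_pi_apply i)

lemma gaussianPDF_le (m : ℝ) (v : ℝ≥0) (y : ℝ) :
    gaussianPDF m v y ≤ ENNReal.ofReal (√(2 * Real.pi * v))⁻¹ := by
  refine ENNReal.ofReal_le_ofReal ?_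
  rw [gaussianPDFReal]
  refine mul_le_of_le_one_right (by positivity) ?_
  rw [Real.exp_le_one_iff, neg_div]
  exact neg_nonpos.2 (by positivity)

lemma lik_le {d n : ℕ} (s : ℝ≥0) (h : Pt d → ℝ) (D : Data d n) :
    lik s h D ≤ ENNReal.ofReal (√(2 * Real.pi * (s ^ 2 : ℝ≥0)))⁻¹ ^ n := by
  calc lik s h D ≤ ∏ _i : Fin n, ENNReal.ofReal (√(2 * Real.pi * (s ^ 2 : ℝ≥0)))⁻¹ :=
        Finset.prod_le_prod' fun i _ => gaussianPDF_le _ _ _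
    _ = _ := by simp

lemma continuous_lik {d n : ℕ} (s : ℝ≥0) (h : Pt d → ℝ) (a : Fin n → Pt d) :
    Continuous fun y : Fin n → ℝ => lik s h fun i => (a i, y i) := by
  have : (fun y : Fin n → ℝ => lik s h fun i => (a i, y i)) =
      fun y => ENNReal.ofReal (∏ i, gaussianPDFReal (h (a i)) (s ^ 2) (y i)) := by
    funext y
    rw [ENNReal.ofReal_prod_of_nonneg fun i _ => gaussianPDFReal_nonneg _ _ _]
    rfl
  rw [this]
  refine ENNReal.continuous_ofReal.comp (continuous_finsetProd _ fun i _ => ?_)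
  unfold gaussianPDFReal
  fun_prop

namespace IsGPModel

variable {d n : ℕ} {Ω : Type*} [MeasurableSpace Ω] {P : Measure Ω} [IsProbabilityMeasure P]
  {X : Set (Pt d)} {k : Pt d → Pt d → ℝ} {s : ℝ≥0} {f : Pt d → Ω → ℝ} {ε : ℕ → Ω → ℝ}

lemma measurable_path (hm : IsGPModel P X k s f ε) : Measurable fun ω (x : X) => f x ω :=
  measurable_pi_lambda _ fun x => hm.measurable_f x x.2

lemma measurable_lik_design (hm : IsGPModel P X k s f ε) {a : Fin n → Pt d}
    (ha : ∀ i, a i ∈ X) :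
    Measurable fun q : Ω × (Fin n → ℝ) => lik s (f · q.1) fun i => (a i, q.2 i) := by
  unfold lik
  refine Finset.measurable_fun_prod _ fun i _ => ?_
  have h1 : Measurable fun q : Ω × (Fin n → ℝ) => f (a i) q.1 :=
    (hm.measurable_f _ (ha i)).comp measurable_fst
  have h2 : Measurable fun q : Ω × (Fin n → ℝ) => q.2 i := by fun_prop
  exact measurable_uncurry_gaussianPDF.comp (h1.prodMk (measurable_const.prodMk h2))

lemma measurable_lik_data (hm : IsGPModel P X k s f ε) {D : Data d n}
    (hD : ∀ i, (D i).1 ∈ X) : Measurable fun ω => lik s (f · ω) D := by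
  unfold lik
  exact Finset.measurable_fun_prod _ fun i _ => measurable_uncurry_gaussianPDF.comp
    ((hm.measurable_f _ (hD i)).prodMk (measurable_const.prodMk measurable_const))

/-- Joint law of the objective and noisy observations at fixed query points. -/
lemma lintegral_design (hm : IsGPModel P X k s f ε) (hs : 0 < s) {a : Fin n → Pt d}
    (ha : ∀ i, a i ∈ X) {g : (X → ℝ) × (Fin n → ℝ) → ℝ≥0∞} (hg : Measurable g) :
    ∫⁻ ω, g (fun x => f x ω, fun i => f (a i) ω + ε i ω) ∂P =
      ∫⁻ y : Fin n → ℝ, ∫⁻ ω, g (fun x => f x ω, y) * lik s (f · ω) (fun i => (a i, y i)) ∂P := by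
  have hv : s ^ 2 ≠ 0 := pow_ne_zero _ hs.ne'
  have hp := hm.measurable_path
  have hεn : Measurable fun ω (i : Fin n) => ε i ω :=
    measurable_pi_lambda _ fun i => hm.measurable_noise i
  have hind : IndepFun (fun ω (x : X) => f x ω) (fun ω (i : Fin n) => ε i ω) P :=
    hm.indep.comp (φ := id) (ψ := fun u : ℕ → ℝ => fun i : Fin n => u i) measurable_id
      (by fun_prop)
  have hlaw : P.map (fun ω (i : Fin n) => ε i ω) =
      Measure.pi fun _ : Fin n => gaussianReal 0 (s ^ 2) := by
    have := (iIndepFun_iff_map_fun_eq_pi_map fun i : Fin n =>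
      (hm.measurable_noise i).aemeasurable).1 (hm.noise_indep.precomp Fin.val_injective)
    rw [this]
    simp only [hm.noise_law]
  have hprod := (indepFun_iff_map_prod_eq_prod_map_map hp.aemeasurable hεn.aemeasurable).1 hind
  rw [hlaw] at hprod
  have hsh : Measurable fun q : (X → ℝ) × (Fin n → ℝ) =>
      (q.1, fun i => q.1 ⟨a i, ha i⟩ + q.2 i) := by fun_prop
  have hgsh : Measurable fun q : (X → ℝ) × (Fin n → ℝ) =>
      g (q.1, fun i => q.1 ⟨a i, ha i⟩ + q.2 i) := hg.comp hsh
  have hj : Measurable fun q : Ω × (Fin n → ℝ) =>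
      g (fun x => f x q.1, q.2) * lik s (f · q.1) fun i => (a i, q.2 i) :=
    (hg.comp ((hp.comp measurable_fst).prodMk measurable_snd)).mul (hm.measurable_lik_design ha)
  have hj' : AEMeasurable (Function.uncurry fun (y : Fin n → ℝ) (ω : Ω) =>
      g (fun x => f x ω, y) * lik s (f · ω) fun i => (a i, y i))
      ((volume : Measure (Fin n → ℝ)).prod P) := (hj.comp measurable_swap).aemeasurable
  rw [lintegral_lintegral_swap hj']
  calc ∫⁻ ω, g (fun x => f x ω, fun i => f (a i) ω + ε i ω) ∂P
      = ∫⁻ q, g (q.1, fun i => q.1 ⟨a i, ha i⟩ + q.2 i)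
          ∂(P.map fun ω => ((fun x : X => f x ω), fun i : Fin n => ε i ω)) := by
        rw [lintegral_map hgsh (hp.prodMk hεn)]
    _ = ∫⁻ ω, ∫⁻ e, g (fun x => f x ω, fun i => f (a i) ω + e i)
          ∂(Measure.pi fun _ : Fin n => gaussianReal 0 (s ^ 2)) ∂P := by
        rw [hprod, lintegral_prod _ hgsh.aemeasurable, lintegral_map _ hp]
        exact Measurable.lintegral_prod_right hgsh
    _ = _ := by
        refine lintegral_congr fun ω => ?_
        have hgω : Measurable fun y : Fin n → ℝ => g (fun x => f x ω, y) :=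
          hg.comp (measurable_const.prodMk measurable_id)
        exact lintegral_pi_gaussianReal_shift (fun i => f (a i) ω) hv hgω

/-- Dominated convergence, using that the likelihood is bounded. Continuity in `y` upgrades the
conjugacy identity from almost every `y` to every `y`. -/
lemma continuous_lintegral_lik (hm : IsGPModel P X k s f ε) {a : Fin n → Pt d}
    (ha : ∀ i, a i ∈ X) {h : Ω → ℝ≥0} (hh : Measurable h) {C : ℝ≥0} (hC : ∀ ω, h ω ≤ C) :
    Continuous fun y : Fin n → ℝ => ∫⁻ ω, h ω * lik s (f · ω) (fun i => (a i, y i)) ∂P := by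
  rw [continuous_iff_continuousAt]
  intro y
  refine tendsto_lintegral_filter_of_dominated_convergence
    (fun _ => C * ENNReal.ofReal (√(2 * Real.pi * (s ^ 2 : ℝ≥0)))⁻¹ ^ n)
    (.of_forall fun y => ?_) (.of_forall fun y => .of_forall fun ω => ?_) ?_
    (.of_forall fun ω => ?_)
  · exact hh.coe_nnreal_ennreal.mul (hm.measurable_lik_data (D := fun i => (a i, y i)) ha)
  · exact mul_le_mul' (by exact_mod_cast hC ω) (lik_le _ _ _)
  · rw [lintegral_const, measure_univ, mul_one]
    exact (ENNReal.mul_lt_top ENNReal.coe_lt_top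
      (ENNReal.pow_lt_top ENNReal.ofReal_lt_top)).ne
  · exact ENNReal.Tendsto.const_mul ((continuous_lik s (f · ω) a).tendsto y)
      (Or.inr ENNReal.coe_ne_top)

lemma lintegral_lik_lt_top (D : Data d n) : ∫⁻ ω, lik s (f · ω) D ∂P < ∞ := by
  refine (lintegral_mono fun ω => lik_le s (f · ω) D).trans_lt ?_
  rw [lintegral_const, measure_univ, mul_one]
  exact ENNReal.pow_lt_top ENNReal.ofReal_lt_top

/-- The regression weights, like the posterior variance below, do not see the observed values; so
the observations may be set to `0` when only these matter. -/
lemma weights_congr {D D' : Data d n} (h : ∀ i, (D i).1 = (D' i).1) (x : Pt d) :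
    weights k s D x = weights k s D' x := by
  have hk : kernelVec k D x = kernelVec k D' x := by funext i; simp only [kernelVec, h]
  simp only [weights, regKernelMatrix, hk, h]

lemma postVar_congr {D D' : Data d n} (h : ∀ i, (D i).1 = (D' i).1) (x : Pt d) :
    postVar k s D x = postVar k s D' x := by
  have hk : kernelVec k D x = kernelVec k D' x := by funext i; simp only [kernelVec, h]
  simp only [postVar, regKernelMatrix, hk, h]

/-- Conjugacy for bounded continuous test functions: the posterior law of `f x`, given observations
`y` at the query points `a`, is the Gaussian law with mean `postMean` and variance `postVar`. -/
lemma lintegral_boundedContinuous_mul_lik (hm : IsGPModel P X k s f ε) (hs : 0 < s)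
    {a : Fin n → Pt d} (ha : ∀ i, a i ∈ X) {x : Pt d} (hx : x ∈ X)
    (ψ : BoundedContinuousFunction ℝ ℝ≥0) (y : Fin n → ℝ) :
    ∫⁻ ω, ψ (f x ω) * lik s (f · ω) (fun i => (a i, y i)) ∂P =
      (∫⁻ ω, lik s (f · ω) (fun i => (a i, y i)) ∂P) *
        ∫⁻ z, ψ z ∂gaussianReal (postMean k s (fun i => (a i, y i)) x)
          (postVar k s (fun i => (a i, y i)) x).toNNReal := by
  set D₀ : Data d n := fun i => (a i, 0) with hD₀
  set w := weights k s D₀ x with hw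
  set v := (postVar k s D₀ x).toNNReal with hv
  have hψ : Measurable fun z => (ψ z : ℝ≥0∞) := ψ.continuous.measurable.coe_nnreal_ennreal
  obtain ⟨C, hC⟩ : ∃ C : ℝ≥0, ∀ z, ψ z ≤ C :=
    ⟨nndist 0 ψ, fun z => ψ.apply_le_nndist_zero z⟩
  set κ : (Fin n → ℝ) → ℝ≥0∞ := fun y => ∫⁻ z, ψ (∑ i, w i * y i + z) ∂gaussianReal 0 v with hκ
  have hκ' : ∀ y : Fin n → ℝ, ∫⁻ z, ψ z ∂gaussianReal (postMean k s (fun i => (a i, y i)) x)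
      (postVar k s (fun i => (a i, y i)) x).toNNReal = κ y := by
    intro y
    rw [hm.postMean_eq (D := fun i => (a i, y i)) hs ha,
      weights_congr (D := fun i => (a i, y i)) (D' := D₀) (fun i => rfl),
      postVar_congr (D := fun i => (a i, y i)) (D' := D₀) (fun i => rfl), hκ]
    have : gaussianReal (∑ i, w i * y i) v =
        (gaussianReal 0 v).map (∑ i, w i * y i + ·) := by
      rw [gaussianReal_map_const_add, zero_add]
    rw [← hv, ← hw]
    simp only
    rw [this, lintegral_map hψ (by fun_prop)]
  have hκle : ∀ y, κ y ≤ C := fun y => by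
    calc κ y ≤ ∫⁻ _, C ∂gaussianReal 0 v := lintegral_mono fun z => ENNReal.coe_le_coe.2 (hC _)
      _ = C := by simp
  have hκc : Continuous κ := by
    rw [continuous_iff_continuousAt]
    intro y
    refine tendsto_lintegral_filter_of_dominated_convergence (fun _ => (C : ℝ≥0∞))
      (.of_forall fun y => ?_) (.of_forall fun y => .of_forall fun z => ?_) ?_
      (.of_forall fun z => ?_)
    · exact hψ.comp (by fun_prop)
    · exact_mod_cast hC _
    · simp
    · refine Continuous.tendsto (f := fun y : Fin n → ℝ => (ψ (∑ i, w i * y i + z) : ℝ≥0∞)) ?_ y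
      exact ENNReal.continuous_coe.comp (ψ.continuous.comp (by fun_prop))
  rw [hκ' y]
  have hfx := hm.measurable_f x hx
  have hu : Continuous fun y : Fin n → ℝ =>
      ∫⁻ ω, ψ (f x ω) * lik s (f · ω) (fun i => (a i, y i)) ∂P :=
    hm.continuous_lintegral_lik ha (h := fun ω => ψ (f x ω))
      (ψ.continuous.measurable.comp hfx) (C := C) fun ω => hC _
  have hc : Continuous fun y : Fin n → ℝ => ∫⁻ ω, lik s (f · ω) (fun i => (a i, y i)) ∂P := by
    simpa using hm.continuous_lintegral_lik ha (h := fun _ => 1) measurable_const (C := 1)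
      fun ω => le_rfl
  have hcκ : Continuous fun y : Fin n → ℝ =>
      (∫⁻ ω, lik s (f · ω) (fun i => (a i, y i)) ∂P) * κ y := by
    rw [continuous_iff_continuousAt]
    exact fun y => ENNReal.Tendsto.mul (hc.tendsto y)
      (Or.inr ((hκle y).trans_lt ENNReal.coe_lt_top).ne) (hκc.tendsto y)
      (Or.inr (lintegral_lik_lt_top _).ne)
  -- Both sides are continuous in `y`, so equality Lebesgue-almost everywhere is enough. The
  -- pointwise identity is needed later, since under an adaptive rule the design itself varies with
  -- the observations and a null set depending on the design could not be discarded.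
  refine congrFun ((hu.ae_eq_iff_eq volume hcκ).1 ?_) y
  refine ae_eq_of_forall_setLIntegral_eq_of_sigmaFinite hu.measurable hcκ.measurable
    fun B hB _ => ?_
  have hY : Measurable fun ω (i : Fin n) => f (a i) ω + ε i ω :=
    measurable_pi_lambda _ fun i => (hm.measurable_f _ (ha i)).add (hm.measurable_noise i)
  have hind : IndepFun (fun ω (i : Fin n) => f (a i) ω + ε i ω) (residual k s f ε D₀ x) P :=
    (hm.indepFun_residual_obs (D := D₀) hs ha hx).symm
  have hR := hm.measurable_residual (D := D₀) (s := s) ha hx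
  have hjoint := (indepFun_iff_map_prod_eq_prod_map_map hY.aemeasurable hR.aemeasurable).1 hind
  rw [hm.map_residual (D := D₀) hs ha hx, ← hv] at hjoint
  have hG : Measurable fun q : (Fin n → ℝ) × ℝ =>
      B.indicator 1 q.1 * (ψ (∑ i, w i * q.1 i + q.2) : ℝ≥0∞) :=
    ((measurable_one.indicator hB).comp measurable_fst).mul (hψ.comp (by fun_prop))
  -- Split `f x` into the posterior mean, a function of the observations, and the residual, and
  -- integrate out the residual by independence.
  have key : ∫⁻ ω, B.indicator 1 (fun i => f (a i) ω + ε i ω) * (ψ (f x ω) : ℝ≥0∞) ∂P =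
      ∫⁻ ω, B.indicator 1 (fun i => f (a i) ω + ε i ω) *
        κ (fun i => f (a i) ω + ε i ω) ∂P := by
    calc _ = ∫⁻ q, B.indicator 1 q.1 * (ψ (∑ i, w i * q.1 i + q.2) : ℝ≥0∞)
          ∂(P.map fun ω => ((fun i => f (a i) ω + ε i ω), residual k s f ε D₀ x ω)) := by
          rw [lintegral_map hG (hY.prodMk hR)]
          refine lintegral_congr fun ω => ?_
          simp only [residual, hD₀]
          congr 3
          ring
      _ = _ := by
          rw [hjoint, lintegral_prod _ hG.aemeasurable, lintegral_map _ hY]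
          · refine lintegral_congr fun ω => ?_
            have hsec : Measurable fun z : ℝ =>
                (ψ (∑ i, w i * (f (a i) ω + ε i ω) + z) : ℝ≥0∞) := hψ.comp (by fun_prop)
            simp only [hκ]
            rw [lintegral_const_mul _ hsec]
          · exact Measurable.lintegral_prod_right hG
  have e1 := hm.lintegral_design hs ha
    (g := fun q => B.indicator 1 q.2 * (ψ (q.1 ⟨x, hx⟩) : ℝ≥0∞))
    (((measurable_one.indicator hB).comp measurable_snd).mul (hψ.comp (by fun_prop)))
  have e2 := hm.lintegral_design hs ha (g := fun q => B.indicator 1 q.2 * κ q.2)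
    (((measurable_one.indicator hB).mul hκc.measurable).comp measurable_snd)
  simp only at e1 e2
  rw [e1, e2] at key
  rw [← lintegral_indicator hB, ← lintegral_indicator hB]
  convert key using 2
  · funext y
    by_cases hy : y ∈ B <;> simp [hy]
  · funext y
    by_cases hy : y ∈ B
    · simp only [hy, Set.indicator_of_mem, Pi.one_apply, one_mul]
      rw [lintegral_const_mul _ (hm.measurable_lik_data (D := fun i => (a i, y i)) ha), mul_comm]
    · simp [hy]

/-- Conjugacy: the posterior law of `f x` given the data `D` is the Gaussian law with mean
`postMean` and variance `postVar`. -/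
theorem lintegral_mul_lik (hm : IsGPModel P X k s f ε) (hs : 0 < s) {D : Data d n}
    (hD : ∀ i, (D i).1 ∈ X) {x : Pt d} (hx : x ∈ X) {ψ : ℝ → ℝ≥0∞} (hψ : Measurable ψ) :
    ∫⁻ ω, ψ (f x ω) * lik s (f · ω) D ∂P =
      (∫⁻ ω, lik s (f · ω) D ∂P) *
        ∫⁻ z, ψ z ∂gaussianReal (postMean k s D x) (postVar k s D x).toNNReal := by
  have hL := hm.measurable_lik_data (s := s) hD
  have hfx := hm.measurable_f x hx
  have hfin : IsFiniteMeasure ((P.withDensity fun ω => lik s (f · ω) D).map (f x)) := by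
    have : IsFiniteMeasure (P.withDensity fun ω => lik s (f · ω) D) :=
      isFiniteMeasure_withDensity (lintegral_lik_lt_top D).ne
    infer_instance
  have hmap : ∀ φ : ℝ → ℝ≥0∞, Measurable φ →
      ∫⁻ z, φ z ∂((P.withDensity fun ω => lik s (f · ω) D).map (f x)) =
        ∫⁻ ω, φ (f x ω) * lik s (f · ω) D ∂P := fun φ hφ => by
    rw [lintegral_map hφ hfx, lintegral_withDensity_eq_lintegral_mul _ hL (g := fun ω => φ (f x ω)) (hφ.comp hfx)]
    simp [mul_comm]
  have hμ : (P.withDensity fun ω => lik s (f · ω) D).map (f x) =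
      (∫⁻ ω, lik s (f · ω) D ∂P) •
        gaussianReal (postMean k s D x) (postVar k s D x).toNNReal := by
    -- Finite measures on the line are determined by bounded continuous functions, which extends
    -- conjugacy to all measurable `ψ`.
    refine ext_of_forall_lintegral_eq_of_IsFiniteMeasure fun φ => ?_
    rw [hmap _ φ.continuous.measurable.coe_nnreal_ennreal, lintegral_smul_measure]
    exact hm.lintegral_boundedContinuous_mul_lik hs hD hx φ fun i => (D i).2
  rw [← hmap ψ hψ, hμ, lintegral_smul_measure, smul_eq_mul]

end IsGPModel

/-! ### Predictive densities and the information gain. -/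

lemma measurable_gaussianPDF_comp {α : Type*} [MeasurableSpace α] {m y : α → ℝ}
    (hm : Measurable m) (hy : Measurable y) (v : ℝ≥0) :
    Measurable fun a => gaussianPDF (m a) v (y a) :=
  measurable_uncurry_gaussianPDF.comp (hm.prodMk (measurable_const.prodMk hy))

/-- Completing the square in `z`: prior times likelihood equals evidence times posterior. -/
lemma gaussianPDFReal_mul_gaussianPDFReal (m y z : ℝ) {u v : ℝ≥0} (hu : u ≠ 0) (hv : v ≠ 0) :
    gaussianPDFReal m v z * gaussianPDFReal z u y =
      gaussianPDFReal m (v + u) y *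
        gaussianPDFReal ((u * m + v * y) / (v + u)) (v * u / (v + u)) z := by
  have hu' : (0 : ℝ) < u := by exact_mod_cast pos_iff_ne_zero.2 hu
  have hv' : (0 : ℝ) < v := by exact_mod_cast pos_iff_ne_zero.2 hv
  have hsqrt : √(2 * Real.pi * v) * √(2 * Real.pi * u) =
      √(2 * Real.pi * (v + u)) * √(2 * Real.pi * (v * u / (v + u))) := by
    rw [← Real.sqrt_mul (by positivity), ← Real.sqrt_mul (by positivity)]
    congr 1
    field_simp
  have hexp : -(z - m) ^ 2 / (2 * v) + -(y - z) ^ 2 / (2 * u) =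
      -(y - m) ^ 2 / (2 * (v + u)) +
        -(z - (u * m + v * y) / (v + u)) ^ 2 / (2 * (v * u / (v + u))) := by
    field_simp
    ring
  simp only [gaussianPDFReal, NNReal.coe_add, NNReal.coe_mul, NNReal.coe_div]
  rw [mul_mul_mul_comm, mul_mul_mul_comm (√(2 * Real.pi * (v + u)))⁻¹, ← mul_inv, ← mul_inv,
    hsqrt, ← Real.exp_add, ← Real.exp_add, hexp]

/-- Convolution of Gaussian densities. -/
lemma lintegral_gaussianPDF_gaussianReal (m y : ℝ) {u : ℝ≥0} (hu : u ≠ 0) (v : ℝ≥0) :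
    ∫⁻ z, gaussianPDF z u y ∂gaussianReal m v = gaussianPDF m (v + u) y := by
  have hmeas : Measurable fun z => gaussianPDF z u y :=
    measurable_uncurry_gaussianPDF.comp
      (measurable_id.prodMk (measurable_const.prodMk measurable_const))
  by_cases hv : v = 0
  · rw [hv, gaussianReal_zero_var, lintegral_dirac' _ hmeas, zero_add]
  rw [gaussianReal_of_var_ne_zero _ hv, lintegral_withDensity_eq_lintegral_mul _
    (measurable_gaussianPDF _ _) hmeas]
  have h : ∀ z, gaussianPDF m v z * gaussianPDF z u y = gaussianPDF m (v + u) y *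
      gaussianPDF ((u * m + v * y) / (v + u)) (v * u / (v + u)) z := fun z => by
    simp only [gaussianPDF]
    rw [← ENNReal.ofReal_mul (gaussianPDFReal_nonneg _ _ _),
      ← ENNReal.ofReal_mul (gaussianPDFReal_nonneg _ _ _),
      gaussianPDFReal_mul_gaussianPDFReal m y z hu hv]
  simp only [Pi.mul_apply, h]
  rw [lintegral_const_mul _ (measurable_gaussianPDF _ _), lintegral_gaussianPDF_eq_one, mul_one]
  exact div_ne_zero (mul_ne_zero hv hu) (add_pos_of_pos_of_nonneg (pos_iff_ne_zero.2 hv) u.2).ne'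

lemma log_gaussianPDFReal (m y : ℝ) {v : ℝ≥0} (hv : v ≠ 0) :
    Real.log (gaussianPDFReal m v y) =
      -(Real.log (2 * Real.pi * v) / 2) - (y - m) ^ 2 / (2 * v) := by
  have hv' : (0 : ℝ) < v := by exact_mod_cast pos_iff_ne_zero.2 hv
  rw [gaussianPDFReal, Real.log_mul (by positivity) (Real.exp_pos _).ne', Real.log_exp,
    Real.log_inv, Real.log_sqrt (by positivity)]
  ring

/-- The first `n` entries of a data stream. -/
def prefixData {d : ℕ} (D : ℕ → Pt d × ℝ) (n : ℕ) : Data d n := fun i => D i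

namespace IsGPModel

variable {d : ℕ} {Ω : Type*} [MeasurableSpace Ω] {P : Measure Ω} [IsProbabilityMeasure P]
  {X : Set (Pt d)} {k : Pt d → Pt d → ℝ} {s : ℝ≥0} {f : Pt d → Ω → ℝ} {ε : ℕ → Ω → ℝ}

/-- The marginal density of the observations factorizes into the predictive densities. -/
lemma lintegral_lik_prefixData (hm : IsGPModel P X k s f ε) (hs : 0 < s) {D : ℕ → Pt d × ℝ}
    (hD : ∀ t, (D t).1 ∈ X) (n : ℕ) :
    ∫⁻ ω, lik s (f · ω) (prefixData D n) ∂P =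
      ∏ t ∈ Finset.range n, gaussianPDF (postMean k s (prefixData D t) (D t).1)
        ((postVar k s (prefixData D t) (D t).1).toNNReal + s ^ 2) (D t).2 := by
  induction n with
  | zero => simp [lik]
  | succ n ih =>
    -- Conjugacy is applied to the density of the next observation as a function of `f` at the next
    -- query; convolution with the posterior then gives the predictive density.
    have hψ : Measurable fun z => gaussianPDF z (s ^ 2) (D n).2 :=
      measurable_uncurry_gaussianPDF.comp
        (measurable_id.prodMk (measurable_const.prodMk measurable_const))
    have h := hm.lintegral_mul_lik hs (D := prefixData D n) (fun i => hD i) (hD n) hψ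
    rw [lintegral_gaussianPDF_gaussianReal _ _ (pow_ne_zero _ hs.ne')] at h
    rw [Finset.prod_range_succ, ← ih, ← h]
    refine lintegral_congr fun ω => ?_
    rw [lik, Fin.prod_univ_castSucc, mul_comm]
    rfl

/-- Mutual information between noisy observations and the objective at fixed query points. -/
theorem mutualInfo_eq (hm : IsGPModel P X k s f ε) (hs : 0 < s) {a : ℕ → Pt d}
    (ha : ∀ t, a t ∈ X) (T : ℕ) :
    mutualInfo P (fun ω (i : Fin T) => f (a i) ω + ε i ω) (fun ω (i : Fin T) => f (a i) ω) =
      ENNReal.ofReal (∑ t ∈ Finset.range T,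
        Real.log (1 + postVar k s (prefixData (fun i => (a i, 0)) t) (a t) / (s : ℝ) ^ 2) / 2) := by
  set Y : Ω → Fin T → ℝ := fun ω i => f (a i) ω + ε i ω with hY
  set F : Ω → Fin T → ℝ := fun ω i => f (a i) ω with hF
  have haT : ∀ i : Fin T, a i ∈ X := fun i => ha i
  have hs2 : s ^ 2 ≠ 0 := pow_ne_zero _ hs.ne'
  have hFm : Measurable F := measurable_pi_lambda _ fun i => hm.measurable_f _ (ha i)
  have hYm : Measurable Y :=
    measurable_pi_lambda _ fun i => (hm.measurable_f _ (ha i)).add (hm.measurable_noise i)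
  -- the density of `Y`
  set c : (Fin T → ℝ) → ℝ≥0∞ := fun y => ∫⁻ ω, lik s (f · ω) (fun i : Fin T => (a i, y i)) ∂P
    with hc
  set v : ℕ → ℝ := fun t => postVar k s (prefixData (fun i => (a i, 0)) t) (a t) with hv
  -- The finite vector is extended to a stream by `0`; only the first `T` entries are used.
  set st : (Fin T → ℝ) → ℕ → Pt d × ℝ := fun y t => (a t, if h : t < T then y ⟨t, h⟩ else 0)
    with hst
  have hst_pre : ∀ y, prefixData (st y) T = fun i : Fin T => (a i, y i) := fun y => by
    funext i
    simp [prefixData, hst]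
  have hvst : ∀ y t, postVar k s (prefixData (st y) t) (a t) = v t := fun y t =>
    postVar_congr (fun i => rfl) _
  have hv0 : ∀ t, 0 ≤ v t := fun t => hm.postVar_nonneg hs (fun i => ha i) (ha t)
  have hw : ∀ t, (v t).toNNReal + s ^ 2 ≠ 0 := fun t =>
    (add_pos_of_nonneg_of_pos zero_le (pos_iff_ne_zero.2 hs2)).ne'
  have hc_eq : ∀ y, c y = ∏ t ∈ Finset.range T,
      gaussianPDF (postMean k s (prefixData (st y) t) (a t)) ((v t).toNNReal + s ^ 2)
        (st y t).2 := fun y => by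
    have := hm.lintegral_lik_prefixData hs (D := st y) (fun t => ha t) T
    rw [hst_pre] at this
    simp only [hc, this]
    refine Finset.prod_congr rfl fun t _ => ?_
    rw [← hvst y t]
  have hc0 : ∀ y, c y ≠ 0 := fun y => by
    rw [hc_eq]
    exact Finset.prod_ne_zero_iff.2 fun t _ => (gaussianPDF_pos _ (hw t) _).ne'
  have hctop : ∀ y, c y ≠ ∞ := fun y => (lintegral_lik_lt_top _).ne
  have hcm : Measurable c := Measurable.lintegral_prod_left (hm.measurable_lik_design haT)
  set L : (Fin T → ℝ) × (Fin T → ℝ) → ℝ≥0∞ := fun q => ∏ i, gaussianPDF (q.2 i) (s ^ 2) (q.1 i)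
    with hL
  have hLm : Measurable L := Finset.measurable_fun_prod _ fun i _ =>
    measurable_gaussianPDF_comp ((measurable_pi_apply i).comp measurable_snd)
      ((measurable_pi_apply i).comp measurable_fst) _
  have hρm : Measurable fun q : (Fin T → ℝ) × (Fin T → ℝ) => L q / c q.1 :=
    hLm.div (hcm.comp measurable_fst)
  have hYlaw : ∀ g : (Fin T → ℝ) → ℝ≥0∞, Measurable g →
      ∫⁻ y, g y ∂P.map Y = ∫⁻ y, g y * c y := fun g hg => by
    rw [lintegral_map hg hYm]
    have h := hm.lintegral_design hs haT (g := fun q => g q.2) (hg.comp measurable_snd)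
    rw [h]
    refine lintegral_congr fun y => ?_
    change ∫⁻ ω, g y * lik s (f · ω) (fun i : Fin T => (a i, y i)) ∂P = _
    rw [lintegral_const_mul _ (hm.measurable_lik_data (D := fun i : Fin T => (a i, y i)) haT)]
  have : IsProbabilityMeasure (P.map Y) := Measure.isProbabilityMeasure_map hYm.aemeasurable
  have : IsProbabilityMeasure (P.map F) := Measure.isProbabilityMeasure_map hFm.aemeasurable
  have : IsProbabilityMeasure (P.map fun ω => (Y ω, F ω)) :=
    Measure.isProbabilityMeasure_map (hYm.prodMk hFm).aemeasurable
  -- The density of the joint law relative to the product of the marginals is the conditional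
  -- density `L` of the observations given the objective, divided by their marginal density `c`.
  have hdens : (P.map fun ω => (Y ω, F ω)) =
      ((P.map Y).prod (P.map F)).withDensity fun q => L q / c q.1 := by
    refine Measure.ext_of_lintegral _ fun g hg => ?_
    have hρg : Measurable fun q : (Fin T → ℝ) × (Fin T → ℝ) => L q / c q.1 * g q := hρm.mul hg
    rw [lintegral_withDensity_eq_lintegral_mul _ hρm hg, lintegral_map hg (hYm.prodMk hFm)]
    simp only [Pi.mul_apply]
    rw [lintegral_prod _ hρg.aemeasurable, hYlaw _ (Measurable.lintegral_prod_right hρg)]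
    have h := hm.lintegral_design hs haT (g := fun q => g (q.2, fun i => q.1 ⟨a i, ha i⟩))
      (hg.comp (by fun_prop))
    rw [h]
    refine lintegral_congr fun y => ?_
    have hsec : Measurable fun h : Fin T → ℝ => L (y, h) / c y * g (y, h) :=
      hρg.comp (measurable_const.prodMk measurable_id)
    have hsecF : Measurable fun ω => L (y, F ω) / c y * g (y, F ω) := hsec.comp hFm
    rw [lintegral_map hsec hFm, ← lintegral_mul_const _ hsecF]
    refine lintegral_congr fun ω => ?_
    have : lik s (f · ω) (fun i : Fin T => (a i, y i)) = L (y, F ω) := rfl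
    rw [this, mul_right_comm, ENNReal.div_mul_cancel (hc0 y) (hctop y), mul_comm]
  have hac : (P.map fun ω => (Y ω, F ω)) ≪ (P.map Y).prod (P.map F) := by
    rw [hdens]
    exact withDensity_absolutelyContinuous _ _
  have hllr : llr (P.map fun ω => (Y ω, F ω)) ((P.map Y).prod (P.map F))
      =ᵐ[P.map fun ω => (Y ω, F ω)] fun q => Real.log (L q / c q.1).toReal := by
    have h := Measure.rnDeriv_withDensity ((P.map Y).prod (P.map F)) hρm
    rw [← hdens] at h
    filter_upwards [hac.ae_le h] with q hq
    rw [llr, hq]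
  -- the log-density in terms of the noise and the innovations
  set D₀ : (t : ℕ) → Data d t := prefixData fun i => (a i, 0) with hD₀
  have hlog : ∀ ω, Real.log (L (Y ω, F ω) / c (Y ω)).toReal = ∑ t ∈ Finset.range T,
      (Real.log (1 + v t / (s : ℝ) ^ 2) / 2 - (ε t ω) ^ 2 / (2 * (s : ℝ) ^ 2) +
        (residual k s f ε (D₀ t) (a t) ω + ε t ω) ^ 2 / (2 * (v t + (s : ℝ) ^ 2))) := by
    intro ω
    have hL' : (L (Y ω, F ω)).toReal = ∏ t ∈ Finset.range T,
        gaussianPDFReal (f (a t) ω) (s ^ 2) (f (a t) ω + ε t ω) := by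
      simp only [hL, hY, hF]
      rw [ENNReal.toReal_prod, Finset.prod_range]
      simp only [toReal_gaussianPDF]
    have hc' : (c (Y ω)).toReal = ∏ t ∈ Finset.range T,
        gaussianPDFReal (postMean k s (prefixData (st (Y ω)) t) (a t)) ((v t).toNNReal + s ^ 2)
          (st (Y ω) t).2 := by
      rw [hc_eq, ENNReal.toReal_prod]
      simp only [toReal_gaussianPDF]
    rw [ENNReal.toReal_div, hL', hc', ← Finset.prod_div_distrib, Real.log_prod]
    · refine Finset.sum_congr rfl fun t ht => ?_
      have htT := Finset.mem_range.1 ht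
      have hst2 : (st (Y ω) t).2 = f (a t) ω + ε t ω := by simp [hst, htT, hY]
      -- Hence the innovation `y_t - μ_{t-1}(a_t)` is the residual plus the new noise.
      have hpm : postMean k s (prefixData (st (Y ω)) t) (a t) =
          f (a t) ω - residual k s f ε (D₀ t) (a t) ω := by
        rw [hm.postMean_eq hs (fun i => ha i), residual,
          weights_congr (D := prefixData (st (Y ω)) t) (D' := D₀ t) (fun i => rfl),
          sub_sub_cancel]
        refine Finset.sum_congr rfl fun i _ => ?_
        simp [prefixData, hst, hD₀, hY, i.2.trans htT]
      have hs' : (0 : ℝ) < (s : ℝ) ^ 2 := by positivity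
      have hsv : 0 < v t + (s : ℝ) ^ 2 := add_pos_of_nonneg_of_pos (hv0 t) hs'
      rw [Real.log_div (gaussianPDFReal_pos _ _ _ hs2).ne' (gaussianPDFReal_pos _ _ _ (hw t)).ne',
        log_gaussianPDFReal _ _ hs2, log_gaussianPDFReal _ _ (hw t), hst2, hpm]
      simp only [NNReal.coe_add, NNReal.coe_pow, Real.coe_toNNReal _ (hv0 t)]
      rw [Real.log_mul (by positivity) hs'.ne', Real.log_mul (by positivity) hsv.ne',
        show 1 + v t / (s : ℝ) ^ 2 = (v t + (s : ℝ) ^ 2) / (s : ℝ) ^ 2 by field_simp; ring,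
        Real.log_div hsv.ne' hs'.ne']
      ring
    · exact fun t _ => div_ne_zero (gaussianPDFReal_pos _ _ _ hs2).ne'
        (gaussianPDFReal_pos _ _ _ (hw t)).ne'
  have hε2 : ∀ t, Integrable (fun ω => (ε t ω) ^ 2) P ∧ ∫ ω, (ε t ω) ^ 2 ∂P = (s : ℝ) ^ 2 :=
    fun t => ⟨(hm.memLp_noise t).integrable_sq, by
      rw [← hm.variance_noise t, variance_of_integral_eq_zero
        (hm.measurable_noise t).aemeasurable (hm.integral_noise t)]⟩
  have hinn : ∀ t, _ ∧ _ := fun t =>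
    hm.integral_innovation_sq hs (D := D₀ t) (fun i => ha i) (ha t)
  have hint : ∀ t, Integrable (fun ω => Real.log (1 + v t / (s : ℝ) ^ 2) / 2 -
      (ε t ω) ^ 2 / (2 * (s : ℝ) ^ 2) +
      (residual k s f ε (D₀ t) (a t) ω + ε t ω) ^ 2 / (2 * (v t + (s : ℝ) ^ 2))) P := fun t =>
    ((integrable_const _).sub ((hε2 t).1.div_const _)).add ((hinn t).1.div_const _)
  -- The two quadratic terms, each a squared centred variable over twice its variance, both have
  -- mean `1/2` and cancel; only the logarithm survives.
  have hval : ∀ t, ∫ ω, (Real.log (1 + v t / (s : ℝ) ^ 2) / 2 -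
      (ε t ω) ^ 2 / (2 * (s : ℝ) ^ 2) +
      (residual k s f ε (D₀ t) (a t) ω + ε t ω) ^ 2 / (2 * (v t + (s : ℝ) ^ 2))) ∂P =
      Real.log (1 + v t / (s : ℝ) ^ 2) / 2 := fun t => by
    have hs' : (0 : ℝ) < (s : ℝ) ^ 2 := by positivity
    have hsv : 0 < v t + (s : ℝ) ^ 2 := add_pos_of_nonneg_of_pos (hv0 t) hs'
    have h1 : Integrable (fun ω => Real.log (1 + v t / (s : ℝ) ^ 2) / 2 -
      (ε t ω) ^ 2 / (2 * (s : ℝ) ^ 2)) P := (integrable_const _).sub ((hε2 t).1.div_const _)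
    rw [integral_add h1 ((hinn t).1.div_const _), integral_sub (integrable_const _) ((hε2 t).1.div_const _), integral_div, integral_div, integral_div,
      (hε2 t).2, (hinn t).2]
    simp only [integral_const, probReal_univ, one_smul]
    have : postVar k s (D₀ t) (a t) = v t := rfl
    rw [this]
    field_simp
    ring
  have hlogm : Measurable fun q : (Fin T → ℝ) × (Fin T → ℝ) => Real.log (L q / c q.1).toReal :=
    hρm.ennreal_toReal.log
  have hintP : Integrable (fun ω => Real.log (L (Y ω, F ω) / c (Y ω)).toReal) P := by
    simp only [hlog]
    exact integrable_finsetSum _ fun t _ => hint t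
  have hllr_int : Integrable (llr (P.map fun ω => (Y ω, F ω)) ((P.map Y).prod (P.map F)))
      (P.map fun ω => (Y ω, F ω)) := by
    rw [integrable_congr hllr, integrable_map_measure hlogm.aestronglyMeasurable
      (hYm.prodMk hFm).aemeasurable]
    exact hintP
  rw [mutualInfo, klDiv_of_ac_of_integrable hac hllr_int, integral_congr_ae hllr,
    integral_map (hYm.prodMk hFm).aemeasurable hlogm.aestronglyMeasurable]
  simp only [hlog, probReal_univ]
  rw [integral_finsetSum _ fun t _ => hint t]
  simp only [hval, add_sub_cancel_right]
  rfl

/-- The information gain is finite. -/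
lemma maxInfoGain_ne_top (hm : IsGPModel P X k s f ε) (hs : 0 < s) (hX : X.Nonempty)
    (hunit : ∀ x ∈ X, k x x = 1) (T : ℕ) : maxInfoGain P X f ε T ≠ ∞ := by
  obtain ⟨x₀, hx₀⟩ := hX
  -- Posterior variances never exceed `k x x = 1`, so this bound is uniform in the design.
  refine ne_top_of_le_ne_top (b := ENNReal.ofReal (∑ t ∈ Finset.range T,
    Real.log (1 + 1 / (s : ℝ) ^ 2) / 2)) ENNReal.ofReal_ne_top (iSup_le fun A => ?_)
  set a : ℕ → Pt d := fun t => if h : t < T then A ⟨t, h⟩ else x₀ with ha_def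
  have ha : ∀ t, a t ∈ X := fun t => by
    by_cases h : t < T
    · simp [ha_def, h]
    · simpa [ha_def, h] using hx₀
  have hA : ∀ i : Fin T, a i = A i := fun i => by simp [ha_def]
  have h := hm.mutualInfo_eq hs ha T
  simp only [hA] at h
  rw [h]
  refine ENNReal.ofReal_le_ofReal (Finset.sum_le_sum fun t _ => ?_)
  have h0 := hm.postVar_nonneg hs (D := prefixData (fun i => (a i, 0)) t) (fun i => ha i) (ha t)
  have h1 := hm.postVar_le hs (D := prefixData (fun i => (a i, 0)) t) (fun i => ha i) (a t)
  rw [hunit _ (ha t)] at h1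
  gcongr

/-- The sum of the posterior variances along a sequence of queries is controlled by the
information gain. -/
theorem sum_postVar_le (hm : IsGPModel P X k s f ε) (hs : 0 < s)
    (hunit : ∀ x ∈ X, k x x = 1) {D : ℕ → Pt d × ℝ} (hD : ∀ t, (D t).1 ∈ X) (T : ℕ) :
    ∑ t ∈ Finset.range T, postVar k s (prefixData D t) (D t).1 ≤
      constC1 s * (maxInfoGain P X f ε T).toReal := by
  have hfin := hm.maxInfoGain_ne_top hs ⟨_, hD 0⟩ hunit T
  have hle : mutualInfo P (fun ω (i : Fin T) => f (D i).1 ω + ε i ω)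
      (fun ω (i : Fin T) => f (D i).1 ω) ≤ maxInfoGain P X f ε T :=
    le_iSup (fun A : Fin T → X => mutualInfo P (fun ω (i : Fin T) => f (A i) ω + ε i ω)
      (fun ω (i : Fin T) => f (A i) ω)) fun i => ⟨(D i).1, hD i⟩
  rw [hm.mutualInfo_eq hs hD T] at hle
  have hle' := (ENNReal.ofReal_le_iff_le_toReal hfin).1 hle
  have hs' : (0 : ℝ) < ((s : ℝ) ^ 2)⁻¹ := by positivity
  have hlogpos : 0 < Real.log (1 + ((s : ℝ) ^ 2)⁻¹) := Real.log_pos (by linarith)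
  calc ∑ t ∈ Finset.range T, postVar k s (prefixData D t) (D t).1
      ≤ ∑ t ∈ Finset.range T, constC1 s * (Real.log (1 +
          postVar k s (prefixData (fun i => ((D i).1, 0)) t) (D t).1 / (s : ℝ) ^ 2) / 2) := by
        refine Finset.sum_le_sum fun t _ => ?_
        have hc : postVar k s (prefixData D t) (D t).1 =
            postVar k s (prefixData (fun i => ((D i).1, 0)) t) (D t).1 :=
          postVar_congr (fun i => rfl) _
        rw [hc]
        have h0 := hm.postVar_nonneg hs (D := prefixData (fun i => ((D i).1, 0)) t)
          (fun i => hD i) (hD t)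
        have h1 := hm.postVar_le hs (D := prefixData (fun i => ((D i).1, 0)) t)
          (fun i => hD i) (D t).1
        rw [hunit _ (hD t)] at h1
        set x := postVar k s (prefixData (fun i => ((D i).1, 0)) t) (D t).1
        -- Bernoulli's inequality with exponent `x ∈ [0, 1]`: taking logarithms gives `x log(1 +
        -- s⁻²) ≤ log(1 + x s⁻²)`, which is where `C₁` comes from.
        have hb := rpow_one_add_le_one_add_mul_self (s := ((s : ℝ) ^ 2)⁻¹) (p := x)
          (by linarith) h0 h1
        have hl := Real.log_le_log (Real.rpow_pos_of_pos (by linarith) _) hb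
        rw [Real.log_rpow (by linarith)] at hl
        have he : constC1 s * (Real.log (1 + x / (s : ℝ) ^ 2) / 2) =
            Real.log (1 + x * ((s : ℝ) ^ 2)⁻¹) / Real.log (1 + ((s : ℝ) ^ 2)⁻¹) := by
          rw [constC1, ← div_eq_mul_inv]
          ring
        rw [he, le_div_iff₀ hlogpos]
        exact hl
    _ = constC1 s * ∑ t ∈ Finset.range T, Real.log (1 +
          postVar k s (prefixData (fun i => ((D i).1, 0)) t) (D t).1 / (s : ℝ) ^ 2) / 2 := by
        rw [Finset.mul_sum]
    _ ≤ _ := mul_le_mul_of_nonneg_left hle' (by rw [constC1]; positivity)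

end IsGPModel

/-! ### Expected excess of a Gaussian variable -/

lemma lintegral_ofReal_mul_gaussianPDF_le :
    ∫⁻ u : ℝ, gaussianPDF 0 1 u * ENNReal.ofReal u ≤ ENNReal.ofReal (√(2 * Real.pi))⁻¹ := by
  have hderiv : ∀ x ∈ Set.Ici (0 : ℝ), HasDerivAt (fun u : ℝ => -Real.exp (-u ^ 2 / 2))
      (x * Real.exp (-x ^ 2 / 2)) x := fun x _ => by
    have h1 : HasDerivAt (fun u : ℝ => -u ^ 2 / 2) (-x) x := by
      refine HasDerivAt.congr_deriv (((hasDerivAt_pow 2 x).neg).div_const 2) ?_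
      norm_num
      ring
    refine h1.exp.neg.congr_deriv ?_
    ring
  have hlim : Filter.Tendsto (fun u : ℝ => -Real.exp (-u ^ 2 / 2)) Filter.atTop (nhds (-0)) := by
    refine Filter.Tendsto.neg (Real.tendsto_exp_atBot.comp ?_)
    have : Filter.Tendsto (fun u : ℝ => u ^ 2 / 2) Filter.atTop Filter.atTop :=
      (Filter.tendsto_pow_atTop two_ne_zero).atTop_div_const two_pos
    refine (Filter.tendsto_neg_atTop_atBot.comp this).congr fun u => ?_
    simp only [Function.comp_apply]
    ring
  have hint := integrableOn_Ioi_deriv_of_nonneg' hderiv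
    (fun x hx => mul_nonneg (le_of_lt hx) (Real.exp_pos _).le) hlim
  have hval := integral_Ioi_of_hasDerivAt_of_nonneg' hderiv
    (fun x hx => mul_nonneg (le_of_lt hx) (Real.exp_pos _).le) hlim
  have hpt : ∀ u : ℝ, gaussianPDF 0 1 u * ENNReal.ofReal u =
      (Set.Ioi 0).indicator (fun u => ENNReal.ofReal ((√(2 * Real.pi))⁻¹ *
        (u * Real.exp (-u ^ 2 / 2)))) u := fun u => by
    by_cases hu : u ∈ Set.Ioi (0 : ℝ)
    · rw [Set.indicator_of_mem hu, gaussianPDF,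
        ← ENNReal.ofReal_mul (gaussianPDFReal_nonneg _ _ _), gaussianPDFReal]
      congr 1
      simp
      ring
    · rw [Set.indicator_of_notMem hu, ENNReal.ofReal_of_nonpos (not_lt.1 hu), mul_zero]
  simp only [hpt]
  rw [lintegral_indicator measurableSet_Ioi, ← ofReal_integral_eq_lintegral_ofReal
    (hint.const_mul _) ((ae_restrict_iff' measurableSet_Ioi).2 (.of_forall fun u hu =>
      mul_nonneg (by positivity) (mul_nonneg (le_of_lt hu) (Real.exp_pos _).le))),
    integral_const_mul, hval]
  simp

/-- After translation by `c`, the standard density satisfies `φ(u + c) ≤ exp(-c²/2) φ(u)` for `u, c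
≥ 0`, which reduces the claim to `c = 0`. -/
lemma lintegral_stdGaussian_excess_le {c : ℝ} (hc : 0 ≤ c) :
    ∫⁻ z, ENNReal.ofReal (z - c) ∂gaussianReal 0 1 ≤
      ENNReal.ofReal (Real.exp (-c ^ 2 / 2) / √(2 * Real.pi)) := by
  have hm : Measurable fun z : ℝ => ENNReal.ofReal (z - c) := by fun_prop
  rw [gaussianReal_of_var_ne_zero _ one_ne_zero,
    lintegral_withDensity_eq_lintegral_mul _ (measurable_gaussianPDF _ _) hm]
  simp only [Pi.mul_apply]
  rw [← lintegral_add_right_eq_self _ c]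
  simp only [add_sub_cancel_right]
  calc ∫⁻ u : ℝ, gaussianPDF 0 1 (u + c) * ENNReal.ofReal u
      ≤ ∫⁻ u : ℝ, ENNReal.ofReal (Real.exp (-c ^ 2 / 2)) *
          (gaussianPDF 0 1 u * ENNReal.ofReal u) := by
        refine lintegral_mono fun u => ?_
        rcases le_or_gt u 0 with hu | hu
        · simp [ENNReal.ofReal_of_nonpos hu]
        · rw [← mul_assoc]
          refine mul_le_mul_left ?_ _
          rw [gaussianPDF, gaussianPDF, ← ENNReal.ofReal_mul (Real.exp_pos _).le]
          refine ENNReal.ofReal_le_ofReal ?_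
          simp only [gaussianPDFReal, sub_zero, NNReal.coe_one, mul_one]
          rw [mul_left_comm, ← Real.exp_add]
          refine mul_le_mul_of_nonneg_left (Real.exp_le_exp.2 ?_) (by positivity)
          nlinarith [mul_nonneg hu.le hc]
    _ = ENNReal.ofReal (Real.exp (-c ^ 2 / 2)) *
          ∫⁻ u : ℝ, gaussianPDF 0 1 u * ENNReal.ofReal u :=
        lintegral_const_mul _ (by fun_prop)
    _ ≤ ENNReal.ofReal (Real.exp (-c ^ 2 / 2)) * ENNReal.ofReal (√(2 * Real.pi))⁻¹ :=
        mul_le_mul_right lintegral_ofReal_mul_gaussianPDF_le _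
    _ = _ := by rw [← ENNReal.ofReal_mul (Real.exp_pos _).le, div_eq_mul_inv (Real.exp _)]

/-- The expected excess of a Gaussian variable with variance at most one over a level that lies `c`
standard deviations above the mean. -/
lemma lintegral_gaussianReal_excess_le (m : ℝ) {v : ℝ} (hv0 : 0 ≤ v) (hv1 : v ≤ 1) {c : ℝ}
    (hc : 0 ≤ c) :
    ∫⁻ z, ENNReal.ofReal (z - (m + c * √v)) ∂gaussianReal m v.toNNReal ≤
      ENNReal.ofReal (Real.exp (-c ^ 2 / 2) / √(2 * Real.pi)) := by
  have hmap : gaussianReal m v.toNNReal = (gaussianReal 0 1).map fun z => m + √v * z := by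
    have h1 : (gaussianReal 0 1).map (√v * ·) = gaussianReal 0 v.toNNReal := by
      rw [gaussianReal_map_const_mul, mul_zero, mul_one]
      congr 1
      ext
      simp [Real.sq_sqrt hv0, hv0]
    have h2 : (gaussianReal 0 v.toNNReal).map (m + ·) = gaussianReal m v.toNNReal := by
      rw [gaussianReal_map_const_add, zero_add]
    rw [← h2, ← h1, Measure.map_map (by fun_prop) (by fun_prop)]
    rfl
  rw [hmap, lintegral_map (by fun_prop) (by fun_prop)]
  -- In standardized form the excess is `√v (z - c)`, and `√v ≤ 1`.
  refine le_trans (lintegral_mono fun z => ?_) (lintegral_stdGaussian_excess_le hc)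
  have hs : √v ≤ 1 := Real.sqrt_le_one.2 hv1
  rcases le_or_gt z c with hz | hz
  · rw [ENNReal.ofReal_of_nonpos]
    · exact zero_le
    · nlinarith [Real.sqrt_nonneg v]
  · refine ENNReal.ofReal_le_ofReal ?_
    nlinarith [Real.sqrt_nonneg v]

/-- Reflection in the mean. It equates the positive and negative parts of the prediction error, so
that one bound yields both integrability and mean zero. -/
lemma lintegral_gaussianReal_symm (m : ℝ) (v : ℝ≥0) :
    ∫⁻ z, ENNReal.ofReal (-(z - m)) ∂gaussianReal m v =
      ∫⁻ z, ENNReal.ofReal (z - m) ∂gaussianReal m v := by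
  have h : (gaussianReal m v).map (fun z => 2 * m - z) = gaussianReal m v := by
    rw [gaussianReal_map_const_sub]
    congr 1
    ring
  conv_rhs => rw [← h, lintegral_map (by fun_prop) (by fun_prop)]
  refine lintegral_congr fun z => ?_
  congr 1
  ring

/-! ### Regular versions of the objective -/

/-- A separable process with continuous paths on `X` is a jointly measurable function of its values
on a countable dense subset. -/
lemma exists_measurable_version {d : ℕ} {Ω : Type*} [MeasurableSpace Ω] {P : Measure Ω}
    {X : Set (Pt d)} (hX : X.Nonempty) {f : Pt d → Ω → ℝ}
    (hcont : ∀ᵐ ω ∂P, ContinuousOn (fun x => f x ω) X) :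
    ∃ (e : ℕ → Pt d) (Φ : Pt d → (ℕ → ℝ) → ℝ), (∀ i, e i ∈ X) ∧ X ⊆ closure (Set.range e) ∧
      (Measurable fun q : Pt d × (ℕ → ℝ) => Φ q.1 q.2) ∧
      ∀ᵐ ω ∂P, ∀ x ∈ X, Φ x (fun i => f (e i) ω) = f x ω := by
  have := hX.to_subtype
  set e : ℕ → Pt d := fun i => TopologicalSpace.denseSeq X i with he
  have heX : ∀ i, e i ∈ X := fun i => (TopologicalSpace.denseSeq X i).2
  have hdense : X ⊆ closure (Set.range e) := by
    have h1 := TopologicalSpace.denseRange_denseSeq X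
    intro x hx
    have h2 := h1 ⟨x, hx⟩
    have h3 := image_closure_subset_closure_image (continuous_subtype_val (p := (· ∈ X)))
      (Set.mem_image_of_mem Subtype.val h2)
    rwa [← Set.range_comp] at h3
  -- The value at `x` is read off at nearest points among finitely many `e i`, a measurable choice.
  -- The upper limit is always defined, and is the limit `f x` for continuous paths.
  refine ⟨e, fun x u => Filter.limsup (fun N => u (SimpleFunc.nearestPtInd e N x)) Filter.atTop,
    heX, hdense, ?_, ?_⟩
  · refine Measurable.limsup fun N => ?_
    have h1 : Measurable fun q : ℕ × (ℕ → ℝ) => q.2 q.1 :=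
      measurable_from_prod_countable_right fun i => measurable_pi_apply i
    exact h1.comp (((SimpleFunc.nearestPtInd e N).measurable.comp measurable_fst).prodMk
      measurable_snd)
  · filter_upwards [hcont] with ω hω x hx
    refine Filter.Tendsto.limsup_eq ?_
    have h1 := SimpleFunc.tendsto_nearestPt (hdense hx)
    have h2 : Filter.Tendsto (fun N => SimpleFunc.nearestPt e N x) Filter.atTop
        (nhdsWithin x X) :=
      tendsto_nhdsWithin_iff.2 ⟨h1, .of_forall fun N => heX _⟩
    exact (hω x hx).tendsto.comp h2

/-! ### The posterior under adaptive sampling -/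

section Measurability

variable {d n : ℕ} {k : Pt d → Pt d → ℝ}

/-- Cramer's rule: adjugate over determinant. The formula also covers singular matrices, where both
conventions for the inverse give `0`. -/
lemma measurable_regKernelMatrix_inv (hk : Measurable fun q : Pt d × Pt d => k q.1 q.2) (s : ℝ≥0)
    (i j : Fin n) : Measurable fun D : Data d n => (regKernelMatrix k s D)⁻¹ i j := by
  have hM : Measurable fun D : Data d n => fun i j => regKernelMatrix k s D i j := by
    refine measurable_pi_lambda _ fun i => measurable_pi_lambda _ fun j => ?_
    simp only [regKernelMatrix, Matrix.add_apply, Matrix.of_apply, Matrix.smul_apply]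
    exact (hk.comp ((measurable_pi_apply i).fst.prodMk (measurable_pi_apply j).fst)).add_const _
  have hc : Measurable fun M : Fin n → Fin n → ℝ => (Matrix.of M).det⁻¹ *
      (Matrix.of M).adjugate i j := by
    have h1 : Continuous fun M : Fin n → Fin n → ℝ => (Matrix.of M).det :=
      Continuous.matrix_det (A := fun M => Matrix.of M) continuous_id
    have h2 : Continuous fun M : Fin n → Fin n → ℝ => (Matrix.of M).adjugate i j :=
      (Continuous.matrix_adjugate (A := fun M => Matrix.of M) continuous_id).matrix_elem i j
    exact h1.measurable.inv.mul h2.measurable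
  have he : (fun D : Data d n => (regKernelMatrix k s D)⁻¹ i j) =
      (fun M : Fin n → Fin n → ℝ => (Matrix.of M).det⁻¹ * (Matrix.of M).adjugate i j) ∘
        fun D i j => regKernelMatrix k s D i j := by
    funext D
    rw [Matrix.inv_def, Ring.inverse_eq_inv', Matrix.smul_apply, smul_eq_mul]
    rfl
  rw [he]
  exact hc.comp hM

variable (hk : Measurable fun q : Pt d × Pt d => k q.1 q.2) {ξ : Data d n → Pt d}
  (hξ : Measurable ξ) (s : ℝ≥0)

include hk hξ

lemma measurable_kernelVec (i : Fin n) : Measurable fun D : Data d n => kernelVec k D (ξ D) i :=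
  hk.comp (hξ.prodMk (measurable_pi_apply i).fst)

lemma measurable_postMean : Measurable fun D : Data d n => postMean k s D (ξ D) := by
  unfold postMean
  simp only [dotProduct, Matrix.mulVec]
  refine Finset.measurable_fun_sum _ fun i _ => (measurable_kernelVec hk hξ i).mul
    (Finset.measurable_fun_sum _ fun j _ => (measurable_regKernelMatrix_inv hk s i j).mul
      (measurable_pi_apply j).snd)

lemma measurable_postVar : Measurable fun D : Data d n => postVar k s D (ξ D) := by
  unfold postVar
  simp only [dotProduct, Matrix.mulVec]
  refine (hk.comp (hξ.prodMk hξ)).sub (Finset.measurable_fun_sum _ fun i _ =>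
    (measurable_kernelVec hk hξ i).mul
    (Finset.measurable_fun_sum _ fun j _ => (measurable_regKernelMatrix_inv hk s i j).mul
      (measurable_kernelVec hk hξ j)))

end Measurability

/-- A Gaussian process model in which the kernel is measurable and the objective is a jointly
measurable function of the query point and of a random element independent of the noise. -/
structure IsMeasurableGPModel {d : ℕ} {Ω E : Type*} [MeasurableSpace Ω] [MeasurableSpace E]
    (P : Measure Ω) (X : Set (Pt d)) (k : Pt d → Pt d → ℝ) (s : ℝ≥0) (Φ : Pt d → E → ℝ)
    (p : Ω → E) (ε : ℕ → Ω → ℝ) : Prop where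
  model : IsGPModel P X k s (fun x ω => Φ x (p ω)) ε
  measurable_kernel : Measurable fun q : Pt d × Pt d => k q.1 q.2
  measurable_eval : Measurable fun q : Pt d × E => Φ q.1 q.2
  measurable_param : Measurable p
  indep_param : IndepFun p (fun ω n => ε n ω) P

namespace IsMeasurableGPModel

variable {d : ℕ} {Ω E : Type*} [MeasurableSpace Ω] [MeasurableSpace E] {P : Measure Ω}
  [IsProbabilityMeasure P] {X : Set (Pt d)} {k : Pt d → Pt d → ℝ} {s : ℝ≥0} {Φ : Pt d → E → ℝ}
  {p : Ω → E} {ε : ℕ → Ω → ℝ} {π : Rule d}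

lemma measurable_f (h : IsMeasurableGPModel P X k s Φ p ε) :
    Measurable fun q : Pt d × Ω => Φ q.1 (p q.2) :=
  h.measurable_eval.comp (measurable_fst.prodMk (h.measurable_param.comp measurable_snd))

lemma measurable_data (h : IsMeasurableGPModel P X k s Φ p ε) (hπm : ∀ n, Measurable (π n))
    (n : ℕ) : Measurable fun ω => history π (fun x ω => Φ x (p ω)) ε ω n :=
  measurable_history (f := fun x ω => Φ x (p ω)) hπm h.measurable_f h.model.measurable_noise n

/-- The posterior law of the objective at a query point chosen from adaptively collected data. -/
theorem lintegral_posterior (h : IsMeasurableGPModel P X k s Φ p ε) (hs : 0 < s)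
    (hX : MeasurableSet X) (hπm : ∀ n, Measurable (π n))
    (hπ : ∀ (n : ℕ) (D : Data d n), (∀ i, (D i).1 ∈ X) → π n D ∈ X) (n : ℕ)
    {ξ : Data d n → Pt d} (hξm : Measurable ξ) (hξ : ∀ D, (∀ i, (D i).1 ∈ X) → ξ D ∈ X)
    {g : Data d n × ℝ → ℝ≥0∞} (hg : Measurable g) :
    ∫⁻ ω, g (history π (fun x ω => Φ x (p ω)) ε ω n,
        Φ (ξ (history π (fun x ω => Φ x (p ω)) ε ω n)) (p ω)) ∂P =
      ∫⁻ ω, (fun D => ∫⁻ z, g (D, z) ∂gaussianReal (postMean k s D (ξ D))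
        (postVar k s D (ξ D)).toNNReal) (history π (fun x ω => Φ x (p ω)) ε ω n) ∂P := by
  have hm := h.model
  have hΦ := h.measurable_eval
  have hp := h.measurable_param
  set G : Data d n → ℝ≥0∞ := fun D => ∫⁻ z, g (D, z) ∂gaussianReal (postMean k s D (ξ D))
    (postVar k s D (ξ D)).toNNReal with hG
  have hGm : Measurable G := by
    have hκ : Measurable fun D : Data d n => gaussianReal (postMean k s D (ξ D))
        (postVar k s D (ξ D)).toNNReal :=
      measurable_gaussianReal.comp ((measurable_postMean h.measurable_kernel hξm s).prodMk
        (measurable_postVar h.measurable_kernel hξm s).real_toNNReal)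
    let κ : Kernel (Data d n) ℝ := ⟨_, hκ⟩
    have : IsMarkovKernel κ := ⟨fun D => by
      change IsProbabilityMeasure (gaussianReal _ _)
      infer_instance⟩
    exact Measurable.lintegral_kernel_prod_right (κ := κ) hg
  have e1 := lintegral_history (g := fun q : E × Data d n => g (q.2, Φ (ξ q.2) q.1)) hπm hs hΦ hp
    hm.measurable_noise hm.noise_law hm.noise_indep h.indep_param n
    (hg.comp (measurable_snd.prodMk
      (hΦ.comp ((hξm.comp measurable_snd).prodMk measurable_fst))))
  have e2 := lintegral_history (g := fun q : E × Data d n => G q.2) hπm hs hΦ hp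
    hm.measurable_noise hm.noise_law hm.noise_indep h.indep_param n (hGm.comp measurable_snd)
  refine e1.trans (Eq.trans ?_ e2.symm)
  refine lintegral_congr_ae ?_
  -- With `D` frozen, `ξ D` is a fixed point of `X` and the claim is conjugacy for the data set `D`.
  filter_upwards [ae_refMeasure_mem hX hπm hπ n] with D hD
  have h1 := hm.lintegral_mul_lik hs hD (hξ D hD) (ψ := fun z => g (D, z))
    (hg.comp (measurable_const.prodMk measurable_id))
  rw [lintegral_const_mul _ (hm.measurable_lik_data hD), mul_comm]
  exact h1

/-- Conditionally on the data, the objective exceeds a level `c` posterior standard deviations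
above the posterior mean only by a small amount. -/
lemma lintegral_excess_le (h : IsMeasurableGPModel P X k s Φ p ε) (hs : 0 < s)
    (hX : MeasurableSet X) (hunit : ∀ x ∈ X, k x x = 1) (hπm : ∀ n, Measurable (π n))
    (hπ : ∀ (n : ℕ) (D : Data d n), (∀ i, (D i).1 ∈ X) → π n D ∈ X) (n : ℕ)
    {ξ : Data d n → Pt d} (hξm : Measurable ξ) (hξ : ∀ D, (∀ i, (D i).1 ∈ X) → ξ D ∈ X)
    {c : ℝ} (hc : 0 ≤ c) :
    ∫⁻ ω, (fun D => ENNReal.ofReal (Φ (ξ D) (p ω) -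
        (postMean k s D (ξ D) + c * √(postVar k s D (ξ D)))))
        (history π (fun x ω => Φ x (p ω)) ε ω n) ∂P ≤
      ENNReal.ofReal (Real.exp (-c ^ 2 / 2) / √(2 * Real.pi)) := by
  have hμ := measurable_postMean h.measurable_kernel hξm s
  have hv := measurable_postVar h.measurable_kernel hξm s
  have hg : Measurable fun q : Data d n × ℝ =>
      ENNReal.ofReal (q.2 - (postMean k s q.1 (ξ q.1) + c * √(postVar k s q.1 (ξ q.1)))) :=
    (measurable_snd.sub ((hμ.comp measurable_fst).add
      ((hv.comp measurable_fst).sqrt.const_mul _))).ennreal_ofReal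
  refine (h.lintegral_posterior hs hX hπm hπ n hξm hξ hg).trans_le ?_
  refine (lintegral_mono (g := fun _ => ENNReal.ofReal (Real.exp (-c ^ 2 / 2) / √(2 * Real.pi)))
    fun ω => ?_).trans_eq (by rw [lintegral_const, measure_univ, mul_one])
  have hD := history_mem hπ (fun x ω => Φ x (p ω)) ε ω n
  set D := history π (fun x ω => Φ x (p ω)) ε ω n
  have h1 := h.model.postVar_le hs hD (ξ D)
  rw [hunit _ (hξ D hD)] at h1
  exact lintegral_gaussianReal_excess_le _ (h.model.postVar_nonneg hs hD (hξ D hD)) h1 hc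

/-- The posterior mean predicts the objective at an adaptively chosen query without bias. -/
lemma integral_prediction_error (h : IsMeasurableGPModel P X k s Φ p ε) (hs : 0 < s)
    (hX : MeasurableSet X) (hunit : ∀ x ∈ X, k x x = 1) (hπm : ∀ n, Measurable (π n))
    (hπ : ∀ (n : ℕ) (D : Data d n), (∀ i, (D i).1 ∈ X) → π n D ∈ X) (n : ℕ)
    {ξ : Data d n → Pt d} (hξm : Measurable ξ) (hξ : ∀ D, (∀ i, (D i).1 ∈ X) → ξ D ∈ X) :
    Integrable (fun ω => (fun D => Φ (ξ D) (p ω) - postMean k s D (ξ D))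
        (history π (fun x ω => Φ x (p ω)) ε ω n)) P ∧
      ∫ ω, (fun D => Φ (ξ D) (p ω) - postMean k s D (ξ D))
        (history π (fun x ω => Φ x (p ω)) ε ω n) ∂P = 0 := by
  have hμ := measurable_postMean h.measurable_kernel hξm s
  have hH := h.measurable_data hπm n
  set Z : Ω → ℝ := fun ω => (fun D => Φ (ξ D) (p ω) - postMean k s D (ξ D))
    (history π (fun x ω => Φ x (p ω)) ε ω n) with hZ
  have hZm : Measurable Z :=
    (h.measurable_f.comp ((hξm.comp hH).prodMk measurable_id)).sub (hμ.comp hH)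
  have hpos : ∫⁻ ω, ENNReal.ofReal (Z ω) ∂P ≤
      ENNReal.ofReal (Real.exp (-0 ^ 2 / 2) / √(2 * Real.pi)) := by
    -- The excess bound at `c = 0` controls the positive part of the prediction error.
    have := h.lintegral_excess_le hs hX hunit hπm hπ n hξm hξ le_rfl
    simpa only [zero_mul, add_zero] using this
  have hpost : ∀ φ : ℝ → ℝ≥0∞, Measurable φ → ∫⁻ ω, φ (Z ω) ∂P =
      ∫⁻ ω, (fun D => ∫⁻ z, φ (z - postMean k s D (ξ D)) ∂gaussianReal (postMean k s D (ξ D))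
        (postVar k s D (ξ D)).toNNReal) (history π (fun x ω => Φ x (p ω)) ε ω n) ∂P :=
    fun φ hφ => h.lintegral_posterior hs hX hπm hπ n hξm hξ
      (g := fun q => φ (q.2 - postMean k s q.1 (ξ q.1)))
      (hφ.comp (measurable_snd.sub (hμ.comp measurable_fst)))
  have hsymm : ∫⁻ ω, ENNReal.ofReal (-Z ω) ∂P = ∫⁻ ω, ENNReal.ofReal (Z ω) ∂P := by
    rw [hpost (fun z => ENNReal.ofReal (-z)) (by fun_prop),
      hpost (fun z => ENNReal.ofReal z) (by fun_prop)]
    exact lintegral_congr fun ω => lintegral_gaussianReal_symm _ _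
  have hint : Integrable Z P := by
    refine ⟨hZm.aestronglyMeasurable, ?_⟩
    rw [HasFiniteIntegral]
    have hle : ∀ ω, ‖Z ω‖ₑ ≤ ENNReal.ofReal (Z ω) + ENNReal.ofReal (-Z ω) := fun ω => by
      rw [Real.enorm_eq_ofReal_abs]
      rcases le_total 0 (Z ω) with hz | hz
      · rw [abs_of_nonneg hz]; exact le_self_add
      · rw [abs_of_nonpos hz]; exact le_add_self
    refine (lintegral_mono hle).trans_lt ?_
    rw [lintegral_add_left hZm.ennreal_ofReal, hsymm]
    exact ENNReal.add_lt_top.2 ⟨hpos.trans_lt ENNReal.ofReal_lt_top,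
      hpos.trans_lt ENNReal.ofReal_lt_top⟩
  refine ⟨hint, ?_⟩
  rw [integral_eq_lintegral_pos_part_sub_lintegral_neg_part hint, hsymm, sub_self]

/-- Bound for the expected regret of one step of GP-UCB, in terms of a finite subset `N` of `X`
on which the objective nearly attains all its values, up to an error `δ`. -/
theorem integral_regret_step_le (h : IsMeasurableGPModel P X k s Φ p ε) (hs : 0 < s)
    (hX : MeasurableSet X) (hunit : ∀ x ∈ X, k x x = 1) {β : ℕ → ℝ} (hπ : IsGPUCB X k s β π)
    {xstar : Ω → Pt d} (hxs : ∀ᵐ ω ∂P, xstar ω ∈ X) (n : ℕ)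
    (hint : Integrable (fun ω => Φ (xstar ω) (p ω) -
      Φ (query π (fun x ω => Φ x (p ω)) ε n ω) (p ω)) P)
    {N : Finset (Pt d)} (hN : ∀ x ∈ N, x ∈ X) {δ : Ω → ℝ} (hδi : Integrable δ P)
    (hδ : ∀ᵐ ω ∂P, ∀ x ∈ X, ∃ y ∈ N, Φ x (p ω) ≤ Φ y (p ω) + δ ω) :
    ∫ ω, (Φ (xstar ω) (p ω) - Φ (query π (fun x ω => Φ x (p ω)) ε n ω) (p ω)) ∂P ≤
      N.card * (Real.exp (-√(β (n + 1)) ^ 2 / 2) / √(2 * Real.pi)) + ∫ ω, δ ω ∂P +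
        ∫ ω, √(β (n + 1)) * √(postVar k s (history π (fun x ω => Φ x (p ω)) ε ω n)
          (query π (fun x ω => Φ x (p ω)) ε n ω)) ∂P := by
  set H : Ω → Data d n := fun ω => history π (fun x ω => Φ x (p ω)) ε ω n with hH
  have hHm : Measurable H := h.measurable_data hπ.measurable n
  have hHX : ∀ ω i, (H ω i).1 ∈ X := fun ω => history_mem hπ.mem _ ε ω n
  set c := √(β (n + 1)) with hc
  have hc0 : 0 ≤ c := Real.sqrt_nonneg _
  -- the excess over the upper confidence bound on `N`
  set W : Pt d → Ω → ℝ := fun y ω =>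
    max (Φ y (p ω) - (postMean k s (H ω) y + c * √(postVar k s (H ω) y))) 0 with hW
  have hWi : ∀ y ∈ N, Integrable (W y) P ∧
      ∫ ω, W y ω ∂P ≤ Real.exp (-c ^ 2 / 2) / √(2 * Real.pi) := by
    intro y hy
    have hle := h.lintegral_excess_le hs hX hunit hπ.measurable hπ.mem n
      (ξ := fun _ => y) measurable_const (fun _ _ => hN y hy) hc0
    have hWm : Measurable (W y) := by
      refine Measurable.max (Measurable.sub ?_ (Measurable.add ?_ (Measurable.const_mul
        (Measurable.sqrt ?_) _))) measurable_const
      · exact h.measurable_f.comp (measurable_const.prodMk measurable_id)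
      · exact (measurable_postMean h.measurable_kernel (ξ := fun _ => y) measurable_const s).comp
          hHm
      · exact (measurable_postVar h.measurable_kernel (ξ := fun _ => y) measurable_const s).comp
          hHm
    have hW0 : 0 ≤ᵐ[P] W y := .of_forall fun ω => le_max_right _ _
    have heq : ∫⁻ ω, ENNReal.ofReal (W y ω) ∂P ≤
        ENNReal.ofReal (Real.exp (-c ^ 2 / 2) / √(2 * Real.pi)) := by
      refine le_trans (le_of_eq (lintegral_congr fun ω => ?_)) hle
      simp only [hW, ENNReal.ofReal_max, ENNReal.ofReal_zero, max_eq_left (zero_le)]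
      rfl
    refine ⟨(lintegral_ofReal_ne_top_iff_integrable hWm.aestronglyMeasurable hW0).1
      (heq.trans_lt ENNReal.ofReal_lt_top).ne, ?_⟩
    rw [integral_eq_lintegral_of_nonneg_ae hW0 hWm.aestronglyMeasurable]
    exact ENNReal.toReal_le_of_le_ofReal (by positivity) heq
  -- the prediction error at the query
  obtain ⟨hZi, hZ0⟩ := h.integral_prediction_error hs hX hunit hπ.measurable hπ.mem n
    (hπ.measurable n) (hπ.mem n)
  set Z : Ω → ℝ := fun ω => Φ (π n (H ω)) (p ω) - postMean k s (H ω) (π n (H ω)) with hZ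
  -- the width of the confidence interval at the query
  have hVi : Integrable (fun ω => c * √(postVar k s (H ω) (π n (H ω)))) P := by
    refine Integrable.const_mul (Integrable.of_bound ?_ 1 (.of_forall fun ω => ?_)) _
    · exact (((measurable_postVar h.measurable_kernel (hπ.measurable n) s).comp
        hHm).sqrt).aestronglyMeasurable
    · rw [Real.norm_eq_abs, abs_of_nonneg (Real.sqrt_nonneg _), Real.sqrt_le_one]
      have := h.model.postVar_le hs (hHX ω) (π n (H ω))
      rwa [hunit _ (hπ.mem n _ (hHX ω))] at this
  -- Compare `f(x*)` with a net point `y`, `f(y)` with its upper confidence bound up to the excess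
  -- `W y`, and that bound with the maximal one, attained at the query. All of `N` is summed because
  -- `y` is random.
  have hpath : ∀ᵐ ω ∂P, Φ (xstar ω) (p ω) -
      Φ (query π (fun x ω => Φ x (p ω)) ε n ω) (p ω) ≤
        ∑ y ∈ N, W y ω + δ ω + c * √(postVar k s (H ω) (π n (H ω))) - Z ω := by
    filter_upwards [hxs, hδ] with ω hω hδω
    obtain ⟨y, hy, hle⟩ := hδω _ hω
    have h1 : W y ω ≤ ∑ y ∈ N, W y ω :=
      Finset.single_le_sum (f := fun y => W y ω) (fun y _ => le_max_right _ _) hy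
    have h2 : Φ y (p ω) - (postMean k s (H ω) y + c * √(postVar k s (H ω) y)) ≤ W y ω :=
      le_max_left _ _
    have h3 := hπ.isMaxOn n (H ω) (hHX ω) (hN y hy)
    simp only [Set.mem_ofPred_eq, ucb, ← hc] at h3
    change Φ (xstar ω) (p ω) - Φ (π n (H ω)) (p ω) ≤ _
    simp only [hZ]
    linarith
  have hsumi : Integrable (fun ω => ∑ y ∈ N, W y ω) P :=
    integrable_finsetSum _ fun y hy => (hWi y hy).1
  have hA : Integrable (fun ω => ∑ y ∈ N, W y ω + δ ω) P := hsumi.add hδi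
  have hB : Integrable (fun ω => ∑ y ∈ N, W y ω + δ ω +
    c * √(postVar k s (H ω) (π n (H ω)))) P := hA.add hVi
  refine (integral_mono_ae hint (hB.sub hZi) hpath).trans ?_
  have e1 := integral_sub hB hZi
  have e2 := integral_add hA hVi
  have e3 := integral_add hsumi hδi
  have e4 : ∫ ω, ∑ y ∈ N, W y ω ∂P ≤
      N.card * (Real.exp (-c ^ 2 / 2) / √(2 * Real.pi)) := by
    rw [integral_finsetSum _ fun y hy => (hWi y hy).1]
    refine (Finset.sum_le_sum fun y hy => (hWi y hy).2).trans_eq ?_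
    rw [Finset.sum_const, nsmul_eq_mul]
  refine e1.le.trans ?_
  rw [hZ0, sub_zero, e2, e3]
  have e5 : ∫ ω, c * √(postVar k s (H ω) (π n (H ω))) ∂P =
    ∫ ω, c * √(postVar k s (H ω) (query π (fun x ω => Φ x (p ω)) ε n ω)) ∂P := rfl
  linarith

end IsMeasurableGPModel

/-! ### Summing the confidence widths -/

/-- The confidence widths along a run of the algorithm sum up to at most the information-gain
bound. -/
lemma IsGPModel.sum_width_le {d : ℕ} {Ω : Type*} [MeasurableSpace Ω] {P : Measure Ω}
    [IsProbabilityMeasure P] {X : Set (Pt d)} {k : Pt d → Pt d → ℝ} {s : ℝ≥0}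
    {f : Pt d → Ω → ℝ} {ε : ℕ → Ω → ℝ} {π : Rule d} (hm : IsGPModel P X k s f ε) (hs : 0 < s)
    (hunit : ∀ x ∈ X, k x x = 1)
    (hπ : ∀ (n : ℕ) (D : Data d n), (∀ i, (D i).1 ∈ X) → π n D ∈ X) {β : ℕ → ℝ}
    (hβ : ∀ m n, 1 ≤ m → m ≤ n → β m ≤ β n) (T : ℕ) (ω : Ω) :
    ∑ n ∈ Finset.range T, √(β (n + 1)) * √(postVar k s (history π f ε ω n) (query π f ε n ω)) ≤
      √(constC1 s * T * β T * (maxInfoGain P X f ε T).toReal) := by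
  have hsum := hm.sum_postVar_le hs hunit
    (D := fun t => (query π f ε t ω, observation π f ε t ω)) (fun t => query_mem hπ f ε t ω) T
  set v : ℕ → ℝ := fun n => postVar k s (history π f ε ω n) (query π f ε n ω) with hv
  have hv0 : ∀ n, 0 ≤ v n := fun n =>
    hm.postVar_nonneg hs (history_mem hπ f ε ω n) (query_mem hπ f ε n ω)
  have hveq : ∀ n, v n = postVar k s
      (prefixData (fun t => (query π f ε t ω, observation π f ε t ω)) n) (query π f ε n ω) :=
    fun n => by simp only [hv]; rw [history_eq_prefix]; rfl
  simp only [← hveq] at hsum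
  set γ := constC1 s * (maxInfoGain P X f ε T).toReal with hγ
  -- Cauchy–Schwarz, followed by the information-gain bound on the sum of variances.
  have hcs : ∑ n ∈ Finset.range T, √(v n) ≤ √(T * γ) := by
    refine Real.le_sqrt_of_sq_le (((sq_sum_le_card_mul_sum_sq (s := Finset.range T)
      (f := fun n => √(v n))).trans_eq ?_).trans
      (mul_le_mul_of_nonneg_left hsum (Nat.cast_nonneg T)))
    rw [Finset.card_range]
    congr 1
    exact Finset.sum_congr rfl fun n _ => Real.sq_sqrt (hv0 n)
  calc ∑ n ∈ Finset.range T, √(β (n + 1)) * √(v n)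
      ≤ ∑ n ∈ Finset.range T, √(β T) * √(v n) := by
        refine Finset.sum_le_sum fun n hn => mul_le_mul_of_nonneg_right ?_ (Real.sqrt_nonneg _)
        exact Real.sqrt_le_sqrt (hβ _ _ (Nat.le_add_left 1 n) (Finset.mem_range.1 hn))
    _ ≤ √(β T) * √(T * γ) := by
        rw [← Finset.mul_sum]
        exact mul_le_mul_of_nonneg_left hcs (Real.sqrt_nonneg _)
    _ = √(constC1 s * T * β T * (maxInfoGain P X f ε T).toReal) := by
        have hT : 0 ≤ T * γ := mul_nonneg (Nat.cast_nonneg T)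
          ((Finset.sum_nonneg fun n _ => hv0 n).trans hsum)
        rw [← Real.sqrt_mul' _ hT, hγ]
        congr 1
        ring

/-- One of two conditions under which the expected regret of a query with confidence parameter `β`
exceeds the width of the confidence interval by at most `B`: either the objective is nearly
maximized on a small finite subset of `X`, or it oscillates little on `X`. -/
def StepBound {d : ℕ} {Ω : Type*} [MeasurableSpace Ω] (P : Measure Ω) (X : Set (Pt d))
    (f : Pt d → Ω → ℝ) (β B : ℝ) : Prop :=
  (∃ (N : Finset (Pt d)) (δ : Ω → ℝ), (∀ x ∈ N, x ∈ X) ∧ Integrable δ P ∧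
    (∀ᵐ ω ∂P, ∀ x ∈ X, ∃ y ∈ N, f x ω ≤ f y ω + δ ω) ∧
    N.card * (Real.exp (-√β ^ 2 / 2) / √(2 * Real.pi)) + ∫ ω, δ ω ∂P ≤ B) ∨
  ∃ δ : Ω → ℝ, Integrable δ P ∧ (∀ᵐ ω ∂P, ∀ x ∈ X, ∀ y ∈ X, f x ω ≤ f y ω + δ ω) ∧
    ∫ ω, δ ω ∂P ≤ B

lemma StepBound.congr {d : ℕ} {Ω : Type*} [MeasurableSpace Ω] {P : Measure Ω} {X : Set (Pt d)}
    {f f' : Pt d → Ω → ℝ} {β B : ℝ} (h : StepBound P X f β B)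
    (hff' : ∀ᵐ ω ∂P, ∀ x ∈ X, f x ω = f' x ω) : StepBound P X f' β B := by
  rcases h with ⟨N, δ, hN, hδi, hδ, hB⟩ | ⟨δ, hδi, hδ, hB⟩
  · refine .inl ⟨N, δ, hN, hδi, ?_, hB⟩
    filter_upwards [hδ, hff'] with ω h1 h2 x hx
    obtain ⟨y, hy, hle⟩ := h1 x hx
    exact ⟨y, hy, by rwa [← h2 x hx, ← h2 y (hN y hy)]⟩
  · refine .inr ⟨δ, hδi, ?_, hB⟩
    filter_upwards [hδ, hff'] with ω h1 h2 x hx y hy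
    rw [← h2 x hx, ← h2 y hy]
    exact h1 x hx y hy

/-! ### Cumulative regret -/

theorem sum_inv_sq_le (T : ℕ) :
    ∑ n ∈ Finset.range T, 1 / ((n + 1 : ℕ) : ℝ) ^ 2 ≤ Real.pi ^ 2 / 6 := by
  have h := (hasSum_nat_add_iff' (f := fun n : ℕ => 1 / (n : ℝ) ^ 2) 1).2 hasSum_zeta_two
  refine (sum_le_hasSum (Finset.range T) (fun n _ => by positivity) h).trans_eq ?_
  simp

namespace IsMeasurableGPModel

variable {d : ℕ} {Ω E : Type*} [MeasurableSpace Ω] [MeasurableSpace E] {P : Measure Ω}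
  [IsProbabilityMeasure P] {X : Set (Pt d)} {k : Pt d → Pt d → ℝ} {s : ℝ≥0} {Φ : Pt d → E → ℝ}
  {p : Ω → E} {ε : ℕ → Ω → ℝ} {π : Rule d}

/-- The regret bound for GP-UCB on a measurable model. -/
theorem regret_bound (h : IsMeasurableGPModel P X k s Φ p ε) (hs : 0 < s)
    (hX : MeasurableSet X) (hunit : ∀ x ∈ X, k x x = 1) {β : ℕ → ℝ} (hπ : IsGPUCB X k s β π)
    (hβ : ∀ m n, 1 ≤ m → m ≤ n → β m ≤ β n) {xstar : Ω → Pt d}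
    (hxs : ∀ᵐ ω ∂P, xstar ω ∈ X) (hxm : AEStronglyMeasurable (fun ω => Φ (xstar ω) (p ω)) P)
    {M : Ω → ℝ} (hMi : Integrable M P) (hM : ∀ᵐ ω ∂P, ∀ x ∈ X, |Φ x (p ω)| ≤ M ω)
    {B : ℝ} (hB : 0 ≤ B) (hstep : ∀ n : ℕ, StepBound P X (fun x ω => Φ x (p ω)) (β (n + 1))
      (B / ((n + 1 : ℕ) : ℝ) ^ 2)) (T : ℕ) :
    Integrable (cumRegret π (fun x ω => Φ x (p ω)) ε xstar T) P ∧
      bcr P π (fun x ω => Φ x (p ω)) ε xstar T ≤ B * (Real.pi ^ 2 / 6) +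
        √(constC1 s * T * β T * (maxInfoGain P X (fun x ω => Φ x (p ω)) ε T).toReal) := by
  set q : ℕ → Ω → Pt d := query π (fun x ω => Φ x (p ω)) ε with hq
  have hqm : ∀ n, Measurable (q n) := fun n =>
    (hπ.measurable n).comp (h.measurable_data hπ.measurable n)
  have hqX : ∀ n ω, q n ω ∈ X := fun n ω => query_mem hπ.mem _ ε n ω
  have hsi : Integrable (fun ω => Φ (xstar ω) (p ω)) P := by
    refine hMi.mono' hxm ?_
    filter_upwards [hxs, hM] with ω h1 h2
    exact h2 _ h1
  have hqi : ∀ n, Integrable (fun ω => Φ (q n ω) (p ω)) P := fun n => by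
    refine hMi.mono' (h.measurable_f.comp ((hqm n).prodMk measurable_id)).aestronglyMeasurable ?_
    filter_upwards [hM] with ω h2
    exact h2 _ (hqX n ω)
  have hri : ∀ n, Integrable (fun ω => Φ (xstar ω) (p ω) - Φ (q n ω) (p ω)) P :=
    fun n => hsi.sub (hqi n)
  refine ⟨integrable_finsetSum _ fun n _ => hri n, ?_⟩
  set w : ℕ → Ω → ℝ := fun n ω => √(β (n + 1)) *
    √(postVar k s (history π (fun x ω => Φ x (p ω)) ε ω n) (q n ω)) with hw
  have hw0 : ∀ n ω, 0 ≤ w n ω := fun n ω => by positivity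
  have hwi : ∀ n, Integrable (w n) P := fun n => by
    refine Integrable.const_mul (Integrable.of_bound ?_ 1 (.of_forall fun ω => ?_)) _
    · exact (((measurable_postVar h.measurable_kernel (hπ.measurable n) s).comp
        (h.measurable_data hπ.measurable n)).sqrt).aestronglyMeasurable
    · rw [Real.norm_eq_abs, abs_of_nonneg (Real.sqrt_nonneg _), Real.sqrt_le_one]
      have := h.model.postVar_le hs (history_mem hπ.mem (fun x ω => Φ x (p ω)) ε ω n) (q n ω)
      rwa [hunit _ (hqX n ω)] at this
  have hone : ∀ n, ∫ ω, (Φ (xstar ω) (p ω) - Φ (q n ω) (p ω)) ∂P ≤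
      B / ((n + 1 : ℕ) : ℝ) ^ 2 + ∫ ω, w n ω ∂P := by
    intro n
    rcases hstep n with ⟨N, δ, hN, hδi, hδ, hle⟩ | ⟨δ, hδi, hδ, hle⟩
    · refine (h.integral_regret_step_le hs hX hunit hπ hxs n (hri n) hN hδi hδ).trans ?_
      exact add_le_add_left hle _
    -- Here the oscillation alone bounds the regret, and the width is added for free.
    · have h0 : 0 ≤ ∫ ω, w n ω ∂P := integral_nonneg (hw0 n)
      have h1 : ∫ ω, (Φ (xstar ω) (p ω) - Φ (q n ω) (p ω)) ∂P ≤ ∫ ω, δ ω ∂P := by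
        refine integral_mono_ae (hri n) hδi ?_
        filter_upwards [hxs, hδ] with ω h2 h3
        have := h3 _ h2 _ (hqX n ω)
        linarith
      linarith
  have hsum : ∑ n ∈ Finset.range T, ∫ ω, w n ω ∂P ≤
      √(constC1 s * T * β T * (maxInfoGain P X (fun x ω => Φ x (p ω)) ε T).toReal) := by
    rw [← integral_finsetSum _ fun n _ => hwi n]
    refine (integral_mono (integrable_finsetSum _ fun n _ => hwi n) (integrable_const _)
      fun ω => h.model.sum_width_le hs hunit hπ.mem hβ T ω).trans_eq ?_
    simp
  have hB' : ∑ n ∈ Finset.range T, B / ((n + 1 : ℕ) : ℝ) ^ 2 ≤ B * (Real.pi ^ 2 / 6) := by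
    refine le_trans (le_of_eq ?_) (mul_le_mul_of_nonneg_left (sum_inv_sq_le T) hB)
    rw [Finset.mul_sum]
    exact Finset.sum_congr rfl fun n _ => by ring
  calc bcr P π (fun x ω => Φ x (p ω)) ε xstar T
      = ∑ n ∈ Finset.range T, ∫ ω, (Φ (xstar ω) (p ω) - Φ (q n ω) (p ω)) ∂P :=
        integral_finsetSum _ fun n _ => hri n
    _ ≤ ∑ n ∈ Finset.range T, (B / ((n + 1 : ℕ) : ℝ) ^ 2 + ∫ ω, w n ω ∂P) :=
        Finset.sum_le_sum fun n _ => hone n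
    _ ≤ _ := by
        rw [Finset.sum_add_distrib]
        exact add_le_add hB' hsum

end IsMeasurableGPModel

/-! ### From continuous sample paths to a measurable model -/

lemma maxInfoGain_congr {d : ℕ} {Ω : Type*} [MeasurableSpace Ω] {P : Measure Ω} {X : Set (Pt d)}
    {f f' : Pt d → Ω → ℝ} {ε : ℕ → Ω → ℝ} (h : ∀ᵐ ω ∂P, ∀ x ∈ X, f x ω = f' x ω) (T : ℕ) :
    maxInfoGain P X f ε T = maxInfoGain P X f' ε T := by
  refine iSup_congr fun A => ?_
  have h1 : (fun ω (i : Fin T) => f (A i) ω) =ᵐ[P] fun ω i => f' (A i) ω := by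
    filter_upwards [h] with ω hω
    funext i
    exact hω _ (A i).2
  have h2 : (fun ω (i : Fin T) => f (A i) ω + ε i ω) =ᵐ[P] fun ω i => f' (A i) ω + ε i ω := by
    filter_upwards [h] with ω hω
    funext i
    rw [hω _ (A i).2]
  have h3 : (fun ω => ((fun i : Fin T => f (A i) ω + ε i ω), fun i : Fin T => f (A i) ω)) =ᵐ[P]
      fun ω => ((fun i : Fin T => f' (A i) ω + ε i ω), fun i : Fin T => f' (A i) ω) := by
    filter_upwards [h1, h2] with ω e1 e2
    rw [e1, e2]
  simp only [mutualInfo]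
  rw [Measure.map_congr h1, Measure.map_congr h2, Measure.map_congr h3]

/-- The kernel is constrained only on `X`. It can therefore be exchanged for a measurable one
without changing which rules are GP-UCB. -/
lemma ucb_congr_kernel {d n : ℕ} {X : Set (Pt d)} {k k' : Pt d → Pt d → ℝ}
    (hk : ∀ x ∈ X, ∀ y ∈ X, k x y = k' x y) (s : ℝ≥0) (β : ℝ) {D : Data d n}
    (hD : ∀ i, (D i).1 ∈ X) {x : Pt d} (hx : x ∈ X) : ucb k s β D x = ucb k' s β D x := by
  have h1 : kernelVec k D x = kernelVec k' D x := by
    funext i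
    exact hk _ hx _ (hD i)
  have h2 : regKernelMatrix k s D = regKernelMatrix k' s D := by
    ext i j
    simp only [regKernelMatrix, Matrix.add_apply, Matrix.of_apply, hk _ (hD i) _ (hD j)]
  simp only [ucb, postMean, postVar, h1, h2, hk x hx x hx]

lemma IsGPUCB.congr_kernel {d : ℕ} {X : Set (Pt d)} {k k' : Pt d → Pt d → ℝ} {s : ℝ≥0}
    {β : ℕ → ℝ} {π : Rule d} (h : IsGPUCB X k s β π)
    (hk : ∀ x ∈ X, ∀ y ∈ X, k x y = k' x y) : IsGPUCB X k' s β π where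
  measurable := h.measurable
  mem := h.mem
  isMaxOn n D hD x hx := by
    have := h.isMaxOn n D hD hx
    simp only [Set.mem_ofPred_eq] at this ⊢
    rwa [← ucb_congr_kernel hk s _ hD hx, ← ucb_congr_kernel hk s _ hD (h.mem n D hD)]

variable {d : ℕ} {Ω : Type*} [MeasurableSpace Ω] {P : Measure Ω}
  [IsProbabilityMeasure P] {X : Set (Pt d)} {k : Pt d → Pt d → ℝ} {s : ℝ≥0}
  {f : Pt d → Ω → ℝ} {ε : ℕ → Ω → ℝ} {π : Rule d}

/-- The maximal value of a process with continuous paths is measurable. -/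
lemma aestronglyMeasurable_eval_argmax (hf : ∀ x ∈ X, Measurable (f x))
    (hcont : ∀ᵐ ω ∂P, ContinuousOn (fun x => f x ω) X) {e : ℕ → Pt d} (heX : ∀ i, e i ∈ X)
    (he : X ⊆ closure (Set.range e)) {xstar : Ω → Pt d}
    (hxstar : ∀ᵐ ω ∂P, xstar ω ∈ X ∧ IsMaxOn (fun x => f x ω) X (xstar ω)) :
    AEStronglyMeasurable (fun ω => f (xstar ω) ω) P := by
  refine AEMeasurable.aestronglyMeasurable
    -- By continuity the maximum is the supremum over a countable dense set, so measurability of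
    -- `xstar` itself is not required.
    ⟨fun ω => ⨆ i, f (e i) ω, Measurable.iSup fun i => hf _ (heX i), ?_⟩
  filter_upwards [hcont, hxstar] with ω hω h2
  obtain ⟨hx, hmax⟩ := h2
  have hbdd : BddAbove (Set.range fun i => f (e i) ω) :=
    ⟨f (xstar ω) ω, by rintro _ ⟨i, rfl⟩; exact hmax (heX i)⟩
  refine le_antisymm ?_ (ciSup_le fun i => hmax (heX i))
  have h1 := SimpleFunc.tendsto_nearestPt (he hx)
  have h3 : Filter.Tendsto (fun N => SimpleFunc.nearestPt e N (xstar ω)) Filter.atTop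
      (nhdsWithin (xstar ω) X) :=
    tendsto_nhdsWithin_iff.2 ⟨h1, .of_forall fun N => heX _⟩
  exact le_of_tendsto ((hω _ hx).tendsto.comp h3)
    (.of_forall fun N => le_ciSup hbdd (SimpleFunc.nearestPtInd e N (xstar ω)))

/-- A Gaussian process model with continuous sample paths agrees with a measurable one. -/
lemma IsGPModel.exists_isMeasurableGPModel (hm : IsGPModel P X k s f ε) (hX : X.Nonempty)
    (hcont : ∀ᵐ ω ∂P, ContinuousOn (fun x => f x ω) X) :
    ∃ (k' : Pt d → Pt d → ℝ) (Φ : Pt d → (ℕ → ℝ) → ℝ) (p : Ω → ℕ → ℝ),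
      IsMeasurableGPModel P X k' s Φ p ε ∧ (∀ x ∈ X, ∀ y ∈ X, k x y = k' x y) ∧
      ∀ᵐ ω ∂P, ∀ x ∈ X, f x ω = Φ x (p ω) := by
  obtain ⟨e, Φ, heX, he, hΦ, hΦf⟩ := exists_measurable_version hX hcont
  set p : Ω → ℕ → ℝ := fun ω i => f (e i) ω with hp
  have hpm : Measurable p := measurable_pi_lambda _ fun i => hm.measurable_f _ (heX i)
  -- The second moments of the measurable version give a kernel measurable on the whole space that
  -- agrees with `k` on `X`.
  set k' : Pt d → Pt d → ℝ := fun x y => ∫ ω, Φ x (p ω) * Φ y (p ω) ∂P with hk'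
  have hae : ∀ x ∈ X, f x =ᵐ[P] fun ω => Φ x (p ω) := fun x hx => by
    filter_upwards [hΦf] with ω hω
    exact (hω x hx).symm
  have hk : ∀ x ∈ X, ∀ y ∈ X, k x y = k' x y := fun x hx y hy => by
    rw [← hm.cov x hx y hy, covariance_eq_sub (hm.memLp_f hx) (hm.memLp_f hy), hm.mean x hx,
      zero_mul, sub_zero]
    refine integral_congr_ae ?_
    filter_upwards [hae x hx, hae y hy] with ω h1 h2
    rw [Pi.mul_apply, h1, h2]
  refine ⟨k', Φ, p, ⟨⟨fun x _ => ?_, hm.measurable_noise, ?_, fun x hx => ?_, fun x hx y hy => ?_,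
    hm.noise_law, hm.noise_indep, ?_⟩, ?_, hΦ, hpm, ?_⟩, hk, ?_⟩
  · exact hΦ.comp (measurable_const.prodMk hpm)
  · exact hm.gaussian.congr fun x => hae x x.2
  · rw [← hm.mean x hx]
    exact integral_congr_ae (hae x hx).symm
  · rw [← hk x hx y hy, ← hm.cov x hx y hy]
    rw [covariance, covariance, integral_congr_ae (hae x hx), integral_congr_ae (hae y hy)]
    refine integral_congr_ae ?_
    filter_upwards [hae x hx, hae y hy] with ω h1 h2
    rw [h1, h2]
  · have hg : Measurable fun (u : X → ℝ) (x : X) => Φ x fun i => u ⟨e i, heX i⟩ :=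
      measurable_pi_lambda _ fun x => hΦ.comp (measurable_const.prodMk
        (measurable_pi_lambda _ fun i => measurable_pi_apply _))
    exact hm.indep.comp hg measurable_id
  · have h1 : Measurable fun q : (Pt d × Pt d) × Ω => Φ q.1.1 (p q.2) * Φ q.1.2 (p q.2) :=
      (hΦ.comp (measurable_fst.fst.prodMk (hpm.comp measurable_snd))).mul
        (hΦ.comp (measurable_fst.snd.prodMk (hpm.comp measurable_snd)))
    exact h1.stronglyMeasurable.integral_prod_right.measurable
  · have hg : Measurable fun (u : X → ℝ) (i : ℕ) => u ⟨e i, heX i⟩ :=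
      measurable_pi_lambda _ fun i => measurable_pi_apply _
    exact hm.indep.comp hg measurable_id
  · filter_upwards [hΦf] with ω hω x hx
    exact (hω x hx).symm

/-- The regret bound for GP-UCB on a model with continuous sample paths. -/
theorem IsGPModel.regret_bound (hm : IsGPModel P X k s f ε) (hs : 0 < s) (hX : MeasurableSet X)
    (hunit : ∀ x ∈ X, k x x = 1) (hcont : ∀ᵐ ω ∂P, ContinuousOn (fun x => f x ω) X)
    {β : ℕ → ℝ} (hπ : IsGPUCB X k s β π) (hβ : ∀ m n, 1 ≤ m → m ≤ n → β m ≤ β n)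
    {xstar : Ω → Pt d} (hxstar : ∀ᵐ ω ∂P, xstar ω ∈ X ∧ IsMaxOn (fun x => f x ω) X (xstar ω))
    {M : Ω → ℝ} (hMi : Integrable M P) (hM : ∀ᵐ ω ∂P, ∀ x ∈ X, |f x ω| ≤ M ω)
    {B : ℝ} (hB : 0 ≤ B)
    (hstep : ∀ n : ℕ, StepBound P X f (β (n + 1)) (B / ((n + 1 : ℕ) : ℝ) ^ 2)) (T : ℕ) :
    maxInfoGain P X f ε T ≠ ∞ ∧ Integrable (cumRegret π f ε xstar T) P ∧
      bcr P π f ε xstar T ≤ B * (Real.pi ^ 2 / 6) +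
        √(constC1 s * T * β T * (maxInfoGain P X f ε T).toReal) := by
  obtain ⟨ω₀, hω₀⟩ := hxstar.exists
  have hne : X.Nonempty := ⟨_, hω₀.1⟩
  obtain ⟨k', Φ, p, h, hk, hf⟩ := hm.exists_isMeasurableGPModel hne hcont
  obtain ⟨e, -, heX, he, -⟩ := exists_measurable_version hne hcont
  have hxm : AEStronglyMeasurable (fun ω => Φ (xstar ω) (p ω)) P := by
    refine (aestronglyMeasurable_eval_argmax hm.measurable_f hcont heX he hxstar).congr ?_
    filter_upwards [hxstar, hf] with ω h1 h2
    exact h2 _ h1.1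
  have hM' : ∀ᵐ ω ∂P, ∀ x ∈ X, |Φ x (p ω)| ≤ M ω := by
    filter_upwards [hM, hf] with ω h1 h2 x hx
    rw [← h2 x hx]
    exact h1 x hx
  obtain ⟨h1, h2⟩ := h.regret_bound hs hX (fun x hx => by rw [← hk x hx x hx, hunit x hx])
    (hπ.congr_kernel hk) hβ (hxstar.mono fun ω hω => hω.1) hxm hMi hM' hB
    (fun n => (hstep n).congr hf) T
  have hreg : cumRegret π f ε xstar T =ᵐ[P] cumRegret π (fun x ω => Φ x (p ω)) ε xstar T := by
    filter_upwards [hf, hxstar] with ω hω hx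
    refine Finset.sum_congr rfl fun n _ => ?_
    have hq : query π f ε n ω = query π (fun x ω => Φ x (p ω)) ε n ω :=
      congrArg (π n)
        (history_congr (f' := fun x ω => Φ x (p ω)) hπ.mem hω fun _ _ => rfl)
    rw [hω _ hx.1, hω _ (query_mem hπ.mem f ε n ω), hq]
  refine ⟨hm.maxInfoGain_ne_top hs hne hunit T, h1.congr hreg.symm, ?_⟩
  rw [maxInfoGain_congr hf T]
  exact (integral_congr_ae hreg).le.trans h2

/-! ### Finite domains -/

/-- The inequality `β ≤ (√β)²` also holds for `β < 0`, where `√β = 0`. Degenerate confidence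
parameters thus need no separate treatment. -/
lemma mul_gaussian_tail_le {m t β : ℝ} (ht : 0 < t)
    (h : m * t ^ 2 / √(2 * Real.pi) ≤ Real.exp (β / 2)) :
    m * (Real.exp (-√β ^ 2 / 2) / √(2 * Real.pi)) ≤ 1 / t ^ 2 := by
  have h1 : β ≤ √β ^ 2 := by
    rcases le_total 0 β with hβ | hβ
    · rw [Real.sq_sqrt hβ]
    · exact hβ.trans (sq_nonneg _)
  have h2 : Real.exp (-√β ^ 2 / 2) ≤ Real.exp (-(β / 2)) := Real.exp_le_exp.2 (by linarith)
  have h3 : Real.exp (β / 2) * Real.exp (-(β / 2)) = 1 := by rw [← Real.exp_add]; simp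
  rw [le_div_iff₀ (by positivity)]
  calc m * (Real.exp (-√β ^ 2 / 2) / √(2 * Real.pi)) * t ^ 2
      = m * t ^ 2 / √(2 * Real.pi) * Real.exp (-√β ^ 2 / 2) := by ring
    _ ≤ Real.exp (β / 2) * Real.exp (-(β / 2)) := by gcongr
    _ = 1 := h3

lemma betaFinite_mono {N : ℕ} (hN : 0 < N) {m n : ℕ} (hm : 1 ≤ m) (hmn : m ≤ n) :
    betaFinite N m ≤ betaFinite N n := by
  have : (0 : ℝ) < m := by exact_mod_cast hm
  have : (0 : ℝ) < N := by exact_mod_cast hN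
  unfold betaFinite
  gcongr

lemma exp_half_betaFinite {N t : ℕ} (hN : 0 < N) (ht : 0 < t) :
    Real.exp (betaFinite N t / 2) = N * (t : ℝ) ^ 2 / √(2 * Real.pi) := by
  have : (0 : ℝ) < t := by exact_mod_cast ht
  have : (0 : ℝ) < N := by exact_mod_cast hN
  rw [betaFinite, mul_div_cancel_left₀ _ two_ne_zero, Real.exp_log (by positivity)]

theorem IsGPModel.regret_bound_finite {d : ℕ} {Ω : Type*} [MeasurableSpace Ω] {P : Measure Ω}
    [IsProbabilityMeasure P] {X : Set (Pt d)} {k : Pt d → Pt d → ℝ} {s : ℝ≥0}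
    {f : Pt d → Ω → ℝ} {ε : ℕ → Ω → ℝ} {π : Rule d} (hm : IsGPModel P X k s f ε) (hs : 0 < s)
    (hunit : ∀ x ∈ X, k x x = 1) {xstar : Ω → Pt d}
    (hxstar : ∀ᵐ ω ∂P, xstar ω ∈ X ∧ IsMaxOn (fun x => f x ω) X (xstar ω)) (hX : X.Finite)
    (hπ : IsGPUCB X k s (betaFinite X.ncard) π) (T : ℕ) :
    maxInfoGain P X f ε T ≠ ∞ ∧ Integrable (cumRegret π f ε xstar T) P ∧
      bcr P π f ε xstar T ≤ Real.pi ^ 2 / 6 +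
        √(constC1 s * T * betaFinite X.ncard T * (maxInfoGain P X f ε T).toReal) := by
  obtain ⟨ω₀, hω₀⟩ := hxstar.exists
  have hcard : 0 < X.ncard := (Set.ncard_pos hX).2 ⟨_, hω₀.1⟩
  have := hX.to_subtype
  have hcont : ∀ᵐ ω ∂P, ContinuousOn (fun x => f x ω) X := .of_forall fun ω =>
    continuousOn_iff_continuous_domRestrict.2 continuous_of_discreteTopology
  have hMi : Integrable (fun ω => ∑ x ∈ hX.toFinset, |f x ω|) P :=
    integrable_finsetSum _ fun x hx =>
      ((hm.memLp_f (hX.mem_toFinset.1 hx)).integrable one_le_two).abs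
  have hM : ∀ᵐ ω ∂P, ∀ x ∈ X, |f x ω| ≤ ∑ x ∈ hX.toFinset, |f x ω| := .of_forall fun ω x hx =>
    Finset.single_le_sum (f := fun x => |f x ω|) (fun _ _ => abs_nonneg _)
      (hX.mem_toFinset.2 hx)
  have := hm.regret_bound hs hX.measurableSet hunit hcont hπ
    (fun m n hm hmn => betaFinite_mono hcard hm hmn) hxstar hMi hM zero_le_one (fun n => ?_) T
  · rwa [one_mul] at this
  -- The net is `X` itself, with no discretization error.
  refine .inl ⟨hX.toFinset, fun _ => 0, fun x hx => hX.mem_toFinset.1 hx, integrable_zero _ _ _,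
    .of_forall fun ω x hx => ⟨x, hX.mem_toFinset.2 hx, by simp⟩, ?_⟩
  rw [integral_zero, add_zero, ← Set.ncard_eq_toFinset_card X hX]
  exact mul_gaussian_tail_le (by positivity)
    (exp_half_betaFinite hcard n.succ_pos).ge

/-! ### Growth of the confidence parameter in the tail constant -/

/-- Put `L = log a`. For `a ≥ c` one has `log(ac) ≤ 2L`, and `2L ≤ (L - 1)²` once `L ≥ 4`; with
`√π/2 ≤ 1` the argument of the outer logarithm is at most `L`. -/
lemma log_sqrt_log_isBigO {c : ℝ} (hc : 1 ≤ c) :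
    (fun a : ℝ => Real.log (√(Real.log (a * c)) + √Real.pi / 2)) =O[Filter.atTop]
      fun a => Real.log (Real.log a) := by
  refine Asymptotics.IsBigO.of_bound 1 ?_
  filter_upwards [Filter.eventually_ge_atTop c, Filter.eventually_ge_atTop (Real.exp 4)]
    with a hac ha
  have ha0 : 0 < a := (Real.exp_pos _).trans_le ha
  have hL : 4 ≤ Real.log a := (Real.le_log_iff_exp_le ha0).2 ha
  have hlog : Real.log (a * c) = Real.log a + Real.log c :=
    Real.log_mul ha0.ne' (by positivity)
  have hc0 : 0 ≤ Real.log c := Real.log_nonneg hc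
  have hcL : Real.log c ≤ Real.log a := Real.log_le_log (by linarith) hac
  have hpi : √Real.pi / 2 ≤ 1 := by
    have : √Real.pi ≤ 2 := Real.sqrt_le_iff.2 ⟨by norm_num, by linarith [Real.pi_le_four]⟩
    linarith
  have h1 : √(Real.log (a * c)) ≤ Real.log a - 1 :=
    Real.sqrt_le_iff.2 ⟨by linarith, by nlinarith⟩
  have h2 : 1 ≤ √(Real.log (a * c)) := Real.le_sqrt_of_sq_le (by linarith)
  have h3 : 0 ≤ √Real.pi / 2 := by positivity
  rw [one_mul, Real.norm_of_nonneg (Real.log_nonneg (by linarith)),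
    Real.norm_of_nonneg (Real.log_nonneg (by linarith))]
  exact Real.log_le_log (by linarith) (by linarith)

theorem betaContinuous_isBigO (d : ℕ) (r b : ℝ) (t : ℕ) :
    (fun a : ℝ => betaContinuous d r a b t) =O[Filter.atTop]
      fun a : ℝ => Real.log (Real.log a) := by
  have hconst : ∀ C : ℝ, (fun _ : ℝ => C) =O[Filter.atTop]
      fun a : ℝ => Real.log (Real.log a) := fun C =>
    (Asymptotics.isLittleO_const_left.2 (.inr (tendsto_norm_atTop_atTop.comp
      (Real.tendsto_log_atTop.comp Real.tendsto_log_atTop)))).isBigO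
  unfold betaContinuous
  refine Asymptotics.IsBigO.add ?_ (hconst _)
  refine Asymptotics.IsBigO.const_mul_left ?_ _
  set c := b * d * r * (t : ℝ) ^ 2 with hc
  -- If a factor of `c` vanishes, the logarithm is `log 0 = 0`; otherwise `d ≥ 1`, and a negative
  -- `c` is harmless since `Real.log` depends only on the absolute value.
  rcases eq_or_ne c 0 with h0 | h0
  · simp only [h0, zero_mul, Real.log_zero]
    exact hconst 0
  have hd : 1 ≤ (d : ℝ) := by
    rw [Nat.one_le_cast, Nat.one_le_iff_ne_zero]
    rintro rfl
    simp [hc] at h0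
  refine ((hconst (Real.log c)).add (log_sqrt_log_isBigO hd)).congr_left fun a => ?_
  rw [Real.log_mul h0 (by positivity)]

/-! ### Sub-Gaussian tails -/

lemma lintegral_Ioi_exp_neg_sq {b : ℝ} (hb : 0 < b) (c : ℝ) :
    ∫⁻ t in Set.Ioi c, ENNReal.ofReal (Real.exp (-((t - c) / b) ^ 2)) =
      ENNReal.ofReal (b * (√Real.pi / 2)) := by
  set F : ℝ → ℝ≥0∞ := (Set.Ioi 0).indicator fun v => ENNReal.ofReal (Real.exp (-(v / b) ^ 2))
    with hF
  have h1 : ∀ t, (Set.Ioi c).indicator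
      (fun t => ENNReal.ofReal (Real.exp (-((t - c) / b) ^ 2))) t = F (t - c) := fun t => by
    simp only [hF, Set.indicator_apply, Set.mem_Ioi, sub_pos]
  have h2 : ∀ v : ℝ, Real.exp (-(v / b) ^ 2) = Real.exp (-(b ^ 2)⁻¹ * v ^ 2) := fun v => by
    congr 1
    ring
  rw [← lintegral_indicator measurableSet_Ioi]
  simp only [h1]
  rw [lintegral_sub_right_eq_self F c, hF, lintegral_indicator measurableSet_Ioi]
  simp only [h2]
  rw [← ofReal_integral_eq_lintegral_ofReal
    (integrable_exp_neg_mul_sq (by positivity)).integrableOn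
    (.of_forall fun v => (Real.exp_pos _).le), integral_gaussian_Ioi]
  congr 1
  rw [div_inv_eq_mul, Real.sqrt_mul Real.pi_pos.le, Real.sqrt_sq hb.le]
  ring

/-- A nonnegative random variable with a sub-Gaussian tail is integrable. -/
lemma integral_le_of_tail {Ω : Type*} [MeasurableSpace Ω] {P : Measure Ω} [IsProbabilityMeasure P]
    {Z : Ω → ℝ≥0∞} (hZ : Measurable Z) {A b : ℝ} (hA : 0 < A) (hb : 0 < b)
    (htail : ∀ l : ℝ, 0 < l →
      P {ω | ENNReal.ofReal l < Z ω} ≤ ENNReal.ofReal (A * Real.exp (-(l / b) ^ 2))) :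
    (∀ᵐ ω ∂P, Z ω ≠ ∞) ∧ Integrable (fun ω => (Z ω).toReal) P ∧
      ∫ ω, (Z ω).toReal ∂P ≤ b * (√(Real.log A) + √Real.pi / 2) := by
  have htop : ∀ᵐ ω ∂P, Z ω ≠ ∞ := by
    have h1 : ∀ n : ℕ, P {ω | Z ω = ∞} ≤
        ENNReal.ofReal (A * Real.exp (-((n + 1 : ℕ) / b) ^ 2)) := fun n =>
      (measure_mono fun ω (hω : Z ω = ∞) => by simp [hω]).trans
        (htail (n + 1 : ℕ) (by positivity))
    have h2 : Filter.Tendsto (fun n : ℕ => ENNReal.ofReal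
        (A * Real.exp (-((n + 1 : ℕ) / b : ℝ) ^ 2))) Filter.atTop (nhds 0) := by
      rw [← ENNReal.ofReal_zero, ← mul_zero A]
      refine ENNReal.tendsto_ofReal (Filter.Tendsto.const_mul _ (Real.tendsto_exp_atBot.comp
        (Filter.tendsto_neg_atTop_atBot.comp ?_)))
      exact (Filter.tendsto_pow_atTop two_ne_zero).comp
        (((tendsto_natCast_atTop_atTop (R := ℝ)).comp
          (Filter.tendsto_add_atTop_nat 1)).atTop_div_const hb)
    have h3 := ge_of_tendsto' h2 h1
    rw [ae_iff]
    simpa using h3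
  -- The level at which the tail bound falls to `1` when `A ≥ 1`, and `0` when `A ≤ 1`. Below it the
  -- probability is bounded by `1`, which contributes `c`; above it the tail contributes `b√π/2`.
  set c := b * √(Real.log A) with hc
  have hc0 : 0 ≤ c := by positivity
  have hA1 : A * Real.exp (-√(Real.log A) ^ 2) ≤ 1 := by
    rcases le_total A 1 with h | h
    · have : Real.exp (-√(Real.log A) ^ 2) ≤ 1 :=
        Real.exp_le_one_iff.2 (neg_nonpos.2 (sq_nonneg _))
      nlinarith [Real.exp_pos (-√(Real.log A) ^ 2)]
    · rw [Real.sq_sqrt (Real.log_nonneg h), Real.exp_neg, Real.exp_log hA, mul_inv_cancel₀ hA.ne']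
  have hlayer : ∫⁻ ω, ENNReal.ofReal (Z ω).toReal ∂P ≤
      ENNReal.ofReal (b * (√(Real.log A) + √Real.pi / 2)) := by
    rw [lintegral_eq_lintegral_meas_lt P (.of_forall fun ω => ENNReal.toReal_nonneg)
      hZ.ennreal_toReal.aemeasurable]
    have hsub : ∀ t : ℝ, 0 < t → P {ω | t < (Z ω).toReal} ≤
        ENNReal.ofReal (A * Real.exp (-(t / b) ^ 2)) := fun t ht =>
      (measure_mono fun ω (hω : t < (Z ω).toReal) => by
        have hne : Z ω ≠ ∞ := fun h => by
          rw [h, ENNReal.toReal_top] at hω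
          exact hω.not_gt ht
        exact (ENNReal.ofReal_lt_iff_lt_toReal ht.le hne).2 hω).trans (htail t ht)
    rw [← Set.Ioc_union_Ioi_eq_Ioi hc0]
    refine (lintegral_union_le _ _ _).trans ?_
    rw [mul_add, ENNReal.ofReal_add hc0 (by positivity), ← lintegral_Ioi_exp_neg_sq hb c]
    refine add_le_add ?_ ?_
    · refine (lintegral_mono fun t => prob_le_one).trans_eq ?_
      rw [lintegral_one, Measure.restrict_apply_univ, Real.volume_Ioc, sub_zero]
    · refine setLIntegral_mono' measurableSet_Ioi fun t ht => ?_
      have ht' : c < t := ht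
      refine (hsub t (hc0.trans_lt ht')).trans (ENNReal.ofReal_le_ofReal ?_)
      set l := √(Real.log A)
      set v := (t - c) / b with hv
      have hv0 : 0 ≤ v := div_nonneg (sub_nonneg.2 ht'.le) hb.le
      have hl0 : 0 ≤ l := Real.sqrt_nonneg _
      have htb : t / b = l + v := by
        rw [hv, hc]
        field_simp
        ring
      -- The cross term in `(l + v)²` is dropped, and `exp(-l²)` absorbs `A`.
      calc A * Real.exp (-(t / b) ^ 2) ≤ A * Real.exp (-l ^ 2 + -v ^ 2) := by
            gcongr
            rw [htb]
            nlinarith [mul_nonneg hl0 hv0]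
        _ = A * Real.exp (-l ^ 2) * Real.exp (-v ^ 2) := by rw [Real.exp_add]; ring
        _ ≤ 1 * Real.exp (-v ^ 2) := by gcongr
        _ = Real.exp (-v ^ 2) := one_mul _
  have h0 : 0 ≤ᵐ[P] fun ω => (Z ω).toReal := .of_forall fun ω => ENNReal.toReal_nonneg
  refine ⟨htop, (lintegral_ofReal_ne_top_iff_integrable
    hZ.ennreal_toReal.aestronglyMeasurable h0).1 (hlayer.trans_lt ENNReal.ofReal_lt_top).ne, ?_⟩
  rw [integral_eq_lintegral_of_nonneg_ae h0 hZ.ennreal_toReal.aestronglyMeasurable]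
  exact ENNReal.toReal_le_of_le_ofReal (by positivity) hlayer

/-! ### Random Lipschitz constants -/

/-- A function with bounded partial derivatives on a convex set is Lipschitz there for the
`ℓ¹` distance. -/
lemma abs_sub_le_of_partial_le {d : ℕ} {X : Set (Pt d)} (hX : Convex ℝ X) {g : Pt d → ℝ}
    {G : Pt d → Pt d →L[ℝ] ℝ} (hg : ∀ x ∈ X, HasFDerivWithinAt g (G x) X x) {l : ℝ}
    (hG : ∀ x ∈ X, ∀ j, |G x (EuclideanSpace.single j 1)| ≤ l) {x y : Pt d} (hx : x ∈ X)
    (hy : y ∈ X) : |g x - g y| ≤ l * ∑ j, |x j - y j| := by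
  have hseg : ∀ t ∈ Set.Icc (0 : ℝ) 1, AffineMap.lineMap y x t ∈ X := fun t ht =>
    hX.lineMap_mem hy hx ht
  have hpart : ∀ z ∈ X, |G z (x - y)| ≤ l * ∑ j, |x j - y j| := fun z hz => by
    have hsum : x - y = ∑ j, (x j - y j) • EuclideanSpace.single j (1 : ℝ) := by
      ext i
      simp [Pi.single_apply]
    rw [hsum, map_sum]
    refine (Finset.abs_sum_le_sum_abs _ _).trans ?_
    rw [Finset.mul_sum]
    refine Finset.sum_le_sum fun j _ => ?_
    rw [map_smul, smul_eq_mul, abs_mul, mul_comm]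
    exact mul_le_mul_of_nonneg_right (hG z hz j) (abs_nonneg _)
  have hderiv : ∀ t ∈ Set.Icc (0 : ℝ) 1, HasDerivWithinAt (fun t => g (AffineMap.lineMap y x t))
      (G (AffineMap.lineMap y x t) (x - y)) (Set.Icc 0 1) t := fun t ht =>
    (hg _ (hseg t ht)).comp_hasDerivWithinAt t AffineMap.hasDerivWithinAt_lineMap hseg
  simpa using norm_image_sub_le_of_norm_deriv_le_segment_01' hderiv
    fun t ht => hpart _ (hseg t ⟨ht.1, ht.2.le⟩)

/-- Under the tail condition on the partial derivatives, the sample paths are Lipschitz, with an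
integrable Lipschitz constant. -/
lemma DerivTail.exists_lipschitz {d : ℕ} {Ω : Type*} [MeasurableSpace Ω] {P : Measure Ω}
    [IsProbabilityMeasure P] {X : Set (Pt d)} {f : Pt d → Ω → ℝ} {r a b : ℝ}
    (h : DerivTail P X f r a b) (hd : 0 < d) (hX : X.Nonempty)
    (hf : ∀ x ∈ X, Measurable (f x)) :
    ∃ Λ : Ω → ℝ, Integrable Λ P ∧ (∀ ω, 0 ≤ Λ ω) ∧
      (∀ᵐ ω ∂P, ∀ x ∈ X, ∀ y ∈ X, |f x ω - f y ω| ≤ Λ ω * ∑ j, |x j - y j|) ∧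
      ∫ ω, Λ ω ∂P ≤ b * (√(Real.log (a * d)) + √Real.pi / 2) := by
  obtain ⟨G, hG, htail⟩ := h.tail
  have hcont : ∀ᵐ ω ∂P, ContinuousOn (fun x => f x ω) X := by
    filter_upwards [hG] with ω hω x hx
    exact (hω x hx).continuousWithinAt
  obtain ⟨e, -, heX, he, -⟩ := exists_measurable_version hX hcont
  -- Difference quotients over a countable dense set are measurable, whereas nothing is assumed on
  -- the measurability of the derivative `G`. Coinciding points contribute `0/0 = 0`.
  set Z : Ω → ℝ≥0∞ := fun ω => ⨆ i, ⨆ j,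
    ENNReal.ofReal (|f (e i) ω - f (e j) ω| / ∑ m, |e i m - e j m|) with hZ
  have hZm : Measurable Z := Measurable.iSup fun i => Measurable.iSup fun j =>
    (((hf _ (heX i)).sub (hf _ (heX j))).abs.div_const _).ennreal_ofReal
  have hZtail : ∀ l : ℝ, 0 < l → P {ω | ENNReal.ofReal l < Z ω} ≤
      ENNReal.ofReal (a * d * Real.exp (-(l / b) ^ 2)) := fun l hl => by
    -- If all partial derivatives are bounded by `l`, so are the quotients. The union bound over the
    -- `d` coordinates turns `a` into `a * d`.
    have hsub : {ω | ENNReal.ofReal l < Z ω} ≤ᵐ[P] ⋃ j : Fin d,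
        {ω | ENNReal.ofReal l < ⨆ x ∈ X, ‖G ω x (EuclideanSpace.single j 1)‖ₑ} := by
      filter_upwards [hG] with ω hω hlt
      by_contra hnot
      have hle : ∀ j, ⨆ x ∈ X, ‖G ω x (EuclideanSpace.single j 1)‖ₑ ≤ ENNReal.ofReal l := by
        intro j
        by_contra hj
        exact hnot (Set.mem_iUnion.2 ⟨j, not_le.1 hj⟩)
      have hbd : ∀ x ∈ X, ∀ j, |G ω x (EuclideanSpace.single j 1)| ≤ l := fun x hx j => by
        have h1 := (le_iSup₂ (f := fun x (_ : x ∈ X) =>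
          ‖G ω x (EuclideanSpace.single j 1)‖ₑ) x hx).trans (hle j)
        rw [Real.enorm_eq_ofReal_abs] at h1
        exact (ENNReal.ofReal_le_ofReal_iff hl.le).1 h1
      refine not_le.2 hlt (iSup₂_le fun i j => ENNReal.ofReal_le_ofReal ?_)
      refine div_le_of_le_mul₀ (Finset.sum_nonneg fun m _ => abs_nonneg _) hl.le ?_
      exact abs_sub_le_of_partial_le h.convex hω hbd (heX i) (heX j)
    refine (measure_mono_ae hsub).trans ((measure_iUnion_fintype_le _ _).trans ?_)
    refine (Finset.sum_le_sum fun j _ => htail j l hl).trans_eq ?_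
    rw [Finset.sum_const, Finset.card_univ, Fintype.card_fin, nsmul_eq_mul,
      ← ENNReal.ofReal_natCast, ← ENNReal.ofReal_mul (Nat.cast_nonneg d)]
    congr 1
    ring
  have hA : 0 < a * (d : ℝ) := mul_pos h.a_pos (by exact_mod_cast hd)
  obtain ⟨htop, hint, hle⟩ := integral_le_of_tail hZm hA h.b_pos hZtail
  refine ⟨fun ω => (Z ω).toReal, hint, fun ω => ENNReal.toReal_nonneg, ?_, hle⟩
  filter_upwards [htop, hcont] with ω hω hc x hx y hy
  have hpair : ∀ i j, |f (e i) ω - f (e j) ω| ≤ (Z ω).toReal * ∑ m, |e i m - e j m| := by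
    intro i j
    rcases (Finset.sum_nonneg fun m (_ : m ∈ Finset.univ) =>
      abs_nonneg (e i m - e j m)).eq_or_lt with h0 | h0
    · have : e i = e j := by
        ext m
        have := (Finset.sum_eq_zero_iff_of_nonneg fun m _ => abs_nonneg _).1 h0.symm m
          (Finset.mem_univ m)
        exact sub_eq_zero.1 (abs_eq_zero.1 this)
      simp [this]
    · rw [← div_le_iff₀ h0]
      exact (ENNReal.ofReal_le_iff_le_toReal hω).1
        (le_iSup₂ (f := fun i j => ENNReal.ofReal
          (|f (e i) ω - f (e j) ω| / ∑ m, |e i m - e j m|)) i j)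
  have happ : ∀ z ∈ X, Filter.Tendsto (fun N => SimpleFunc.nearestPt e N z) Filter.atTop
      (nhdsWithin z X) := fun z hz =>
    tendsto_nhdsWithin_iff.2 ⟨SimpleFunc.tendsto_nearestPt (he hz), .of_forall fun N => heX _⟩
  have hcoord : ∀ z ∈ X, ∀ m, Filter.Tendsto (fun N => SimpleFunc.nearestPt e N z m)
      Filter.atTop (nhds (z m)) := fun z hz m =>
    ((EuclideanSpace.proj (𝕜 := ℝ) m).continuous.tendsto z).comp
      (SimpleFunc.tendsto_nearestPt (he hz))
  refine le_of_tendsto_of_tendsto'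
    (((((hc x hx).tendsto.comp (happ x hx)).sub ((hc y hy).tendsto.comp (happ y hy))).abs))
    (Filter.Tendsto.const_mul _ (tendsto_finsetSum _ fun m _ =>
      ((hcoord x hx m).sub (hcoord y hy m)).abs)) fun N => ?_
  exact hpair (SimpleFunc.nearestPtInd e N x) (SimpleFunc.nearestPtInd e N y)

/-! ### Finite nets of compact convex sets -/

lemma exists_abs_sub_center_le {r : ℝ} (hr : 0 < r) {n : ℕ} (hn : 0 < n) {x : ℝ}
    (hx : x ∈ Set.Icc 0 r) : ∃ i : Fin n, |x - (i + 1 / 2) * (r / n)| ≤ r / (2 * n) := by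
  have hn' : (0 : ℝ) < n := by exact_mod_cast hn
  have hcell : ∃ i : Fin n, (i : ℝ) ≤ x * n / r ∧ x * n / r ≤ i + 1 := by
    have h0 : 0 ≤ x * n / r := div_nonneg (mul_nonneg hx.1 hn'.le) hr.le
    -- The right endpoint `r` would fall outside the `n` cells and is assigned to the last one.
    rcases hx.2.eq_or_lt with rfl | hlt
    · refine ⟨⟨n - 1, by omega⟩, ?_, ?_⟩ <;>
      · rw [mul_div_cancel_left₀ _ hr.ne', Nat.cast_sub hn]
        simp
    · refine ⟨⟨⌊x * n / r⌋₊, ?_⟩, Nat.floor_le h0, (Nat.lt_floor_add_one _).le⟩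
      rw [Nat.floor_lt h0, div_lt_iff₀ hr, mul_comm]
      exact mul_lt_mul_of_pos_left hlt hn'
  obtain ⟨i, h1, h2⟩ := hcell
  refine ⟨i, ?_⟩
  rw [le_div_iff₀ hr] at h1
  rw [div_le_iff₀ hr] at h2
  have e1 : x - (i + 1 / 2) * (r / n) = (x * n - (i + 1 / 2) * r) / n := by field_simp
  have e2 : r / (2 * n) = r / 2 / n := by field_simp
  rw [e1, e2, abs_div, abs_of_pos hn']
  refine div_le_div_of_nonneg_right (abs_le.2 ⟨?_, ?_⟩) hn'.le <;> linarith

lemma sum_abs_le_sqrt_mul_norm {d : ℕ} (x : Pt d) : ∑ j, |x j| ≤ √d * ‖x‖ := by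
  rw [EuclideanSpace.norm_eq, ← Real.sqrt_mul (Nat.cast_nonneg d)]
  refine Real.le_sqrt_of_sq_le ((sq_sum_le_card_mul_sum_sq (s := Finset.univ)
    (f := fun j => |x j|)).trans_eq ?_)
  simp

/-- The metric projection onto a closed convex set does not increase distances to its points. -/
lemma exists_projection {d : ℕ} {X : Set (Pt d)} (hne : X.Nonempty) (hX : IsClosed X)
    (hconv : Convex ℝ X) (u : Pt d) : ∃ v ∈ X, ∀ x ∈ X, ‖x - v‖ ≤ ‖x - u‖ := by
  obtain ⟨v, hv, hmin⟩ := exists_norm_eq_iInf_of_complete_convex hne hX.isComplete hconv u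
  refine ⟨v, hv, fun x hx => ?_⟩
  have hle := (norm_eq_iInf_iff_real_inner_le_zero hconv hv).1 hmin x hx
  have hsq : ‖x - u‖ ^ 2 = ‖x - v‖ ^ 2 - 2 * inner ℝ (u - v) (x - v) + ‖u - v‖ ^ 2 := by
    have : x - u = (x - v) - (u - v) := by abel
    rw [this, norm_sub_sq_real, real_inner_comm]
  refine abs_le_of_sq_le_sq' ?_ (norm_nonneg _) |>.2
  nlinarith [sq_nonneg ‖u - v‖]

/-- A compact convex subset of the box `[0, r]^d` has an internal net of at most `n ^ d` points with
`ℓ¹` mesh at most `d * r / (2 * n)`. -/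
lemma exists_net {d : ℕ} {X : Set (Pt d)} (hne : X.Nonempty) (hX : IsClosed X)
    (hconv : Convex ℝ X) {r : ℝ} (hr : 0 < r) (hbox : ∀ x ∈ X, ∀ j, x j ∈ Set.Icc 0 r) {n : ℕ}
    (hn : 0 < n) : ∃ N : Finset (Pt d), (∀ x ∈ N, x ∈ X) ∧ N.card ≤ n ^ d ∧
      ∀ x ∈ X, ∃ y ∈ N, ∑ j, |x j - y j| ≤ d * r / (2 * n) := by
  classical
  choose proj hprojX hproj using exists_projection hne hX hconv
  set center : (Fin d → Fin n) → Pt d := fun g =>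
    WithLp.toLp 2 fun j => ((g j : ℝ) + 1 / 2) * (r / n) with hcenter
  refine ⟨Finset.univ.image fun g => proj (center g), ?_, ?_, ?_⟩
  · intro x hx
    obtain ⟨g, -, rfl⟩ := Finset.mem_image.1 hx
    exact hprojX _
  · exact Finset.card_image_le.trans_eq (by simp)
  · intro x hx
    choose g hg using fun j => exists_abs_sub_center_le hr hn (hbox x hx j)
    -- Cell centres may lie outside `X`. Projecting them costs nothing here: the Euclidean distance
    -- to `x` stays at most `√d · r/(2n)`, and passing to `ℓ¹` costs a further `√d`.
    refine ⟨proj (center g), Finset.mem_image_of_mem _ (Finset.mem_univ _), ?_⟩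
    have hρ : 0 ≤ r / (2 * n) := by positivity
    have hnorm : ‖x - center g‖ ≤ √d * (r / (2 * n)) := by
      rw [EuclideanSpace.norm_eq, ← Real.sqrt_sq hρ, ← Real.sqrt_mul (Nat.cast_nonneg d)]
      refine Real.sqrt_le_sqrt ((Finset.sum_le_sum fun j _ => ?_).trans_eq
        (show ∑ _j : Fin d, (r / (2 * n)) ^ 2 = _ by simp))
      rw [Real.norm_eq_abs]
      exact pow_le_pow_left₀ (abs_nonneg _) (hg j) 2
    calc ∑ j, |x j - proj (center g) j| ≤ √d * ‖x - proj (center g)‖ :=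
          sum_abs_le_sqrt_mul_norm (x - proj (center g))
      _ ≤ √d * (√d * (r / (2 * n))) := by
          have := (hproj (center g) x hx).trans hnorm
          gcongr
      _ = d * r / (2 * n) := by
          rw [← mul_assoc, Real.mul_self_sqrt (Nat.cast_nonneg d), mul_div_assoc]

/-! ### Continuous domains -/

lemma betaContinuous_mono {d : ℕ} (hd : 0 < d) {r a b : ℝ} (hr : 0 < r) (hb : 0 < b) {m n : ℕ}
    (hm : 1 ≤ m) (hmn : m ≤ n) : betaContinuous d r a b m ≤ betaContinuous d r a b n := by
  have : (0 : ℝ) < m := by exact_mod_cast hm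
  have : (0 : ℝ) < d := by exact_mod_cast hd
  unfold betaContinuous
  gcongr

lemma exp_half_betaContinuous {d : ℕ} (hd : 0 < d) {r a b : ℝ} (hr : 0 < r) (hb : 0 < b) {t : ℕ}
    (ht : 0 < t) : Real.exp (betaContinuous d r a b t / 2) =
      (b * d * r * (t : ℝ) ^ 2 * (√(Real.log (a * d)) + √Real.pi / 2)) ^ d * (t : ℝ) ^ 2 /
        √(2 * Real.pi) := by
  have : (0 : ℝ) < t := by exact_mod_cast ht
  have : (0 : ℝ) < d := by exact_mod_cast hd
  set c := b * d * r * (t : ℝ) ^ 2 * (√(Real.log (a * d)) + √Real.pi / 2) with hc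
  have hc0 : 0 < c := by positivity
  have hβ : betaContinuous d r a b t / 2 =
      d * Real.log c + Real.log ((t : ℝ) ^ 2 / √(2 * Real.pi)) := by
    rw [betaContinuous, ← hc]
    ring
  rw [hβ, Real.exp_add, Real.exp_nat_mul, Real.exp_log hc0, Real.exp_log (by positivity),
    mul_div_assoc]

/-- The regret of GP-UCB on a continuous domain is summable up to the confidence widths. -/
lemma DerivTail.stepBound {d : ℕ} {Ω : Type*} [MeasurableSpace Ω] {P : Measure Ω}
    [IsProbabilityMeasure P] {X : Set (Pt d)} {f : Pt d → Ω → ℝ} {r a b : ℝ}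
    (h : DerivTail P X f r a b) (hd : 0 < d) (hX : X.Nonempty) {Λ : Ω → ℝ} (hΛi : Integrable Λ P)
    (hΛ0 : ∀ ω, 0 ≤ Λ ω)
    (hΛ : ∀ᵐ ω ∂P, ∀ x ∈ X, ∀ y ∈ X, |f x ω - f y ω| ≤ Λ ω * ∑ j, |x j - y j|)
    (hΛE : ∫ ω, Λ ω ∂P ≤ b * (√(Real.log (a * d)) + √Real.pi / 2)) {t : ℕ} (ht : 0 < t) :
    StepBound P X f (betaContinuous d r a b t) (2 / (t : ℝ) ^ 2) := by
  have hr := h.r_pos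
  have hb := h.b_pos
  have ht' : (0 : ℝ) < t := by exact_mod_cast ht
  have hd' : (0 : ℝ) < d := by exact_mod_cast hd
  have hlip : ∀ {ρ : ℝ} {ω : Ω} {x y : Pt d}, |f x ω - f y ω| ≤ Λ ω * ∑ j, |x j - y j| →
      ∑ j, |x j - y j| ≤ ρ → f x ω ≤ f y ω + Λ ω * ρ := fun {ρ ω x y} h1 h2 => by
    have := mul_le_mul_of_nonneg_left h2 (hΛ0 ω)
    linarith [le_abs_self (f x ω - f y ω)]
  set K := b * (√(Real.log (a * d)) + √Real.pi / 2) with hK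
  have hK0 : 0 < K := by positivity
  set τ := b * d * r * (t : ℝ) ^ 2 * (√(Real.log (a * d)) + √Real.pi / 2) with hτ
  have hτK : τ = d * r * (t : ℝ) ^ 2 * K := by rw [hτ, hK]; ring
  have hτ0 : 0 < τ := by positivity
  -- `τ` is the base of the `d`-th power in `exp(β/2)`, and equals `d r t²` times the bound `K` for
  -- the mean Lipschitz constant. A mesh of `d r/τ` thus costs `1/t²` in mean.
  rcases le_or_gt 1 τ with h1 | h1
  -- Cell centres halve the mesh, so `τ/2` cells per side suffice; the slack makes the rounded
  -- number at most `τ`, and the net has at most `τ ^ d` points.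
  · set n := ⌈τ / 2⌉₊ with hn
    have hn0 : 0 < n := Nat.ceil_pos.2 (by positivity)
    have hn1 : τ / 2 ≤ n := Nat.le_ceil _
    have hn2 : (n : ℝ) ≤ τ := by
      rcases le_or_gt τ 2 with h2 | h2
      · have : n ≤ 1 := Nat.ceil_le.2 (by norm_num; linarith)
        have : (n : ℝ) ≤ 1 := by exact_mod_cast this
        linarith
      · have := Nat.ceil_lt_add_one (show 0 ≤ τ / 2 by positivity)
        linarith
    obtain ⟨N, hNX, hNc, hN⟩ := exists_net hX h.compact.isClosed h.convex hr h.subset_box hn0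
    refine .inl ⟨N, fun ω => Λ ω * (d * r / τ), hNX, hΛi.mul_const _, ?_, ?_⟩
    · filter_upwards [hΛ] with ω hω x hx
      obtain ⟨y, hy, hxy⟩ := hN x hx
      refine ⟨y, hy, hlip (hω x hx y (hNX y hy)) (hxy.trans ?_)⟩
      gcongr
      linarith
    · have e1 : (N.card : ℝ) * (Real.exp (-√(betaContinuous d r a b t) ^ 2 / 2) /
          √(2 * Real.pi)) ≤ 1 / (t : ℝ) ^ 2 := by
        refine mul_gaussian_tail_le ht' ?_
        rw [exp_half_betaContinuous hd hr hb ht, ← hτ]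
        have : (N.card : ℝ) ≤ τ ^ d :=
          (show (N.card : ℝ) ≤ (n : ℝ) ^ d by exact_mod_cast hNc).trans (by gcongr)
        gcongr
      have e2 : ∫ ω, Λ ω * (d * r / τ) ∂P ≤ 1 / (t : ℝ) ^ 2 := by
        rw [integral_mul_const]
        refine (mul_le_mul_of_nonneg_right hΛE (by positivity)).trans_eq ?_
        rw [hτK]
        field_simp
      refine (add_le_add e1 e2).trans_eq ?_
      ring
  -- When `τ < 1` the whole box has `ℓ¹` diameter at most `d r`, and the mean oscillation `K d r =
  -- τ/t²` is already below the allowance.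
  · refine .inr ⟨fun ω => Λ ω * (d * r), hΛi.mul_const _, ?_, ?_⟩
    · filter_upwards [hΛ] with ω hω x hx y hy
      refine hlip (hω x hx y hy) ?_
      refine (Finset.sum_le_sum fun j _ => ?_).trans_eq (show ∑ _j : Fin d, r = d * r by simp)
      have hxj := h.subset_box x hx j
      have hyj := h.subset_box y hy j
      exact abs_le.2 ⟨by linarith [hxj.1, hyj.2], by linarith [hxj.2, hyj.1]⟩
    · rw [integral_mul_const, le_div_iff₀ (by positivity)]
      have : (∫ ω, Λ ω ∂P) * (d * r) * (t : ℝ) ^ 2 ≤ K * (d * r) * (t : ℝ) ^ 2 := by gcongr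
      linarith

theorem IsGPModel.regret_bound_continuous {d : ℕ} {Ω : Type*} [MeasurableSpace Ω] {P : Measure Ω}
    [IsProbabilityMeasure P] {X : Set (Pt d)} {k : Pt d → Pt d → ℝ} {s : ℝ≥0}
    {f : Pt d → Ω → ℝ} {ε : ℕ → Ω → ℝ} {π : Rule d} (hm : IsGPModel P X k s f ε) (hs : 0 < s)
    (hunit : ∀ x ∈ X, k x x = 1) {xstar : Ω → Pt d}
    (hxstar : ∀ᵐ ω ∂P, xstar ω ∈ X ∧ IsMaxOn (fun x => f x ω) X (xstar ω)) (hX : X.Infinite)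
    {r a b : ℝ} (h : DerivTail P X f r a b) (hπ : IsGPUCB X k s (betaContinuous d r a b) π)
    (T : ℕ) :
    maxInfoGain P X f ε T ≠ ∞ ∧ Integrable (cumRegret π f ε xstar T) P ∧
      bcr P π f ε xstar T ≤ Real.pi ^ 2 / 3 +
        √(constC1 s * T * betaContinuous d r a b T * (maxInfoGain P X f ε T).toReal) := by
  -- In dimension zero the space is a single point, so `X` could not be infinite.
  have hd : 0 < d := by
    rw [Nat.pos_iff_ne_zero]
    rintro rfl
    exact hX (Set.toFinite X)
  obtain ⟨x₀, hx₀⟩ := hX.nonempty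
  obtain ⟨Λ, hΛi, hΛ0, hΛ, hΛE⟩ := h.exists_lipschitz hd ⟨x₀, hx₀⟩ hm.measurable_f
  have hcont : ∀ᵐ ω ∂P, ContinuousOn (fun x => f x ω) X := by
    obtain ⟨G, hG, -⟩ := h.tail
    filter_upwards [hG] with ω hω x hx
    exact (hω x hx).continuousWithinAt
  have hM : ∀ᵐ ω ∂P, ∀ x ∈ X, |f x ω| ≤ |f x₀ ω| + Λ ω * (d * r) := by
    filter_upwards [hΛ] with ω hω x hx
    have h1 : ∑ j, |x j - x₀ j| ≤ d * r := by
      refine (Finset.sum_le_sum fun j _ => ?_).trans_eq (show ∑ _j : Fin d, r = d * r by simp)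
      have hxj := h.subset_box x hx j
      have hyj := h.subset_box x₀ hx₀ j
      exact abs_le.2 ⟨by linarith [hxj.1, hyj.2], by linarith [hxj.2, hyj.1]⟩
    have h2 := (hω x hx x₀ hx₀).trans (mul_le_mul_of_nonneg_left h1 (hΛ0 ω))
    linarith [abs_sub_abs_le_abs_sub (f x ω) (f x₀ ω)]
  obtain ⟨h1, h2, h3⟩ := hm.regret_bound hs h.compact.isClosed.measurableSet hunit hcont hπ
    (fun m n hm hmn => betaContinuous_mono hd h.r_pos h.b_pos hm hmn) hxstar
    (((hm.memLp_f hx₀).integrable one_le_two).abs.add (hΛi.mul_const _)) hM zero_le_two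
    (fun n => h.stepBound hd ⟨x₀, hx₀⟩ hΛi hΛ0 hΛ hΛE n.succ_pos) T
  exact ⟨h1, h2, h3.trans_eq (by ring)⟩

end GPUCB

/-! ### The main theorem. -/

theorem theorem5 {d : ℕ} {Ω : Type*} [MeasurableSpace Ω] (P : Measure Ω) [IsProbabilityMeasure P]
    (X : Set (GPUCB.Pt d)) (k : GPUCB.Pt d → GPUCB.Pt d → ℝ) (s : ℝ≥0) (hs : 0 < s)
    (f : GPUCB.Pt d → Ω → ℝ) (ε : ℕ → Ω → ℝ) (hmodel : GPUCB.IsGPModel P X k s f ε)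
    (hstat : GPUCB.IsStationaryOn X k) (hunit : ∀ x ∈ X, k x x = 1)
    (xstar : Ω → GPUCB.Pt d)
    (hxstar : ∀ᵐ ω ∂P, xstar ω ∈ X ∧ IsMaxOn (fun x => f x ω) X (xstar ω)) :
    -- (i) finite domain
    (X.Finite → ∀ π : GPUCB.Rule d, GPUCB.IsGPUCB X k s (GPUCB.betaFinite X.ncard) π → ∀ T : ℕ,
      GPUCB.maxInfoGain P X f ε T ≠ ∞ ∧
      Integrable (GPUCB.cumRegret π f ε xstar T) P ∧
      GPUCB.bcr P π f ε xstar T ≤ Real.pi ^ 2 / 6 +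
        Real.sqrt (GPUCB.constC1 s * T * GPUCB.betaFinite X.ncard T *
          (GPUCB.maxInfoGain P X f ε T).toReal)) ∧
    -- (ii) continuous domain
    (X.Infinite → ∀ r a b : ℝ, GPUCB.DerivTail P X f r a b →
      ∀ π : GPUCB.Rule d, GPUCB.IsGPUCB X k s (GPUCB.betaContinuous d r a b) π → ∀ T : ℕ,
      GPUCB.maxInfoGain P X f ε T ≠ ∞ ∧
      Integrable (GPUCB.cumRegret π f ε xstar T) P ∧
      GPUCB.bcr P π f ε xstar T ≤ Real.pi ^ 2 / 3 +
        Real.sqrt (GPUCB.constC1 s * T * GPUCB.betaContinuous d r a b T *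
          (GPUCB.maxInfoGain P X f ε T).toReal)) ∧
    -- dependence on the constant `a` in the continuous case
    (∀ (r b : ℝ) (t : ℕ), (fun a : ℝ => GPUCB.betaContinuous d r a b t) =O[Filter.atTop]
      (fun a : ℝ => Real.log (Real.log a))) := by
  refine ⟨fun hX π hπ T => ?_, fun hX r a b h π hπ T => ?_, GPUCB.betaContinuous_isBigO d⟩
  · exact hmodel.regret_bound_finite hs hunit hxstar hX hπ T
  · exact hmodel.regret_bound_continuous hs hunit hxstar hX h hπ T
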